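/- Let $\mathfrak g$ be a finite-dimensional simple complex Lie algebra, $G$ the connected simply connected complex Lie group with Lie algebra $\mathfrak g$, and $\mathrm{Cent}(G)$ its centre. Let $\mathfrak h\subset\mathfrak g$ be a Cartan subalgebra, $\Delta$ the set of roots, $\Pi=\{\alpha_1,\dots,\alpha_n\}$ a set of simple roots, $\Delta^+$ the positive roots, $\theta=\sum_i m_i\alpha_i$ the highest root, and $\mathfrak b=\mathfrak h\oplus\bigoplus_{\alpha\in\Delta^+}\mathfrak g_\alpha$ the corresponding Borel subalgebra. Let $\omega_1^\vee,\dots,\omega_n^\vee\in\mathfrak h$ be the basis dual to $\Pi$, $P^\vee=\sum_i\mathbb Z\omega_i^\vee$, $J=\{i\mid m_i=1\}$, and $$X=\{\tau\in P^\vee\mid \alpha_i(\tau)\ge 0\ (1\le i\le n),\ \theta(\tau)\le 2\}.$$ For $\tau\in P^\vee$ put $\Delta_\tau^k=\{\alpha\in\Delta^+\mid\alpha(\tau)=k\}$ and $V_\tau=\{\alpha\in\Delta^+\mid\alpha(\tau)>0\}$; for $\Phi\subseteq\Delta^+$ put $\mathfrak i(\Phi)=\bigoplus_{\alpha\in\Phi}\mathfrak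 g_\alpha$; for a subspace $\mathfrak i\subseteq\mathfrak g$ put $\Phi_{\mathfrak i}=\{\alpha\in\Delta^+\mid\mathfrak g_\alpha\subseteq\mathfrak i\}$. An abelian ideal $\mathfrak i$ of $\mathfrak b$ is called special if $\Phi_{\mathfrak i}=\Delta_\tau^2$ for some $\tau\in X$. Let $\mathfrak i$ be an abelian ideal of $\mathfrak b$ and let $$C_{\mathfrak i}=\{\omega\in\{\omega_i^\vee\mid i\in J\}\cup\{0\}\ \mid\ \Phi_{\mathfrak i}\subseteq V_\omega\}.$$ Then $\mathrm{Cent}(G)$ is finite, and there are exactly $|\mathrm{Cent}(G)|-|C_{\mathfrak i}|$ decompositions $$\mathfrak i=\mathfrak i(\Delta_\tau^2)+\mathfrak s,\qquad \tau\in X,$$ with $\mathfrak i(\Delta_\tau^2)$ a nonzero special abelian ideal and $\mathfrak s$ a subspace of $\mathfrak i(\Delta_\tau^1)$; here a decomposition is the pair of subspaces $(\mathfrak i(\Delta_\tau^2),\mathfrak s)$. -/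

import Mathlib

open Module LieAlgebra LieAlgebra.IsKilling

namespace LieDecomp

noncomputable section

/-! ### The connected simply connected group with a given semisimple Lie algebra -/

section Group

attribute [local instance] LieRing.ofAssociativeRing

/-- The finite-dimensional complex (matrix) representations of `𝔤`. Matrices form a Lie algebra
through the commutator bracket. -/
def MatrixRep (𝔤 : Type*) [LieRing 𝔤] [LieAlgebra ℂ 𝔤] : Type _ :=
  Σ n : ℕ, 𝔤 →ₗ⁅ℂ⁆ Matrix (Fin n) (Fin n) ℂ

/-- The family `(exp (ρ x))_ρ`, where `ρ` runs over all finite-dimensional representations. -/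
def expFamily {𝔤 : Type*} [LieRing 𝔤] [LieAlgebra ℂ 𝔤] (x : 𝔤) :
    (ρ : MatrixRep 𝔤) → GL (Fin ρ.1) ℂ :=
  fun ρ => (Matrix.isUnit_exp (ρ.2 x)).unit

/-- The connected simply connected complex Lie group `G` with Lie algebra `𝔤` (for `𝔤`
semisimple), as an abstract group. As `G` is simply connected, every finite-dimensional
representation `ρ` of `𝔤` is the differential of a unique representation of `G`, and this sends
`exp x` to `exp (ρ x)`; as `G` is complex semisimple, it is a linear group, so that `G` acts
faithfully on the product of all its finite-dimensional representations; as `G` is connected, it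
is generated by `exp 𝔤`. Hence `G` is the group generated by the families `(exp (ρ x))_ρ`,
`x ∈ 𝔤`, where `ρ` runs over all finite-dimensional representations of `𝔤`. (Restricting to the
adjoint representation alone would give the adjoint group.) -/
def simplyConnectedGroup (𝔤 : Type*) [LieRing 𝔤] [LieAlgebra ℂ 𝔤] :
    Subgroup ((ρ : MatrixRep 𝔤) → GL (Fin ρ.1) ℂ) :=
  Subgroup.closure (Set.range expFamily)

/-- The centre `Cent(G)` of `G`. -/
abbrev Cent (𝔤 : Type*) [LieRing 𝔤] [LieAlgebra ℂ 𝔤] : Subgroup (simplyConnectedGroup 𝔤) :=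
  Subgroup.center (simplyConnectedGroup 𝔤)

end Group

/-! ### Roots, coweights, alcoves

Below, `𝔥` is a Cartan subalgebra of the simple Lie algebra `𝔤`, `Δ` is the set of roots (the type
`𝔥.root`), and `b` is a set of simple roots `Π` (`b.support` is the index set `{1, …, n}`). -/

variable {𝔤 : Type*} [LieRing 𝔤] [LieAlgebra ℂ 𝔤] [FiniteDimensional ℂ 𝔤] [LieAlgebra.IsSimple ℂ 𝔤]
  {𝔥 : LieSubalgebra ℂ 𝔤} [𝔥.IsCartanSubalgebra]

/-- The set `Δ⁺` of positive roots. -/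
def posRoots (b : (rootSystem 𝔥).Base) : Set 𝔥.root := {α | b.IsPos α}

/-- `θ` is the highest root: for each root `α`, `θ - α` is a sum of simple roots. -/
def IsHighestRoot (b : (rootSystem 𝔥).Base) (θ : 𝔥.root) : Prop :=
  ∀ α : 𝔥.root, (rootSystem 𝔥).root θ - (rootSystem 𝔥).root α ∈
    AddSubmonoid.closure ((rootSystem 𝔥).root '' b.support)

/-- The fundamental coweights `ω_i^∨`: the basis of `𝔥` dual to the basis of simple roots. -/
def fundCoweight (b : (rootSystem 𝔥).Base) (i : b.support) : 𝔥 :=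
  (Module.evalEquiv ℂ 𝔥).symm (b.toWeightBasis.coord i)

theorem root_fundCoweight (b : (rootSystem 𝔥).Base) (i j : b.support) :
    (j : 𝔥.root).1 (fundCoweight b i) = Finsupp.single j (1 : ℂ) i := by
  have h : (rootSystem 𝔥).root j (fundCoweight b i)
      = b.toWeightBasis.coord i ((rootSystem 𝔥).root j) := by
    rw [fundCoweight, Module.apply_evalEquiv_symm_apply]
  rw [Basis.coord_apply, RootPairing.Base.toWeightBasis_repr_root] at h
  exact h

/-- The coweight lattice `P^∨ = ∑ ℤ ω_i^∨`. -/
def coweightLattice (b : (rootSystem 𝔥).Base) : AddSubgroup 𝔥 :=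
  AddSubgroup.closure (Set.range (fundCoweight b))

/-- The index set `J = {i | m_i = 1}`, where `θ = ∑ m_i α_i` is the highest root. -/
def J (b : (rootSystem 𝔥).Base) : Set b.support :=
  {i | ∃ θ : 𝔥.root, IsHighestRoot b θ ∧ b.toWeightBasis.repr ((rootSystem 𝔥).root θ) i = 1}

/-- The set `{ω_i^∨ | i ∈ J} ∪ {0}`. -/
def minusculeCoweights (b : (rootSystem 𝔥).Base) : Set 𝔥 :=
  fundCoweight b '' J b ∪ {0}

variable (𝔥) in
/-- `𝔥_ℝ`: the elements of `𝔥` on which every root takes a real value. -/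
def realPart : Set 𝔥 := {x | ∀ α : 𝔥.root, (α.1 x).im = 0}

/-- The closed alcove
`{x ∈ 𝔥_ℝ | α(x) ≥ 0 for all simple roots α, and θ(x) ≤ k}`, `θ` the highest root. -/
def closedAlcove (b : (rootSystem 𝔥).Base) (k : ℕ) : Set 𝔥 :=
  {x | x ∈ realPart 𝔥 ∧ (∀ α ∈ b.support, 0 ≤ (α.1 x).re) ∧
    ∃ θ : 𝔥.root, IsHighestRoot b θ ∧ (θ.1 x).re ≤ k}

/-- `X = C̄₂ ∩ P^∨`. -/
def X (b : (rootSystem 𝔥).Base) : Set 𝔥 := closedAlcove b 2 ∩ coweightLattice b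

/-- `Δ_τ^k = {α ∈ Δ⁺ | α(τ) = k}`. -/
def levelRoots (b : (rootSystem 𝔥).Base) (τ : 𝔥) (k : ℕ) : Set 𝔥.root :=
  {α ∈ posRoots b | α.1 τ = k}

/-- `V_ω = {α ∈ Δ⁺ | α(ω) > 0}`, for `ω` in `𝔥_ℝ`. -/
def V (b : (rootSystem 𝔥).Base) (ω : 𝔥) : Set 𝔥.root :=
  {α ∈ posRoots b | 0 < (α.1 ω).re}

/-! ### The Borel subalgebra and its ideals -/

/-- `𝔦(Φ) = ⨁_{α ∈ Φ} 𝔤_α`, a subspace of `𝔤`. -/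
def rootSum (Φ : Set 𝔥.root) : Submodule ℂ 𝔤 :=
  ⨆ α ∈ Φ, (rootSpace 𝔥 α.1).toSubmodule

theorem rootSpace_le_rootSum (b : (rootSystem 𝔥).Base) {α : 𝔥.root} (hα : α ∈ posRoots b) :
    (rootSpace 𝔥 α.1).toSubmodule ≤ rootSum (posRoots b) :=
  le_iSup₂_of_le α hα le_rfl

theorem rootSum_lie_mem (b : (rootSystem 𝔥).Base) {α : 𝔥.root} (hα : α ∈ posRoots b) {x y : 𝔤}
    (hx : x ∈ rootSpace 𝔥 α.1) (hy : y ∈ rootSum (posRoots b)) :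
    ⁅x, y⁆ ∈ rootSum (posRoots b) := by
  suffices h : rootSum (posRoots b) ≤ (rootSum (posRoots b)).comap (LieAlgebra.ad ℂ 𝔤 x)
    from h hy
  refine iSup₂_le fun β hβ z hz => ?_
  have hxz : ⁅x, z⁆ ∈ rootSpace 𝔥 (α.1 + β.1 : 𝔥 → ℂ) :=
    lie_mem_genWeightSpace_of_mem_genWeightSpace hx hz
  change ⁅x, z⁆ ∈ rootSum (posRoots b)
  by_cases h : rootSpace 𝔥 (α.1 + β.1 : 𝔥 → ℂ) = ⊥
  · rw [h] at hxz
    have : ⁅x, z⁆ = 0 := by simpa using hxz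
    simp [this]
  · obtain ⟨γ, hcoe⟩ : ∃ γ : LieModule.Weight ℂ 𝔥 𝔤, (γ : 𝔥 → ℂ) = α.1 + β.1 :=
      ⟨⟨α.1 + β.1, h⟩, rfl⟩
    rw [← hcoe] at hxz
    have hγ0 : γ.IsNonZero := by
      intro h0
      let := (rootSystem 𝔥).indexNeg
      have h1 : (rootSystem 𝔥).root α = (rootSystem 𝔥).root (-β) := by
        rw [RootPairing.indexNeg_neg, RootPairing.root_reflectionPerm, RootPairing.reflection_apply_self]
        ext t
        exact eq_neg_of_add_eq_zero_left (congrFun (hcoe.symm.trans h0) t)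
      have h2 : α = -β := (rootSystem 𝔥).root.injective h1
      have h3 : b.IsPos (-β) := h2 ▸ hα
      exact (RootPairing.Base.IsPos.neg_iff_not b β).1 h3 hβ
    have hγ1 : γ ∈ 𝔥.root := by simpa using hγ0
    have hsum : (rootSystem 𝔥).root ⟨γ, hγ1⟩ = (rootSystem 𝔥).root α + (rootSystem 𝔥).root β := by
      ext t
      exact congrFun hcoe t
    have hγ : (⟨γ, hγ1⟩ : 𝔥.root) ∈ posRoots b := RootPairing.Base.IsPos.add hα hβ hsum
    exact rootSpace_le_rootSum b hγ hxz

theorem cartan_lie_mem (b : (rootSystem 𝔥).Base) {x y : 𝔤} (hx : x ∈ 𝔥)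
    (hy : y ∈ rootSum (posRoots b)) : ⁅x, y⁆ ∈ rootSum (posRoots b) := by
  suffices h : rootSum (posRoots b) ≤ (rootSum (posRoots b)).comap (LieAlgebra.ad ℂ 𝔤 x)
    from h hy
  refine iSup₂_le fun β hβ z hz => ?_
  exact rootSpace_le_rootSum b hβ ((rootSpace 𝔥 β.1).lie_mem (x := ⟨x, hx⟩) hz)

theorem borel_lie_mem (b : (rootSystem 𝔥).Base) {x y : 𝔤}
    (hx : x ∈ 𝔥.toSubmodule ⊔ rootSum (posRoots b))
    (hy : y ∈ 𝔥.toSubmodule ⊔ rootSum (posRoots b)) :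
    ⁅x, y⁆ ∈ 𝔥.toSubmodule ⊔ rootSum (posRoots b) := by
  obtain ⟨x₁, hx₁, x₂, hx₂, rfl⟩ := Submodule.mem_sup.1 hx
  obtain ⟨y₁, hy₁, y₂, hy₂, rfl⟩ := Submodule.mem_sup.1 hy
  have h₁ : ⁅x₂, y₂⁆ ∈ rootSum (posRoots b) := by
    suffices h : rootSum (posRoots b) ≤ (rootSum (posRoots b)).comap (LieAlgebra.ad ℂ 𝔤 y₂) by
      rw [← lie_skew]
      exact neg_mem (h hx₂)
    refine iSup₂_le fun β hβ z hz => ?_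
    change ⁅y₂, z⁆ ∈ rootSum (posRoots b)
    rw [← lie_skew]
    exact neg_mem (rootSum_lie_mem b hβ hz hy₂)
  have h₂ : ⁅x₂, y₁⁆ ∈ rootSum (posRoots b) := by
    rw [← lie_skew]
    exact neg_mem (cartan_lie_mem b hy₁ hx₂)
  have h₃ := cartan_lie_mem b hx₁ hy₂
  rw [add_lie, lie_add, lie_add, add_assoc]
  exact Submodule.add_mem_sup (𝔥.lie_mem hx₁ hy₁) (add_mem h₃ (add_mem h₂ h₁))

/-- The Borel subalgebra `𝔟 = 𝔥 ⊕ 𝔫`, `𝔫 = ⨁_{α ∈ Δ⁺} 𝔤_α`. -/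
def borel (b : (rootSystem 𝔥).Base) : LieSubalgebra ℂ 𝔤 where
  toSubmodule := 𝔥.toSubmodule ⊔ rootSum (posRoots b)
  lie_mem' := borel_lie_mem b

/-- The subspace `𝔦` of `𝔤` is an abelian ideal of `𝔟`. -/
structure IsAbelianIdeal (b : (rootSystem 𝔥).Base) (𝔦 : Submodule ℂ 𝔤) : Prop where
  le_borel : 𝔦 ≤ (borel b).toSubmodule
  lie_mem : ∀ x ∈ borel b, ∀ y ∈ 𝔦, ⁅x, y⁆ ∈ 𝔦
  abelian : ∀ x ∈ 𝔦, ∀ y ∈ 𝔦, ⁅x, y⁆ = 0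

/-- `Φ_𝔦 = {α ∈ Δ⁺ | 𝔤_α ⊆ 𝔦}`. -/
def rootsOf (b : (rootSystem 𝔥).Base) (𝔦 : Submodule ℂ 𝔤) : Set 𝔥.root :=
  {α ∈ posRoots b | (rootSpace 𝔥 α.1).toSubmodule ≤ 𝔦}

/-- A special abelian ideal of `𝔟`: an abelian ideal `𝔦` with `Φ_𝔦 = Δ_τ²` for some `τ ∈ X`. -/
def IsSpecial (b : (rootSystem 𝔥).Base) (𝔦 : Submodule ℂ 𝔤) : Prop :=
  IsAbelianIdeal b 𝔦 ∧ ∃ τ ∈ X b, rootsOf b 𝔦 = levelRoots b τ 2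

/-- `C_𝔦 = {ω ∈ {ω_i^∨ | i ∈ J} ∪ {0} | Φ_𝔦 ⊆ V_ω}`. -/
def C (b : (rootSystem 𝔥).Base) (𝔦 : Submodule ℂ 𝔤) : Set 𝔥 :=
  {ω ∈ minusculeCoweights b | rootsOf b 𝔦 ⊆ V b ω}

/-- The decompositions `𝔦 = 𝔧 + 𝔰`, with `𝔧 = 𝔦(Δ_τ²)` a nonzero special abelian ideal and `𝔰` a
subspace of `𝔦(Δ_τ¹)`, for some `τ ∈ X`. A decomposition is the pair of subspaces `(𝔧, 𝔰)`. -/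
def decompositions (b : (rootSystem 𝔥).Base) (𝔦 : Submodule ℂ 𝔤) :
    Set (Submodule ℂ 𝔤 × Submodule ℂ 𝔤) :=
  {p | ∃ τ ∈ X b, p.1 = rootSum (levelRoots b τ 2) ∧ p.1 ≠ ⊥ ∧ IsSpecial b p.1 ∧
    p.2 ≤ rootSum (levelRoots b τ 1) ∧ 𝔦 = p.1 ⊔ p.2}

end

end LieDecomp

-- Both numbers come from one alcove. An abelian ideal is the sum of its root spaces, and its root
-- set Φ determines an alcove on which a root of Φ takes values between 1 and 2, and every other
-- positive root values between 0 and 1 (`isShi_shi`). A coweight τ in the closure of this alcove is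
-- the same as an element of X with Δ_τ² ⊆ Φ ⊆ Δ_τ¹ ∪ Δ_τ². If Δ_τ² is empty, then τ is zero or
-- minuscule and Φ ⊆ V_τ; these τ form C_𝔦 (`C_eq`). If Δ_τ² is nonempty, then τ gives the
-- decomposition with 𝔰 = 𝔦(Φ ∩ Δ_τ¹). All decompositions arise in this way (`decompositions_eq`),
-- and Δ_τ² determines τ (`eq_of_levelRoots_two_eq`). So the decompositions together with C_𝔦 count
-- the coweights in the closed alcove.
--
-- Every closed alcove contains [P^∨ : Q^∨] coweights, one in each coset of the coroot lattice Q^∨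
-- (`alcoveVertices_bijective`). Existence: the element of the coset closest to the middle of the
-- alcove violates no wall. Uniqueness: two of them differ by an element of Q^∨ on which all roots
-- have absolute value at most 1, and such an element is zero.
--
-- It remains to see that |Cent(G)| = [P^∨ : Q^∨] (`card_center`). The map h ↦ exp(2πi h) sends P^∨
-- to the centre, because exp(2πi h) acts trivially on the adjoint module. It has kernel Q^∨ and is
-- onto. Both of these facts use finite-dimensional modules whose highest weights are the
-- fundamental weights (`exists_finiteDimensional`), and a central element is determined by its
-- scalars on highest weight vectors (`eq_one_of_mem_center`).
--
-- Modules of arbitrary highest weight φ are built without a basis of the enveloping algebra U. If v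
-- is a highest weight vector of weight φ and ξ a form of weight φ killing 𝔫⁻M with ξ(v) = 1, then
-- ξ(uv) is a polynomial in φ for each u ∈ U. Tensor products of known modules supply a Zariski
-- dense set of such φ, so the identities satisfied by these polynomials persist at every φ. This
-- gives a form on U for every φ, and the quotient of U by the largest left ideal in its kernel is
-- the module. For dominant integral φ its weights are stable under the Weyl group, and averaging
-- over that group bounds their depth. Complete reducibility is replaced by E = E^𝔤 + 𝔤E
-- (`invariants_sup_span_lie_eq_top`).

universe u v w

set_option linter.unusedSectionVars false

/-! ### Levels of roots and Shi coordinates -/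

namespace RootPairing

variable {ι K M N : Type*} [Fintype ι] [Field K] [CharZero K] [AddCommGroup M] [Module K M]
  [AddCommGroup N] [Module K N] {P : RootPairing ι K M N} [P.IsCrystallographic]

variable (P) in
/-- Integral functions on the roots which transform like the restriction of a linear form. -/
def IsLevel (l : ι → ℤ) : Prop :=
  ∀ i j, l (P.reflectionPerm j i) = l i - P.pairingIn ℤ i j * l j

theorem isLevel_pairingIn (j : ι) : P.IsLevel (fun i => P.pairingIn ℤ i j) := by
  intro i k
  have h := P.pairing_reflectionPerm k i j
  apply (algebraMap ℤ K).injective_int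
  simp only [map_sub, map_mul, P.algebraMap_pairingIn]
  rw [← P.root_coroot_eq_pairing (P.reflectionPerm k i) j, P.root_reflectionPerm,
    P.reflection_apply_root]
  simp

theorem IsLevel.add {l l' : ι → ℤ} (h : P.IsLevel l) (h' : P.IsLevel l') :
    P.IsLevel (l + l') := by
  intro i j
  simp only [Pi.add_apply, h i j, h' i j]
  ring

theorem IsLevel.sub {l l' : ι → ℤ} (h : P.IsLevel l) (h' : P.IsLevel l') :
    P.IsLevel (l - l') := by
  intro i j
  simp only [Pi.sub_apply, h i j, h' i j]
  ring

theorem IsLevel.neg {l : ι → ℤ} (h : P.IsLevel l) (i : ι) :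
    l (P.reflectionPerm i i) = - l i := by
  rw [h i i, P.pairingIn_same]; ring

variable (P) in
/-- The sum of the pairings with the coroots in a list. -/
noncomputable def corootLevel (s : List ι) : ι → ℤ := fun i => (s.map fun j => P.pairingIn ℤ i j).sum

@[simp] theorem corootLevel_nil : P.corootLevel [] = 0 := by ext; simp [corootLevel]

@[simp] theorem corootLevel_cons (j : ι) (s : List ι) :
    P.corootLevel (j :: s) = (fun i => P.pairingIn ℤ i j) + P.corootLevel s := by
  ext; simp [corootLevel]

theorem isLevel_corootLevel (s : List ι) : P.IsLevel (P.corootLevel s) := by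
  induction s with
  | nil => intro i j; simp
  | cons j s ih => rw [corootLevel_cons]; exact (isLevel_pairingIn j).add ih

theorem pairingIn_reflectionPerm_left (i j : ι) :
    P.pairingIn ℤ (P.reflectionPerm j i) j = - P.pairingIn ℤ i j := by
  have h := isLevel_pairingIn (P := P) j i j
  simp only [P.pairingIn_same] at h
  rw [h]; ring

/-- Reindexing by the reflection in j turns the left side into its negative plus the right side. For
the Weyl-invariant form (l, l') = ∑ l_i l'_i this says that pairing with the coroot of j is a
nonnegative multiple of l_j. -/
theorem two_mul_sum_level_mul_pairingIn {l : ι → ℤ} (h : P.IsLevel l) (j : ι) :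
    2 * ∑ i, l i * P.pairingIn ℤ i j = l j * ∑ i, P.pairingIn ℤ i j ^ 2 := by
  have key : ∑ i, l i * P.pairingIn ℤ i j
      = ∑ i, (l i - P.pairingIn ℤ i j * l j) * (- P.pairingIn ℤ i j) := by
    rw [← (P.reflectionPerm j).sum_comp]
    exact Finset.sum_congr rfl fun i _ => by rw [h i j, pairingIn_reflectionPerm_left]
  have h2 : ∑ i, (l i - P.pairingIn ℤ i j * l j) * (- P.pairingIn ℤ i j)
      = - ∑ i, l i * P.pairingIn ℤ i j + l j * ∑ i, P.pairingIn ℤ i j ^ 2 := by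
    rw [Finset.mul_sum, ← Finset.sum_neg_distrib, ← Finset.sum_add_distrib]
    exact Finset.sum_congr rfl fun i _ => by ring
  linarith

/-- Let λ be the sum of the coroots in `s`. If λ takes the value 1 on some j in `s`, then dropping j
replaces λ by its reflection, which satisfies the same bound with a shorter list. If λ is
nonpositive on all of `s`, then (λ, λ) ≤ 0. -/
theorem corootLevel_eq_zero_of_abs_le_one (n : ℕ) (s : List ι) (hs : s.length = n)
    (h : ∀ i, P.corootLevel s i ≤ 1) : P.corootLevel s = 0 := by
  classical
  induction n generalizing s with
  | zero => simp [List.length_eq_zero_iff.1 hs]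
  | succ n ih =>
    have hl := isLevel_corootLevel (P := P) s
    by_cases hpos : ∃ j ∈ s, 0 < P.corootLevel s j
    · obtain ⟨j, hj, hj0⟩ := hpos
      have hj1 : P.corootLevel s j = 1 := le_antisymm (h j) hj0
      have hperm : P.corootLevel s = P.corootLevel (j :: s.erase j) := by
        ext i
        exact ((List.perm_cons_erase hj).map _).sum_eq
      have hrefl : ∀ i, P.corootLevel (s.erase j) i = P.corootLevel s (P.reflectionPerm j i) := by
        intro i
        have := congrFun hperm i
        rw [corootLevel_cons] at this
        simp only [Pi.add_apply] at this
        rw [hl i j, hj1]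
        linarith
      have h0 := ih (s.erase j) (by rw [List.length_erase_of_mem hj, hs]; rfl)
        fun i => by rw [hrefl]; exact h _
      ext i
      have := hrefl (P.reflectionPerm j i)
      rw [h0] at this
      simpa using this.symm
    · push Not at hpos
      -- Expand only the second factor over a list `t`: each j in it contributes half of λ_j ∑ ⟨i,
      -- j⟩², which is nonpositive.
      have hsum : ∑ i, P.corootLevel s i * P.corootLevel s i ≤ 0 := by
        have : ∀ t : List ι, (∀ j ∈ t, P.corootLevel s j ≤ 0) →
            ∑ i, P.corootLevel s i * P.corootLevel t i ≤ 0 := by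
          intro t ht
          induction t with
          | nil => simp
          | cons j t iht =>
            simp only [corootLevel_cons, Pi.add_apply, mul_add, Finset.sum_add_distrib]
            have h1 := iht fun j hj => ht j (List.mem_cons_of_mem _ hj)
            have h2 := two_mul_sum_level_mul_pairingIn hl j
            have h3 : P.corootLevel s j * ∑ i, P.pairingIn ℤ i j ^ 2 ≤ 0 :=
              mul_nonpos_of_nonpos_of_nonneg (ht j List.mem_cons_self)
                (Finset.sum_nonneg fun i _ => sq_nonneg _)
            linarith
        exact this s hpos
      ext i
      have := (Finset.sum_eq_zero_iff_of_nonneg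
        (fun i _ => mul_self_nonneg (P.corootLevel s i))).1
        (le_antisymm hsum (Finset.sum_nonneg fun i _ => mul_self_nonneg _)) i (Finset.mem_univ i)
      simpa using this

/-- Shi's conditions on the coordinates of an alcove. -/
structure IsShi (P : RootPairing ι K M N) (k : ι → ℤ) : Prop where
  neg : ∀ i, k (P.reflectionPerm i i) = -1 - k i
  add_le : ∀ i j m, P.root m = P.root i + P.root j → k m ≤ k i + k j + 1

/-- The roots i, i + j, …, i + mj all lie on the j-string through i and end at the reflection of i.
The subadditivity condition is applied at each of the m steps. -/
theorem IsShi.le_of_string [P.IsReduced] {k : ι → ℤ} (hk : P.IsShi k) {i j : ι} {m : ℕ}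
    (hm : P.pairingIn ℤ i j = -m) (hli : LinearIndependent K ![P.root j, P.root i]) :
    k (P.reflectionPerm j i) ≤ k i + m * (k j + 1) := by
  have htop : m ≤ P.chainTopCoeff j i := by
    have := P.chainBotCoeff_sub_chainTopCoeff hli
    omega
  have key : ∀ n ≤ m, ∀ q, P.root q = P.root i + n • P.root j → k q ≤ k i + n * (k j + 1) := by
    intro n
    induction n with
    | zero =>
      intro _ q hq
      have : q = i := P.root.injective (by simpa using hq)
      simp [this]
    | succ n ih =>
      intro hn q hq
      obtain ⟨r, hr⟩ := (P.root_add_nsmul_mem_range_iff_le_chainTopCoeff hli (n := n)).2 (by omega)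
      have h1 := ih (by omega) r hr
      have h2 := hk.add_le r j q (by rw [hq, hr, succ_nsmul, add_assoc])
      push_cast
      linarith
  refine key m le_rfl _ ?_
  rw [P.root_reflectionPerm, P.reflection_apply_root, ← P.algebraMap_pairingIn ℤ, hm]
  simp [Nat.cast_smul_eq_nsmul]

/-- For a level function x in place of k + 1/2, the left side would be x_j ∑ ⟨i, j⟩². So the
orthogonal projection of k + 1/2 to the level functions satisfies the upper wall inequality x_j <
k_j + 1. After symmetrising under the reflection in j the inequality holds term by term, and
strictly at i = j. -/
theorem IsShi.sum_lt [P.IsReduced] {k : ι → ℤ} (hk : P.IsShi k) (j : ι) :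
    ∑ i, (2 * k i + 1) * P.pairingIn ℤ i j < (k j + 1) * ∑ i, P.pairingIn ℤ i j ^ 2 := by
  have hsum : ∑ i, (2 * k i + 1) * P.pairingIn ℤ i j
      = ∑ i, (k i - k (P.reflectionPerm j i)) * P.pairingIn ℤ i j := by
    have h1 : ∑ i, (2 * k i + 1) * P.pairingIn ℤ i j
        = ∑ i, (2 * k (P.reflectionPerm j i) + 1) * (- P.pairingIn ℤ i j) := by
      rw [← (P.reflectionPerm j).sum_comp]
      exact Finset.sum_congr rfl fun i _ => by rw [pairingIn_reflectionPerm_left]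
    have h2 : 2 * ∑ i, (k i - k (P.reflectionPerm j i)) * P.pairingIn ℤ i j
        = ∑ i, (2 * k i + 1) * P.pairingIn ℤ i j
          + ∑ i, (2 * k (P.reflectionPerm j i) + 1) * (- P.pairingIn ℤ i j) := by
      rw [Finset.mul_sum, ← Finset.sum_add_distrib]
      exact Finset.sum_congr rfl fun i _ => by ring
    linarith
  rw [hsum, Finset.mul_sum]
  have hself : (k j - k (P.reflectionPerm j j)) * P.pairingIn ℤ j j
      < (k j + 1) * P.pairingIn ℤ j j ^ 2 := by
    rw [hk.neg, P.pairingIn_same]; linarith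
  refine Finset.sum_lt_sum (fun i _ => ?_) ⟨j, Finset.mem_univ j, hself⟩
  by_cases hij : i = j
  · subst hij; exact hself.le
  by_cases hij' : P.root i = - P.root j
  · have hi : i = P.reflectionPerm j j := P.root.injective (by simpa using hij')
    have h3 : P.reflectionPerm j i = j := by rw [hi]; simp
    rw [h3]
    rw [hi, hk.neg, P.pairingIn_reflectionPerm_self_left, P.pairingIn_same]
    linarith
  have hli : LinearIndependent K ![P.root j, P.root i] :=
    IsReduced.linearIndependent P (Ne.symm hij) fun h => hij' (by rw [h, neg_neg])
  rcases le_total (P.pairingIn ℤ i j) 0 with h | h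
  · obtain ⟨m, hm⟩ := Int.eq_ofNat_of_zero_le (neg_nonneg.2 h)
    have hm' : P.pairingIn ℤ i j = -(m : ℤ) := by omega
    have := hk.le_of_string hm' hli
    rw [hm']
    nlinarith [Int.natCast_nonneg m]
  · obtain ⟨m, hm⟩ := Int.eq_ofNat_of_zero_le h
    have hij2 : P.reflectionPerm j i ≠ j := fun hh => hij' (by
      have : i = P.reflectionPerm j j := by
        have := P.reflectionPerm_self j i
        rwa [hh, eq_comm] at this
      rw [this]; simp)
    have hij3 : P.root (P.reflectionPerm j i) ≠ - P.root j := fun hh => hij (by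
      have : P.reflectionPerm j i = P.reflectionPerm j j := P.root.injective (by rw [hh]; simp)
      exact (P.reflectionPerm j).injective this)
    have hli' : LinearIndependent K ![P.root j, P.root (P.reflectionPerm j i)] :=
      IsReduced.linearIndependent P (Ne.symm hij2) fun h => hij3 (by rw [h, neg_neg])
    have hp : P.pairingIn ℤ (P.reflectionPerm j i) j = -(m : ℤ) := by
      rw [pairingIn_reflectionPerm_left, hm]
    have := hk.le_of_string hp hli'
    rw [P.reflectionPerm_self] at this
    rw [hm]
    change (k i - k (P.reflectionPerm j i)) * (m : ℤ) ≤ (k j + 1) * (m : ℤ) ^ 2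
    nlinarith [Int.natCast_nonneg m]

/-- Each coset of the coroot lattice contains a vertex of the alcove with given Shi coordinates. -/
theorem IsShi.exists_corootLevel [P.IsReduced] {k : ι → ℤ} (hk : P.IsShi k) {l : ι → ℤ}
    (hl : P.IsLevel l) : ∃ s : List ι, ∀ i, (l + P.corootLevel s) i ≤ k i + 1 := by
  -- Four times the squared distance to k + 1/2; the factor 4 makes it an integer, so a minimum
  -- exists.
  let F : List ι → ℕ := fun s => (∑ i, (2 * (l + P.corootLevel s) i - 2 * k i - 1) ^ 2).toNat
  have hF : ∀ s, (F s : ℤ) = ∑ i, (2 * (l + P.corootLevel s) i - 2 * k i - 1) ^ 2 := fun s =>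
    Int.toNat_of_nonneg (Finset.sum_nonneg fun i _ => sq_nonneg _)
  obtain ⟨s, hs⟩ : ∃ s, ∀ t, F s ≤ F t := by
    obtain ⟨s, hs⟩ := WellFounded.has_min (InvImage.wf F Nat.lt_wfRel.wf) Set.univ ⟨[], trivial⟩
    exact ⟨s, fun t => not_lt.1 (hs.2 t trivial)⟩
  refine ⟨s, fun j => ?_⟩
  by_contra! hcon
  have hlev := hl.add (isLevel_corootLevel (P := P) s)
  set a := l + P.corootLevel s with ha
  -- If the upper wall of j is violated, subtracting the coroot of j strictly decreases the
  -- distance. The violation is a_j ≥ k_j + 2, and this integrality is needed.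
  have hmin : (F s : ℤ) ≤ F (P.reflectionPerm j j :: s) := by exact_mod_cast hs _
  rw [hF, hF] at hmin
  have hshift : ∀ i, (l + P.corootLevel (P.reflectionPerm j j :: s)) i
      = a i - P.pairingIn ℤ i j := by
    intro i
    simp only [corootLevel_cons, Pi.add_apply, ha, P.pairingIn_reflectionPerm_self_right]
    ring
  simp only [hshift, ← ha] at hmin
  have hexp : ∑ i, (2 * (a i - P.pairingIn ℤ i j) - 2 * k i - 1) ^ 2
      = ∑ i, (2 * a i - 2 * k i - 1) ^ 2 - 4 * (2 * ∑ i, a i * P.pairingIn ℤ i j)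
        + 4 * ∑ i, (2 * k i + 1) * P.pairingIn ℤ i j + 4 * ∑ i, P.pairingIn ℤ i j ^ 2 := by
    simp only [Finset.mul_sum, ← Finset.sum_add_distrib, ← Finset.sum_sub_distrib]
    exact Finset.sum_congr rfl fun i _ => by ring
  rw [hexp, two_mul_sum_level_mul_pairingIn hlev] at hmin
  have h1 := hk.sum_lt j
  have h2 : 0 ≤ ∑ i, P.pairingIn ℤ i j ^ 2 := Finset.sum_nonneg fun i _ => sq_nonneg _
  nlinarith

/-- The upper bound at the root -i is the lower bound at i. -/
theorem IsShi.le_of_forall_le {k l : ι → ℤ} (hk : P.IsShi k) (hl : P.IsLevel l)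
    (h : ∀ i, l i ≤ k i + 1) (i : ι) : k i ≤ l i := by
  have := h (P.reflectionPerm i i)
  rw [hl.neg, hk.neg] at this
  linarith

end RootPairing

/-! ### Coweights and the vertices of alcoves -/

namespace LieDecomp

variable {𝔤 : Type*} [LieRing 𝔤] [LieAlgebra ℂ 𝔤] [FiniteDimensional ℂ 𝔤] [LieAlgebra.IsSimple ℂ 𝔤]
  {𝔥 : LieSubalgebra ℂ 𝔤} [𝔥.IsCartanSubalgebra]

/-- The level `α(τ)` of a root, for `τ` in the coweight lattice. -/
noncomputable def lev (τ : 𝔥) (α : 𝔥.root) : ℤ := ⌊(α.1 τ).re⌋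

theorem lev_eq {τ : 𝔥} {α : 𝔥.root} {n : ℤ} (h : α.1 τ = n) : lev τ α = n := by
  simp [lev, h]

theorem root_apply (α : 𝔥.root) (x : 𝔥) : (rootSystem 𝔥).root α x = α.1 x := rfl

theorem eq_of_root_apply_eq (b : (rootSystem 𝔥).Base) {x y : 𝔥}
    (h : ∀ i : b.support, (i : 𝔥.root).1 x = (i : 𝔥.root).1 y) : x = y := by
  apply (Module.evalEquiv ℂ 𝔥).injective
  apply b.toWeightBasis.ext
  intro i
  simpa using h i

theorem eq_sum_fundCoweight (b : (rootSystem 𝔥).Base) (x : 𝔥) :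
    x = ∑ i : b.support, (i : 𝔥.root).1 x • fundCoweight b i := by
  apply eq_of_root_apply_eq b
  intro j
  have : ∀ y : 𝔥, (j : 𝔥.root).1 y = (rootSystem 𝔥).root j y := fun _ => rfl
  rw [this (∑ i : b.support, (i : 𝔥.root).1 x • fundCoweight b i), map_sum]
  simp only [map_smul, root_apply, root_fundCoweight, smul_eq_mul]
  rw [Finset.sum_eq_single j (fun i _ hij => by simp [hij]) (by simp)]
  simp

theorem mem_coweightLattice_iff (b : (rootSystem 𝔥).Base) {τ : 𝔥} :
    τ ∈ coweightLattice b ↔ ∀ α : 𝔥.root, ∃ n : ℤ, α.1 τ = n := by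
  constructor
  · intro h α
    induction h using AddSubgroup.closure_induction with
    | mem x hx =>
      obtain ⟨i, rfl⟩ := hx
      have hα := b.root_mem_span_int α
      have : ∀ φ ∈ Submodule.span ℤ ((rootSystem 𝔥).root '' b.support),
          ∃ n : ℤ, φ (fundCoweight b i) = n := by
        intro φ hφ
        induction hφ using Submodule.span_induction with
        | mem x hx =>
          obtain ⟨j, hj, rfl⟩ := hx
          have := root_fundCoweight b i ⟨j, hj⟩
          classical
          rw [Finsupp.single_apply] at this
          refine ⟨if ⟨j, hj⟩ = i then 1 else 0, ?_⟩
          rw [root_apply, this]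
          split_ifs <;> simp
        | zero => exact ⟨0, by simp⟩
        | add x y _ _ hx hy =>
          obtain ⟨n, hn⟩ := hx
          obtain ⟨m, hm⟩ := hy
          exact ⟨n + m, by simp [hn, hm]⟩
        | smul a x _ hx =>
          obtain ⟨n, hn⟩ := hx
          exact ⟨a * n, by simp [hn]⟩
      exact this _ hα
    | zero => exact ⟨0, by simp⟩
    | add x y _ _ hx hy =>
      obtain ⟨n, hn⟩ := hx
      obtain ⟨m, hm⟩ := hy
      refine ⟨n + m, ?_⟩
      rw [← root_apply, map_add, root_apply, root_apply, hn, hm]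
      simp
    | neg x _ hx =>
      obtain ⟨n, hn⟩ := hx
      refine ⟨-n, ?_⟩
      rw [← root_apply, map_neg, root_apply, hn]
      simp
  · intro h
    rw [eq_sum_fundCoweight b τ]
    refine sum_mem fun i _ => ?_
    obtain ⟨n, hn⟩ := h i
    rw [hn, Int.cast_smul_eq_zsmul]
    exact AddSubgroup.zsmul_mem _ (AddSubgroup.subset_closure (Set.mem_range_self i)) n

theorem apply_eq_lev {b : (rootSystem 𝔥).Base} {τ : 𝔥} (h : τ ∈ coweightLattice b) (α : 𝔥.root) :
    α.1 τ = lev τ α := by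
  obtain ⟨n, hn⟩ := (mem_coweightLattice_iff b).1 h α
  rw [lev_eq hn, hn]

theorem lev_add {b : (rootSystem 𝔥).Base} {τ σ : 𝔥} (h : τ ∈ coweightLattice b)
    (h' : σ ∈ coweightLattice b) (α : 𝔥.root) : lev (τ + σ) α = lev τ α + lev σ α := by
  apply lev_eq
  rw [← root_apply, map_add, root_apply, root_apply, apply_eq_lev h, apply_eq_lev h']
  simp

theorem lev_sub {b : (rootSystem 𝔥).Base} {τ σ : 𝔥} (h : τ ∈ coweightLattice b)
    (h' : σ ∈ coweightLattice b) (α : 𝔥.root) : lev (τ - σ) α = lev τ α - lev σ α := by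
  apply lev_eq
  rw [← root_apply, map_sub, root_apply, root_apply, apply_eq_lev h, apply_eq_lev h']
  simp

theorem lev_eq_add {b : (rootSystem 𝔥).Base} {τ : 𝔥} (h : τ ∈ coweightLattice b)
    {α β γ : 𝔥.root} (hγ : (rootSystem 𝔥).root γ = (rootSystem 𝔥).root α + (rootSystem 𝔥).root β) :
    lev τ γ = lev τ α + lev τ β := by
  apply lev_eq
  rw [← root_apply, hγ, LinearMap.add_apply, root_apply, root_apply, apply_eq_lev h,
    apply_eq_lev h]
  simp

theorem isLevel_lev {b : (rootSystem 𝔥).Base} {τ : 𝔥} (h : τ ∈ coweightLattice b) :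
    (rootSystem 𝔥).IsLevel (lev τ) := by
  intro α β
  apply lev_eq
  rw [← root_apply, RootPairing.root_reflectionPerm, RootPairing.reflection_apply_root,
    LinearMap.sub_apply, LinearMap.smul_apply, root_apply, root_apply, apply_eq_lev h,
    apply_eq_lev h, ← (rootSystem 𝔥).algebraMap_pairingIn ℤ]
  simp

theorem eq_of_lev_eq {b : (rootSystem 𝔥).Base} {τ σ : 𝔥} (h : τ ∈ coweightLattice b)
    (h' : σ ∈ coweightLattice b) (hl : ∀ α, lev τ α = lev σ α) : τ = σ := by
  apply eq_of_root_apply_eq b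
  intro i
  rw [apply_eq_lev h, apply_eq_lev h', hl]

/-! ### The coroot lattice and the coweights in a closed alcove -/

variable (𝔥) in
/-- The coroot lattice `Q^∨`. -/
noncomputable def corootLattice : AddSubgroup 𝔥 :=
  AddSubgroup.closure (Set.range (rootSystem 𝔥).coroot)

theorem apply_coroot (α β : 𝔥.root) :
    α.1 ((rootSystem 𝔥).coroot β) = ((rootSystem 𝔥).pairingIn ℤ α β : ℤ) := by
  have := (rootSystem 𝔥).algebraMap_pairingIn ℤ α β
  rw [← (rootSystem 𝔥).root_coroot_eq_pairing] at this
  exact this.symm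

theorem corootLattice_le (b : (rootSystem 𝔥).Base) : corootLattice 𝔥 ≤ coweightLattice b := by
  refine (AddSubgroup.closure_le _).2 ?_
  rintro _ ⟨β, rfl⟩
  exact (mem_coweightLattice_iff b).2 fun α => ⟨_, apply_coroot α β⟩

/-- The sum of the coroots in a list. -/
noncomputable def corootSum (s : List 𝔥.root) : 𝔥 := (s.map (rootSystem 𝔥).coroot).sum

theorem corootSum_mem (s : List 𝔥.root) : corootSum s ∈ corootLattice 𝔥 := by
  refine AddSubgroup.list_sum_mem _ fun x hx => ?_
  obtain ⟨β, -, rfl⟩ := List.mem_map.1 hx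
  exact AddSubgroup.subset_closure ⟨β, rfl⟩

/-- A list without signs suffices, since the negative of a coroot is the coroot of the negative
root. -/
theorem exists_corootSum {x : 𝔥} (hx : x ∈ corootLattice 𝔥) : ∃ s : List 𝔥.root, x = corootSum s := by
  induction hx using AddSubgroup.closure_induction with
  | mem x hx => obtain ⟨β, rfl⟩ := hx; exact ⟨[β], by simp [corootSum]⟩
  | zero => exact ⟨[], by simp [corootSum]⟩
  | add x y _ _ hx hy =>
    obtain ⟨s, rfl⟩ := hx
    obtain ⟨t, rfl⟩ := hy
    exact ⟨s ++ t, by simp [corootSum]⟩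
  | neg x hx' hx =>
    obtain ⟨s, rfl⟩ := hx
    clear hx'
    refine ⟨s.map fun β => (rootSystem 𝔥).reflectionPerm β β, ?_⟩
    have : ∀ β, (rootSystem 𝔥).coroot ((rootSystem 𝔥).reflectionPerm β β)
        = - (rootSystem 𝔥).coroot β := by
      intro β
      rw [RootPairing.coroot_reflectionPerm, RootPairing.coreflection_apply_self]
    induction s with
    | nil => simp [corootSum]
    | cons β s ih =>
      simp only [corootSum, List.map_cons, List.sum_cons, neg_add] at ih ⊢
      rw [ih, this]

theorem lev_corootSum (b : (rootSystem 𝔥).Base) (s : List 𝔥.root) :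
    lev (corootSum s) = (rootSystem 𝔥).corootLevel s := by
  induction s with
  | nil =>
    ext α
    apply lev_eq
    simp [corootSum]
  | cons β s ih =>
    ext α
    have h1 : corootSum (β :: s) = (rootSystem 𝔥).coroot β + corootSum s := by simp [corootSum]
    rw [h1, lev_add (b := b) (corootLattice_le b (AddSubgroup.subset_closure ⟨β, rfl⟩))
      (corootLattice_le b (corootSum_mem s)), ih, lev_eq (apply_coroot α β)]
    simp

/-- The coweights which are vertices of the alcove with Shi coordinates `k`. -/
def alcoveVertices (b : (rootSystem 𝔥).Base) (k : 𝔥.root → ℤ) : Set 𝔥 :=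
  {τ | τ ∈ coweightLattice b ∧ ∀ α, k α ≤ lev τ α ∧ lev τ α ≤ k α + 1}

theorem alcoveVertices_finite (b : (rootSystem 𝔥).Base) (k : 𝔥.root → ℤ) :
    (alcoveVertices b k).Finite := by
  refine Set.Finite.of_finite_image (f := lev)
    ((Set.Finite.pi' fun α => Set.finite_Icc (k α) (k α + 1)).subset ?_) ?_
  · rintro _ ⟨τ, hτ, rfl⟩
    exact hτ.2
  · intro τ hτ σ hσ h
    exact eq_of_lev_eq hτ.1 hσ.1 fun α => congrFun h α

theorem eq_zero_of_lev_le_one (b : (rootSystem 𝔥).Base) {x : 𝔥} (hx : x ∈ corootLattice 𝔥)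
    (h : ∀ α, lev x α ≤ 1) : x = 0 := by
  obtain ⟨s, rfl⟩ := exists_corootSum hx
  rw [lev_corootSum b] at h
  have h0 := RootPairing.corootLevel_eq_zero_of_abs_le_one s.length s rfl h
  refine eq_of_lev_eq (b := b) (corootLattice_le b hx) (zero_mem _) fun α => ?_
  rw [lev_corootSum b, h0]
  exact (lev_eq (by simp)).symm

/-- Injective because two coweights in the closed alcove have levels differing by at most 1 at every
root, so a difference in the coroot lattice vanishes; surjective by the minimal distance argument.
-/
theorem alcoveVertices_bijective (b : (rootSystem 𝔥).Base) {k : 𝔥.root → ℤ}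
    (hk : (rootSystem 𝔥).IsShi k) :
    Function.Bijective (fun τ : alcoveVertices b k =>
      (QuotientAddGroup.mk (⟨τ.1, τ.2.1⟩ : coweightLattice b) :
        coweightLattice b ⧸ (corootLattice 𝔥).addSubgroupOf (coweightLattice b))) := by
  constructor
  · rintro ⟨τ, hτ⟩ ⟨σ, hσ⟩ h
    have h1 : -τ + σ ∈ corootLattice 𝔥 :=
      (QuotientAddGroup.eq (s := (corootLattice 𝔥).addSubgroupOf (coweightLattice b))).1 h
    have h2 : σ - τ ∈ corootLattice 𝔥 := by rwa [neg_add_eq_sub] at h1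
    have h3 : σ - τ = 0 := eq_zero_of_lev_le_one b h2 fun α => by
      rw [lev_sub hσ.1 hτ.1]
      have := hτ.2 α
      have := hσ.2 α
      linarith
    exact Subtype.ext (sub_eq_zero.1 h3).symm
  · intro q
    obtain ⟨⟨τ, hτ⟩, rfl⟩ := QuotientAddGroup.mk_surjective q
    obtain ⟨s, hs⟩ := hk.exists_corootLevel (isLevel_lev hτ)
    have hmem : τ + corootSum s ∈ coweightLattice b :=
      add_mem hτ (corootLattice_le b (corootSum_mem s))
    have hlev : lev (τ + corootSum s) = lev τ + (rootSystem 𝔥).corootLevel s := by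
      ext α
      rw [lev_add hτ (corootLattice_le b (corootSum_mem s)), lev_corootSum b]
      rfl
    rw [← hlev] at hs
    refine ⟨⟨τ + corootSum s, hmem, fun α => ⟨hk.le_of_forall_le (isLevel_lev hmem) hs α, hs α⟩⟩, ?_⟩
    refine (QuotientAddGroup.eq.2 ?_).symm
    change -τ + (τ + corootSum s) ∈ corootLattice 𝔥
    rw [neg_add_cancel_left]
    exact corootSum_mem s

theorem ncard_alcoveVertices (b : (rootSystem 𝔥).Base) {k : 𝔥.root → ℤ}
    (hk : (rootSystem 𝔥).IsShi k) :
    (alcoveVertices b k).ncard = (corootLattice 𝔥).relIndex (coweightLattice b) :=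
  Nat.card_congr (Equiv.ofBijective _ (alcoveVertices_bijective b hk))

end LieDecomp

/-! ### Root spaces, positive roots and abelian ideals -/

namespace LieDecomp

variable {𝔤 : Type*} [LieRing 𝔤] [LieAlgebra ℂ 𝔤] [FiniteDimensional ℂ 𝔤] [LieAlgebra.IsSimple ℂ 𝔤]
  {𝔥 : LieSubalgebra ℂ 𝔤} [𝔥.IsCartanSubalgebra]

/-- Take the sl₂-triple of α and a vector x at the top of the α-string through β. This top is at
least one step above β, so the vector of 𝔤_β obtained by lowering x is not killed by e. -/
theorem exists_lie_ne_zero {α β γ : 𝔥.root}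
    (hγ : (rootSystem 𝔥).root γ = (rootSystem 𝔥).root α + (rootSystem 𝔥).root β) :
    ∃ x ∈ rootSpace 𝔥 α.1, ∃ y ∈ rootSpace 𝔥 β.1, ⁅x, y⁆ ≠ 0 := by
  have hα : α.1.IsNonZero := 𝔥.isNonZero_coe_root α
  obtain ⟨x, hx, x_ne0⟩ := (LieModule.chainTop α.1 β.1).exists_ne_zero
  obtain ⟨h, e, f, isSl2, he, hf⟩ := exists_isSl2Triple_of_weight_isNonZero hα
  obtain rfl := isSl2.h_eq_coroot hα he hf
  have prim : isSl2.HasPrimitiveVectorWith x (chainLength α.1 β.1 : ℂ) :=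
    have := LieAlgebra.lie_mem_genWeightSpace_of_mem_genWeightSpace he hx
    ⟨x_ne0, (chainLength_smul _ _ hx).symm,
      by rwa [LieModule.genWeightSpace_add_chainTop _ _ hα] at this⟩
  have htop : 1 ≤ LieModule.chainTopCoeff α.1 β.1 := by
    have hne : rootSpace 𝔥 ((1 : ℤ) • (α.1 : 𝔥 → ℂ) + β.1) ≠ ⊥ := by
      have : ((1 : ℤ) • (α.1 : 𝔥 → ℂ) + β.1) = γ.1 := by
        ext t
        simpa using (congrArg (fun φ : Dual ℂ 𝔥 => φ t) hγ).symm
      rw [this]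
      exact γ.1.2
    have := ((rootSpace_zsmul_add_ne_bot_iff α.1 β.1 hα 1).1 hne).1
    omega
  have hle := chainTopCoeff_le_chainLength α.1 β.1
  obtain ⟨t, ht⟩ : ∃ t, LieModule.chainTopCoeff α.1 β.1 = t + 1 := ⟨_, (Nat.sub_add_cancel htop).symm⟩
  -- The bracket with e is (t + 1)(ℓ - t) fᵗx, where ℓ is the chain length; it is nonzero because t
  -- + 1 ≤ ℓ.
  refine ⟨e, he, ((LieModule.toEnd ℂ 𝔤 𝔤 f) ^ (t + 1)) x, ?_, ?_⟩
  · have := LieAlgebra.toEnd_pow_apply_mem hf hx (t + 1)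
    convert! this using 2
    ext s
    simp [ht]
  · rw [prim.lie_e_pow_succ_toEnd_f]
    refine smul_ne_zero (mul_ne_zero (by exact_mod_cast t.succ_ne_zero) ?_)
      (prim.pow_toEnd_f_ne_zero_of_eq_nat rfl (by omega))
    rw [sub_ne_zero]
    norm_cast
    omega

theorem rootSpace_le_rootSum_iff {Φ : Set 𝔥.root} {α : 𝔥.root} :
    (rootSpace 𝔥 α.1).toSubmodule ≤ rootSum Φ ↔ α ∈ Φ := by
  constructor
  · intro h
    by_contra hα
    have hind : iSupIndep fun β : 𝔥.root => (rootSpace 𝔥 β.1).toSubmodule := by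
      have := (LieModule.iSupIndep_genWeightSpace' ℂ 𝔥 𝔤).comp
        (Subtype.val_injective (p := fun β => β ∈ 𝔥.root))
      exact LieSubmodule.iSupIndep_toSubmodule.2 this
    have hd := hind.disjoint_biSup (x := α) hα
    have hbot := hd le_rfl h
    exact α.1.2 (LieSubmodule.toSubmodule_injective (le_bot_iff.1 hbot))
  · exact fun h => le_iSup₂_of_le α h le_rfl

theorem rootSum_mono {Φ Ψ : Set 𝔥.root} (h : Φ ⊆ Ψ) : rootSum Φ ≤ rootSum Ψ :=
  biSup_mono h

theorem rootSum_le_iff {Φ Ψ : Set 𝔥.root} : rootSum Φ ≤ rootSum Ψ ↔ Φ ⊆ Ψ :=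
  ⟨fun h _ hα => rootSpace_le_rootSum_iff.1 ((rootSpace_le_rootSum_iff.2 hα).trans h), rootSum_mono⟩

theorem rootSum_injective {Φ Ψ : Set 𝔥.root} (h : rootSum Φ = rootSum Ψ) : Φ = Ψ :=
  Set.Subset.antisymm (rootSum_le_iff.1 h.le) (rootSum_le_iff.1 h.ge)

theorem rootSum_union (Φ Ψ : Set 𝔥.root) : rootSum (Φ ∪ Ψ) = rootSum Φ ⊔ rootSum Ψ :=
  iSup_union

theorem rootSum_empty : rootSum (∅ : Set 𝔥.root) = ⊥ := by simp [rootSum]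

theorem disjoint_rootSum {Φ Ψ : Set 𝔥.root} (h : Disjoint Φ Ψ) :
    Disjoint (rootSum Φ) (rootSum Ψ) := by
  have hind : iSupIndep fun β : 𝔥.root => (rootSpace 𝔥 β.1).toSubmodule := by
    have := (LieModule.iSupIndep_genWeightSpace' ℂ 𝔥 𝔤).comp
      (Subtype.val_injective (p := fun β => β ∈ 𝔥.root))
    exact LieSubmodule.iSupIndep_toSubmodule.2 this
  exact hind.disjoint_biSup_biSup h

theorem rootsOf_rootSum (b : (rootSystem 𝔥).Base) {Φ : Set 𝔥.root} (h : Φ ⊆ posRoots b) :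
    rootsOf b (rootSum Φ) = Φ := by
  ext α
  simp only [rootsOf, Set.mem_ofPred_eq, rootSpace_le_rootSum_iff]
  exact ⟨fun h => h.2, fun hα => ⟨h hα, hα⟩⟩

/-- The negative of a root. -/
noncomputable def negRoot (α : 𝔥.root) : 𝔥.root := (rootSystem 𝔥).reflectionPerm α α

@[simp] theorem root_negRoot (α : 𝔥.root) :
    (rootSystem 𝔥).root (negRoot α) = - (rootSystem 𝔥).root α := by
  rw [negRoot, RootPairing.root_reflectionPerm, RootPairing.reflection_apply_self]

@[simp] theorem negRoot_negRoot (α : 𝔥.root) : negRoot (negRoot α) = α :=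
  (rootSystem 𝔥).root.injective (by rw [root_negRoot, root_negRoot, neg_neg])

theorem negRoot_mem_posRoots_iff (b : (rootSystem 𝔥).Base) (α : 𝔥.root) :
    negRoot α ∈ posRoots b ↔ α ∉ posRoots b := by
  have := RootPairing.Base.IsPos.neg_iff_not b α
  rwa [RootPairing.indexNeg_neg] at this

theorem root_mem_closure_of_mem_posRoots (b : (rootSystem 𝔥).Base) {α : 𝔥.root}
    (h : α ∈ posRoots b) :
    (rootSystem 𝔥).root α ∈ AddSubmonoid.closure ((rootSystem 𝔥).root '' b.support) := by
  refine RootPairing.Base.IsPos.induction_on_add (b := b) h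
    (p := fun i => (rootSystem 𝔥).root i ∈ AddSubmonoid.closure ((rootSystem 𝔥).root '' b.support))
    (fun i hi => AddSubmonoid.subset_closure ⟨i, hi, rfl⟩) ?_
  intro i j k hk hi hj
  rw [hk]
  exact add_mem hi (AddSubmonoid.subset_closure (Set.mem_image_of_mem _ hj))

theorem add_mem_posRoots (b : (rootSystem 𝔥).Base) {α β γ : 𝔥.root} (hα : α ∈ posRoots b)
    (hβ : β ∈ posRoots b)
    (hγ : (rootSystem 𝔥).root γ = (rootSystem 𝔥).root α + (rootSystem 𝔥).root β) :
    γ ∈ posRoots b := RootPairing.Base.IsPos.add hα hβ hγ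

theorem simple_mem_posRoots (b : (rootSystem 𝔥).Base) {i : 𝔥.root} (hi : i ∈ b.support) :
    i ∈ posRoots b := b.isPos_of_mem_support hi

theorem exists_root_eq_add {α β : 𝔥.root} {x y : 𝔤} (hx : x ∈ rootSpace 𝔥 α.1)
    (hy : y ∈ rootSpace 𝔥 β.1) (hxy : ⁅x, y⁆ ≠ 0) (hneg : β ≠ negRoot α) :
    ∃ γ : 𝔥.root, (rootSystem 𝔥).root γ = (rootSystem 𝔥).root α + (rootSystem 𝔥).root β ∧
      ⁅x, y⁆ ∈ rootSpace 𝔥 γ.1 := by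
  have hxy' : ⁅x, y⁆ ∈ rootSpace 𝔥 (α.1 + β.1 : 𝔥 → ℂ) :=
    lie_mem_genWeightSpace_of_mem_genWeightSpace hx hy
  have hne : rootSpace 𝔥 (α.1 + β.1 : 𝔥 → ℂ) ≠ ⊥ := fun hbot => by
    rw [hbot] at hxy'; exact hxy (by simpa using hxy')
  obtain ⟨γ, hγ⟩ : ∃ γ : LieModule.Weight ℂ 𝔥 𝔤, (γ : 𝔥 → ℂ) = α.1 + β.1 := ⟨⟨_, hne⟩, rfl⟩
  have hγ1 : γ ∈ 𝔥.root := by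
    have : γ.IsNonZero := by
      intro h0
      apply hneg
      apply (rootSystem 𝔥).root.injective
      rw [root_negRoot]
      ext t
      have := congrFun (hγ.symm.trans h0) t
      exact eq_neg_of_add_eq_zero_right this
    simpa using this
  exact ⟨⟨γ, hγ1⟩, by ext t; exact congrFun hγ t, hγ ▸ hxy'⟩

/-- The conditions on a set of positive roots satisfied by the roots of an abelian ideal. -/
structure IsAbelianRootIdeal (b : (rootSystem 𝔥).Base) (Φ : Set 𝔥.root) : Prop where
  pos : Φ ⊆ posRoots b
  add_mem : ∀ α ∈ Φ, ∀ β ∈ posRoots b, ∀ γ : 𝔥.root,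
    (rootSystem 𝔥).root γ = (rootSystem 𝔥).root α + (rootSystem 𝔥).root β → γ ∈ Φ
  abelian : ∀ α ∈ Φ, ∀ β ∈ Φ, ∀ γ : 𝔥.root,
    (rootSystem 𝔥).root γ ≠ (rootSystem 𝔥).root α + (rootSystem 𝔥).root β

theorem rootSpace_le_of_mem {𝔦 : Submodule ℂ 𝔤} {α : 𝔥.root} {x : 𝔤}
    (hx : x ∈ rootSpace 𝔥 α.1) (hx0 : x ≠ 0) (hi : x ∈ 𝔦) :
    (rootSpace 𝔥 α.1).toSubmodule ≤ 𝔦 := by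
  intro y hy
  obtain ⟨c, hc⟩ := (finrank_eq_one_iff_of_nonzero' (⟨x, hx⟩ : rootSpace 𝔥 α.1)
    (by simpa [Subtype.ext_iff] using hx0)).1
    (finrank_rootSpace_eq_one α.1 (𝔥.isNonZero_coe_root α)) ⟨y, hy⟩
  have : y = c • x := (congrArg Subtype.val hc).symm
  rw [this]
  exact 𝔦.smul_mem c hi

theorem mem_borel_of_mem_posRoots (b : (rootSystem 𝔥).Base) {α : 𝔥.root} (hα : α ∈ posRoots b)
    {x : 𝔤} (hx : x ∈ rootSpace 𝔥 α.1) : x ∈ borel b :=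
  Submodule.mem_sup_right (rootSpace_le_rootSum b hα hx)

theorem mem_borel_of_mem_cartan (b : (rootSystem 𝔥).Base) {x : 𝔤} (hx : x ∈ 𝔥) : x ∈ borel b :=
  Submodule.mem_sup_left hx

theorem IsAbelianIdeal.isAbelianRootIdeal {b : (rootSystem 𝔥).Base} {𝔦 : Submodule ℂ 𝔤}
    (h : IsAbelianIdeal b 𝔦) : IsAbelianRootIdeal b (rootsOf b 𝔦) where
  pos := fun α hα => hα.1
  add_mem := by
    intro α hα β hβ γ hγ
    rw [add_comm] at hγ
    obtain ⟨x, hx, y, hy, hxy⟩ := exists_lie_ne_zero hγ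
    refine ⟨add_mem_posRoots b hβ hα.1 hγ, rootSpace_le_of_mem (x := ⁅x, y⁆) ?_ hxy
      (h.lie_mem x (mem_borel_of_mem_posRoots b hβ hx) y (hα.2 hy))⟩
    have := lie_mem_genWeightSpace_of_mem_genWeightSpace hx hy
    convert! this using 2
    ext t
    exact congrArg (fun φ : Dual ℂ 𝔥 => φ t) hγ
  abelian := by
    intro α hα β hβ γ hγ
    obtain ⟨x, hx, y, hy, hxy⟩ := exists_lie_ne_zero hγ
    exact hxy (h.abelian x (hα.2 hx) y (hβ.2 hy))

theorem rootSum_isAbelianIdeal {b : (rootSystem 𝔥).Base} {Φ : Set 𝔥.root}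
    (h : IsAbelianRootIdeal b Φ) : IsAbelianIdeal b (rootSum Φ) where
  le_borel := (rootSum_mono h.pos).trans le_sup_right
  lie_mem := by
    intro x hx y hy
    suffices hle : rootSum Φ ≤ (rootSum Φ).comap (LieAlgebra.ad ℂ 𝔤 x) from hle hy
    refine iSup₂_le fun α hα z hz => ?_
    change ⁅x, z⁆ ∈ rootSum Φ
    obtain ⟨x₁, hx₁, x₂, hx₂, rfl⟩ := Submodule.mem_sup.1 hx
    rw [add_lie]
    refine add_mem (rootSpace_le_rootSum_iff.2 hα ((rootSpace 𝔥 α.1).lie_mem (x := ⟨x₁, hx₁⟩) hz)) ?_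
    suffices hle : rootSum (posRoots b) ≤ (rootSum Φ).comap (LieAlgebra.ad ℂ 𝔤 z) by
      rw [← lie_skew]
      exact neg_mem (hle hx₂)
    refine iSup₂_le fun β hβ w hw => ?_
    change ⁅z, w⁆ ∈ rootSum Φ
    by_cases h0 : ⁅z, w⁆ = 0
    · rw [h0]; exact zero_mem _
    obtain ⟨γ, hγ, hzw⟩ := exists_root_eq_add hz hw h0 fun hneg => by
      rw [hneg] at hβ
      exact (negRoot_mem_posRoots_iff b α).1 hβ (h.pos hα)
    exact rootSpace_le_rootSum_iff.2 (h.add_mem α hα β hβ _ hγ) hzw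
  abelian := by
    intro x hx y hy
    suffices hle : rootSum Φ ≤ LinearMap.ker (LieAlgebra.ad ℂ 𝔤 y) by
      rw [← lie_skew, neg_eq_zero]
      exact hle hx
    refine iSup₂_le fun α hα z hz => ?_
    suffices hle : rootSum Φ ≤ LinearMap.ker (LieAlgebra.ad ℂ 𝔤 z) by
      change ⁅y, z⁆ = 0
      rw [← lie_skew, neg_eq_zero]
      exact hle hy
    refine iSup₂_le fun β hβ w hw => ?_
    change ⁅z, w⁆ = 0
    by_contra h0
    obtain ⟨γ, hγ, -⟩ := exists_root_eq_add hz hw h0 fun hneg => by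
      have := h.pos hβ
      rw [hneg] at this
      exact (negRoot_mem_posRoots_iff b α).1 this (h.pos hα)
    exact h.abelian α hα β hβ γ hγ

/-- Stability under 𝔥 splits the ideal into weight components. Commutativity rules out weight zero,
containment in 𝔟 rules out negative roots, and root spaces are lines. -/
theorem IsAbelianIdeal.eq_rootSum {b : (rootSystem 𝔥).Base} {𝔦 : Submodule ℂ 𝔤}
    (h : IsAbelianIdeal b 𝔦) : 𝔦 = rootSum (rootsOf b 𝔦) := by
  refine le_antisymm ?_ (iSup₂_le fun α hα => hα.2)
  let N : LieSubmodule ℂ 𝔥 𝔤 :=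
    { 𝔦 with lie_mem := fun {x m} hm => h.lie_mem x (mem_borel_of_mem_cartan b x.2) m hm }
  have hN : N.toSubmodule = 𝔦 := rfl
  have hdec := congrArg LieSubmodule.toSubmodule (LieModule.eq_iSup_inf_genWeightSpace (N := N))
  rw [LieSubmodule.iSup_toSubmodule, hN] at hdec
  refine hdec.le.trans (iSup_le fun χ x hx => ?_)
  obtain ⟨hx1, hx2⟩ : x ∈ 𝔦 ∧ x ∈ rootSpace 𝔥 χ := hx
  by_cases hx0 : x = 0
  · rw [hx0]; exact zero_mem _
  by_cases hχ : χ.IsZero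
  · exfalso
    have hxh : x ∈ 𝔥 := by
      rw [hχ.eq] at hx2
      simpa using hx2
    -- If x ∈ 𝔥 were a nonzero element of the ideal, then for a simple root vector e with α_i(x) ≠ 0
    -- the bracket [x, e] would lie in the ideal, while [x, [x, e]] = α_i(x)² e ≠ 0.
    obtain ⟨i, hi⟩ : ∃ i : b.support, (i : 𝔥.root).1 (⟨x, hxh⟩ : 𝔥) ≠ 0 := by
      by_contra! hcon
      have : (⟨x, hxh⟩ : 𝔥) = 0 := eq_of_root_apply_eq b fun i => by
        rw [hcon i]
        exact (map_zero ((rootSystem 𝔥).root i)).symm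
      exact hx0 (congrArg Subtype.val this)
    obtain ⟨e, he, he0⟩ := (i : 𝔥.root).1.exists_ne_zero
    have hpos := simple_mem_posRoots b i.2
    have h1 := lie_eq_smul_of_mem_rootSpace he ⟨x, hxh⟩
    have h2 : ⁅x, e⁆ ∈ 𝔦 := by
      rw [← lie_skew]
      exact neg_mem (h.lie_mem e (mem_borel_of_mem_posRoots b hpos he) x hx1)
    have h3 := h.abelian x hx1 _ h2
    change ⁅x, e⁆ = _ at h1
    rw [h1, lie_smul, h1, smul_smul] at h3
    exact (smul_ne_zero (mul_ne_zero hi hi) he0) h3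
  · have hχ' : χ ∈ 𝔥.root := by simpa using hχ
    have hle := rootSpace_le_of_mem (α := ⟨χ, hχ'⟩) hx2 hx0 hx1
    suffices hmem : (⟨χ, hχ'⟩ : 𝔥.root) ∈ rootsOf b 𝔦 from
      rootSpace_le_rootSum_iff (α := ⟨χ, hχ'⟩).2 hmem hx2
    refine ⟨?_, hle⟩
    by_contra hneg
    have hxb := h.le_borel hx1
    have hneg' := (negRoot_mem_posRoots_iff b ⟨χ, hχ'⟩).2 hneg
    have hdisj : Disjoint (rootSpace 𝔥 χ).toSubmodule (𝔥.toSubmodule ⊔ rootSum (posRoots b)) := by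
      have hind := LieSubmodule.iSupIndep_toSubmodule.2 (LieModule.iSupIndep_genWeightSpace ℂ 𝔥 𝔤)
      have hd := hind.disjoint_biSup (x := (χ : 𝔥 → ℂ))
        (y := {0} ∪ (fun β : 𝔥.root => (β.1 : 𝔥 → ℂ)) '' posRoots b) (by
          rintro (h0 | ⟨β, hβ, hβχ⟩)
          · exact hχ h0
          · apply hneg
            have : β = ⟨χ, hχ'⟩ := (rootSystem 𝔥).root.injective (by
              ext t; exact congrFun hβχ t)
            rwa [← this])
      refine hd.mono_right (sup_le ?_ (iSup₂_le fun β hβ => ?_))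
      · refine le_iSup₂_of_le (0 : 𝔥 → ℂ) (Or.inl rfl) ?_
        intro y hy
        simpa using hy
      · exact le_iSup₂_of_le (β.1 : 𝔥 → ℂ) (Or.inr (Set.mem_image_of_mem _ hβ)) le_rfl
    exact hx0 (Submodule.disjoint_def.1 hdisj x hx2 hxb)

end LieDecomp

/-! ### Counting decompositions -/

namespace LieDecomp

variable {𝔤 : Type*} [LieRing 𝔤] [LieAlgebra ℂ 𝔤] [FiniteDimensional ℂ 𝔤] [LieAlgebra.IsSimple ℂ 𝔤]
  {𝔥 : LieSubalgebra ℂ 𝔤} [𝔥.IsCartanSubalgebra]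

theorem exists_nonneg_of_mem_closure {b : (rootSystem 𝔥).Base} {τ : 𝔥}
    (hτ : τ ∈ coweightLattice b) (h : ∀ i ∈ b.support, 0 ≤ lev τ i) {φ : Dual ℂ 𝔥}
    (hφ : φ ∈ AddSubmonoid.closure ((rootSystem 𝔥).root '' b.support)) :
    ∃ n : ℤ, 0 ≤ n ∧ φ τ = n := by
  induction hφ using AddSubmonoid.closure_induction with
  | mem x hx =>
    obtain ⟨i, hi, rfl⟩ := hx
    exact ⟨lev τ i, h i hi, apply_eq_lev hτ i⟩
  | zero => exact ⟨0, le_rfl, by simp⟩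
  | add x y _ _ hx hy =>
    obtain ⟨n, hn, hn'⟩ := hx
    obtain ⟨m, hm, hm'⟩ := hy
    exact ⟨n + m, add_nonneg hn hm, by simp [hn', hm']⟩

theorem fundCoweight_mem (b : (rootSystem 𝔥).Base) (i : b.support) :
    fundCoweight b i ∈ coweightLattice b := AddSubgroup.subset_closure ⟨i, rfl⟩

theorem lev_fundCoweight_self (b : (rootSystem 𝔥).Base) (i : b.support) :
    lev (fundCoweight b i) i = 1 :=
  lev_eq (by rw [root_fundCoweight]; simp)

theorem lev_fundCoweight_of_ne (b : (rootSystem 𝔥).Base) {i j : b.support} (h : j ≠ i) :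
    lev (fundCoweight b i) j = 0 :=
  lev_eq (by rw [root_fundCoweight]; simp [h])

theorem lev_fundCoweight_nonneg (b : (rootSystem 𝔥).Base) (i : b.support) {j : 𝔥.root}
    (hj : j ∈ b.support) : 0 ≤ lev (fundCoweight b i) j := by
  by_cases h : (⟨j, hj⟩ : b.support) = i
  · subst h; rw [lev_fundCoweight_self b ⟨j, hj⟩]; exact zero_le_one
  · rw [lev_fundCoweight_of_ne b h]

theorem lev_nonneg_of_mem_posRoots {b : (rootSystem 𝔥).Base} {τ : 𝔥}
    (hτ : τ ∈ coweightLattice b) (h : ∀ i ∈ b.support, 0 ≤ lev τ i) {α : 𝔥.root}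
    (hα : α ∈ posRoots b) : 0 ≤ lev τ α := by
  obtain ⟨n, hn, hn'⟩ := exists_nonneg_of_mem_closure hτ h (root_mem_closure_of_mem_posRoots b hα)
  rwa [lev_eq (τ := τ) (α := α) hn']

theorem IsHighestRoot.lev_le {b : (rootSystem 𝔥).Base} {θ : 𝔥.root} (hθ : IsHighestRoot b θ)
    {τ : 𝔥} (hτ : τ ∈ coweightLattice b) (h : ∀ i ∈ b.support, 0 ≤ lev τ i) (α : 𝔥.root) :
    lev τ α ≤ lev τ θ := by
  obtain ⟨n, hn, hn'⟩ := exists_nonneg_of_mem_closure hτ h (hθ α)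
  rw [LinearMap.sub_apply, root_apply, root_apply, apply_eq_lev hτ, apply_eq_lev hτ] at hn'
  have : lev τ θ - lev τ α = n := by exact_mod_cast hn'
  linarith

theorem base_support_nonempty (b : (rootSystem 𝔥).Base) : Nonempty b.support := by
  have hirr : (rootSystem 𝔥).IsIrreducible := inferInstance
  have := hirr.nontrivial
  have hb := b.toWeightBasis
  by_contra hcon
  rw [not_nonempty_iff] at hcon
  have := b.toWeightBasis.repr.toEquiv.subsingleton
  exact not_subsingleton (Dual ℂ 𝔥) this

theorem IsHighestRoot.mem_posRoots {b : (rootSystem 𝔥).Base} {θ : 𝔥.root}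
    (hθ : IsHighestRoot b θ) : θ ∈ posRoots b := by
  by_contra hcon
  obtain ⟨i⟩ := base_support_nonempty b
  have h1 := lev_nonneg_of_mem_posRoots (fundCoweight_mem b i)
    (fun j hj => lev_fundCoweight_nonneg b i hj) ((negRoot_mem_posRoots_iff b θ).2 hcon)
  have h2 := hθ.lev_le (fundCoweight_mem b i) (fun j hj => lev_fundCoweight_nonneg b i hj) i
  rw [lev_fundCoweight_self] at h2
  have h3 := (isLevel_lev (fundCoweight_mem b i)).neg θ
  rw [negRoot, h3] at h1
  linarith

theorem one_le_lev_highestRoot {b : (rootSystem 𝔥).Base} {θ : 𝔥.root}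
    (hθ : IsHighestRoot b θ) (i : b.support) : 1 ≤ lev (fundCoweight b i) θ := by
  have h2 := hθ.lev_le (fundCoweight_mem b i) (fun j hj => lev_fundCoweight_nonneg b i hj) i
  rwa [lev_fundCoweight_self] at h2

theorem mem_X_iff {b : (rootSystem 𝔥).Base} {θ : 𝔥.root} (hθ : IsHighestRoot b θ) {τ : 𝔥} :
    τ ∈ X b ↔ τ ∈ coweightLattice b ∧ ∀ α ∈ posRoots b, 0 ≤ lev τ α ∧ lev τ α ≤ 2 := by
  constructor
  · rintro ⟨⟨-, h0, θ', hθ', h2⟩, hτ⟩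
    have hτ' : τ ∈ coweightLattice b := hτ
    have hs : ∀ i ∈ b.support, 0 ≤ lev τ i := by
      intro i hi
      have := h0 i hi
      rw [apply_eq_lev hτ'] at this
      exact_mod_cast this
    rw [apply_eq_lev hτ'] at h2
    have h2' : lev τ θ' ≤ 2 := by exact_mod_cast h2
    exact ⟨hτ', fun α hα => ⟨lev_nonneg_of_mem_posRoots hτ' hs hα, (hθ'.lev_le hτ' hs α).trans h2'⟩⟩
  · rintro ⟨hτ, h⟩
    refine ⟨⟨fun α => ?_, fun i hi => ?_, θ, hθ, ?_⟩, hτ⟩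
    · rw [apply_eq_lev hτ]; simp
    · rw [apply_eq_lev hτ]
      exact_mod_cast (h i (simple_mem_posRoots b hi)).1
    · rw [apply_eq_lev hτ]
      exact_mod_cast (h θ hθ.mem_posRoots).2

theorem mem_levelRoots_iff {b : (rootSystem 𝔥).Base} {τ : 𝔥} (hτ : τ ∈ coweightLattice b) {k : ℕ}
    {α : 𝔥.root} : α ∈ levelRoots b τ k ↔ α ∈ posRoots b ∧ lev τ α = k := by
  refine and_congr_right fun _ => ?_
  rw [apply_eq_lev hτ]
  norm_cast

theorem mem_V_iff {b : (rootSystem 𝔥).Base} {τ : 𝔥} (hτ : τ ∈ coweightLattice b)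
    {α : 𝔥.root} : α ∈ V b τ ↔ α ∈ posRoots b ∧ 0 < lev τ α := by
  refine and_congr_right fun _ => ?_
  rw [apply_eq_lev hτ]
  norm_cast

/-- For dominant τ, θ(τ) = ∑ m_i α_i(τ) with every m_i ≥ 1. If this is at most 1, then at most one
α_i(τ) is nonzero, and in that case both it and m_i equal 1. -/
theorem mem_minusculeCoweights_iff {b : (rootSystem 𝔥).Base} {θ : 𝔥.root}
    (hθ : IsHighestRoot b θ) {τ : 𝔥} : τ ∈ minusculeCoweights b ↔
      τ ∈ coweightLattice b ∧ ∀ α ∈ posRoots b, 0 ≤ lev τ α ∧ lev τ α ≤ 1 := by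
  classical
  constructor
  · rintro (⟨i, ⟨θ', hθ', hi⟩, rfl⟩ | rfl)
    · have hnn := fun j hj => lev_fundCoweight_nonneg b i (j := j) hj
      have h1 : lev (fundCoweight b i) θ' = 1 := by
        apply lev_eq
        rw [← root_apply, fundCoweight, Module.apply_evalEquiv_symm_apply, Basis.coord_apply, hi]
        simp
      exact ⟨fundCoweight_mem b i, fun α hα => ⟨lev_nonneg_of_mem_posRoots (fundCoweight_mem b i)
        hnn hα, (hθ'.lev_le (fundCoweight_mem b i) hnn α).trans h1.le⟩⟩
    · refine ⟨zero_mem _, fun α _ => ?_⟩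
      have : lev (0 : 𝔥) α = 0 := lev_eq (by simp)
      rw [this]
      exact ⟨le_rfl, zero_le_one⟩
  · rintro ⟨hτ, h⟩
    have hs : ∀ i : b.support, 0 ≤ lev τ i := fun i => (h i (simple_mem_posRoots b i.2)).1
    have hsum : lev τ θ = ∑ i : b.support, lev τ i * lev (fundCoweight b i) θ := by
      apply lev_eq
      conv_lhs => rw [eq_sum_fundCoweight b τ, ← root_apply, map_sum]
      simp only [map_smul, root_apply, smul_eq_mul, apply_eq_lev hτ,
        apply_eq_lev (fundCoweight_mem b _)]
      push_cast
      rfl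
    have hnn : ∀ i : b.support, 0 ≤ lev τ i * lev (fundCoweight b i) θ := fun i =>
      mul_nonneg (hs i) (zero_le_one.trans (one_le_lev_highestRoot hθ i))
    have hle : ∑ i : b.support, lev τ i * lev (fundCoweight b i) θ ≤ 1 :=
      hsum ▸ (h θ hθ.mem_posRoots).2
    by_cases h0 : ∀ i : b.support, lev τ i = 0
    · right
      exact eq_of_root_apply_eq b fun i => by rw [apply_eq_lev hτ, h0 i]; simp
    left
    push Not at h0
    obtain ⟨i, hi⟩ := h0
    have hi1 : 1 ≤ lev τ i := by have := hs i; omega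
    have hm1 := one_le_lev_highestRoot hθ i
    have hsplit := Finset.add_sum_erase Finset.univ
      (fun i : b.support => lev τ i * lev (fundCoweight b i) θ) (Finset.mem_univ i)
    have hrest : 0 ≤ ∑ j ∈ Finset.univ.erase i, lev τ j * lev (fundCoweight b j) θ :=
      Finset.sum_nonneg fun j _ => hnn j
    have hprod : lev τ i * lev (fundCoweight b i) θ ≤ 1 := by linarith
    have hθi : lev (fundCoweight b i) θ = 1 := by nlinarith
    have hτi : lev τ i = 1 := by nlinarith
    refine ⟨i, ⟨θ, hθ, ?_⟩, ?_⟩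
    · have := apply_eq_lev (fundCoweight_mem b i) θ
      rw [hθi, ← root_apply, fundCoweight, Module.apply_evalEquiv_symm_apply,
        Basis.coord_apply] at this
      simpa using this
    · apply eq_of_root_apply_eq b
      intro j
      rw [apply_eq_lev (fundCoweight_mem b i), apply_eq_lev hτ]
      by_cases hj : j = i
      · rw [hj, lev_fundCoweight_self, hτi]
      · have h2 := (Finset.sum_eq_zero_iff_of_nonneg (fun j _ => hnn j)).1
          (le_antisymm (by rw [hθi, hτi] at hsplit; linarith) hrest) j (Finset.mem_erase.2 ⟨hj, Finset.mem_univ j⟩)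
        have h3 := one_le_lev_highestRoot hθ j
        rw [lev_fundCoweight_of_ne b hj, (mul_eq_zero.1 h2).resolve_right (by omega)]

/-! ### Recovering a coweight of X from its roots of level two -/

theorem IsHighestRoot.add_ne {b : (rootSystem 𝔥).Base} {θ : 𝔥.root} (hθ : IsHighestRoot b θ)
    {β γ : 𝔥.root} (hβ : β ∈ posRoots b) :
    (rootSystem 𝔥).root γ ≠ (rootSystem 𝔥).root θ + (rootSystem 𝔥).root β := by
  intro hγ
  apply (rootSystem 𝔥).ne_zero β
  have h0 : ∀ i, lev (fundCoweight b i) β = 0 := by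
    intro i
    have hnn := fun j hj => lev_fundCoweight_nonneg b i (j := j) hj
    have h1 := lev_nonneg_of_mem_posRoots (fundCoweight_mem b i) hnn hβ
    have h2 := hθ.lev_le (fundCoweight_mem b i) hnn γ
    rw [lev_eq_add (fundCoweight_mem b i) hγ] at h2
    omega
  ext x
  rw [eq_sum_fundCoweight b x, map_sum]
  simp only [map_smul, root_apply, apply_eq_lev (fundCoweight_mem b _), h0]
  simp

/-- Since Δ_τ² is nonempty, θ has level 2. If β > 0 is not orthogonal to θ and β ≠ θ, then θ = β + γ
with γ > 0, and the levels of β, γ add up to 2. They are (2,0), (0,2) or (1,1), and membership of β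
and γ in Δ_τ² tells which. The roots not orthogonal to θ span. -/
theorem eq_of_levelRoots_two_eq {b : (rootSystem 𝔥).Base} {θ : 𝔥.root} (hθ : IsHighestRoot b θ)
    {τ σ : 𝔥} (hτ : τ ∈ X b) (hσ : σ ∈ X b) (hne : (levelRoots b τ 2).Nonempty)
    (heq : levelRoots b τ 2 = levelRoots b σ 2) : τ = σ := by
  obtain ⟨hτP, hτ2⟩ := (mem_X_iff hθ).1 hτ
  obtain ⟨hσP, hσ2⟩ := (mem_X_iff hθ).1 hσ
  have hiff : ∀ α ∈ posRoots b, (lev τ α = 2 ↔ lev σ α = 2) := by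
    intro α hα
    have h1 := mem_levelRoots_iff hτP (b := b) (k := 2) (α := α)
    have h2 := mem_levelRoots_iff hσP (b := b) (k := 2) (α := α)
    rw [heq] at h1
    simp only [hα, true_and] at h1 h2
    exact h1.symm.trans h2
  have hθτ : lev τ θ = 2 := by
    obtain ⟨α, hα⟩ := hne
    have h1 := ((mem_levelRoots_iff hτP).1 hα).2
    have h2 := hθ.lev_le hτP (fun i hi => (hτ2 i (simple_mem_posRoots b hi)).1) α
    have h3 := (hτ2 θ hθ.mem_posRoots).2
    push_cast at h1
    omega
  have hθσ : lev σ θ = 2 := (hiff θ hθ.mem_posRoots).1 hθτ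
  let s : Set 𝔥.root := {β | (rootSystem 𝔥).pairingIn ℤ θ β ≠ 0}
  have hpos : ∀ β ∈ s, β ∈ posRoots b → lev τ β = lev σ β := by
    intro β hβ hβpos
    by_cases hβθ : θ = β
    · rw [← hβθ, hθτ, hθσ]
    have hp : 0 < (rootSystem 𝔥).pairingIn ℤ θ β := by
      refine lt_of_le_of_ne (not_lt.1 fun hneg => ?_) (Ne.symm hβ)
      have hne' : (rootSystem 𝔥).root θ ≠ - (rootSystem 𝔥).root β := by
        intro h
        have : θ = negRoot β := (rootSystem 𝔥).root.injective (by rw [h, root_negRoot])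
        have h' := hθ.mem_posRoots
        rw [this] at h'
        exact (negRoot_mem_posRoots_iff b β).1 h' hβpos
      obtain ⟨γ, hγ⟩ := (rootSystem 𝔥).root_add_root_mem_of_pairingIn_neg hneg hne'
      exact hθ.add_ne hβpos hγ
    obtain ⟨γ, hγ⟩ := (rootSystem 𝔥).root_sub_root_mem_of_pairingIn_pos hp hβθ
    have hγpos : γ ∈ posRoots b := by
      by_contra hcon
      refine hθ.add_ne (γ := β) ((negRoot_mem_posRoots_iff b γ).2 hcon) ?_
      rw [root_negRoot, hγ]
      abel
    have hsum : (rootSystem 𝔥).root θ = (rootSystem 𝔥).root β + (rootSystem 𝔥).root γ := by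
      rw [hγ]; abel
    have h1 := lev_eq_add hτP hsum
    have h2 := lev_eq_add hσP hsum
    have h3 := hiff β hβpos
    have h4 := hiff γ hγpos
    have h5 := hτ2 β hβpos
    have h6 := hσ2 β hβpos
    omega
  have hall : ∀ β ∈ s, lev τ β = lev σ β := by
    intro β hβ
    by_cases hβpos : β ∈ posRoots b
    · exact hpos β hβ hβpos
    · have h1 := hpos (negRoot β) (by
        change (rootSystem 𝔥).pairingIn ℤ θ ((rootSystem 𝔥).reflectionPerm β β) ≠ 0
        rw [RootPairing.pairingIn_reflectionPerm_self_right]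
        exact neg_ne_zero.2 hβ) ((negRoot_mem_posRoots_iff b β).2 hβpos)
      rw [negRoot, (isLevel_lev hτP).neg, (isLevel_lev hσP).neg] at h1
      exact neg_injective h1
  -- Irreducibility reduces this to roots j outside the span being orthogonal to `s`. Such a j is
  -- orthogonal to θ, so reflection in j preserves `s`; for i in `s` the difference of i and its
  -- reflection is ⟨i, j⟩ times the root j, forcing ⟨i, j⟩ = 0.
  have hspan : Submodule.span ℂ ((rootSystem 𝔥).root '' s) = ⊤ := by
    refine (rootSystem 𝔥).span_root_image_eq_top_of_forall_orthogonal s ⟨θ, ?_⟩ ?_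
    · change (rootSystem 𝔥).pairingIn ℤ θ θ ≠ 0
      rw [RootPairing.pairingIn_same]; norm_num
    · intro j hj i hi
      by_contra hort
      apply hj
      have hjs : (rootSystem 𝔥).pairingIn ℤ θ j = 0 := by
        by_contra hcon
        exact hj (Submodule.subset_span ⟨j, hcon, rfl⟩)
      have hjs' : (rootSystem 𝔥).pairingIn ℤ j θ = 0 :=
        (RootPairing.pairingIn_eq_zero_iff (P := rootSystem 𝔥)).1 hjs
      have hpij : (rootSystem 𝔥).pairingIn ℤ i j ≠ 0 := by
        intro h0
        apply hort
        have h0' := (RootPairing.pairingIn_eq_zero_iff (P := rootSystem 𝔥)).1 h0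
        exact ⟨by rw [← (rootSystem 𝔥).algebraMap_pairingIn ℤ, h0', map_zero],
          by rw [← (rootSystem 𝔥).algebraMap_pairingIn ℤ, h0, map_zero]⟩
      have hsi : (rootSystem 𝔥).reflectionPerm j i ∈ s := by
        change (rootSystem 𝔥).pairingIn ℤ θ _ ≠ 0
        intro h0
        have h0' := (RootPairing.pairingIn_eq_zero_iff (P := rootSystem 𝔥)).1 h0
        have h1 := RootPairing.isLevel_pairingIn (P := rootSystem 𝔥) θ i j
        simp only at h1
        rw [h1, hjs', mul_zero, sub_zero] at h0'
        exact hi ((RootPairing.pairingIn_eq_zero_iff (P := rootSystem 𝔥)).1 h0')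
      have hmem := sub_mem (Submodule.subset_span (R := ℂ) (Set.mem_image_of_mem (rootSystem 𝔥).root hi))
        (Submodule.subset_span (Set.mem_image_of_mem (rootSystem 𝔥).root hsi))
      rw [RootPairing.root_reflectionPerm, RootPairing.reflection_apply_root, sub_sub_cancel] at hmem
      refine (Submodule.smul_mem_iff _ ?_).1 hmem
      rw [← (rootSystem 𝔥).algebraMap_pairingIn ℤ]
      simpa using hpij
  apply (Module.evalEquiv ℂ 𝔥).injective
  refine LinearMap.ext_on hspan ?_
  rintro _ ⟨β, hβ, rfl⟩
  simp only [Module.evalEquiv_apply, Module.Dual.eval_apply, root_apply]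
  rw [apply_eq_lev hτP, apply_eq_lev hσP, hall β hβ]

/-! ### The alcove of an abelian ideal -/

open Classical in
/-- The Shi coordinates of the alcove attached to an ideal of positive roots. -/
noncomputable def shi (b : (rootSystem 𝔥).Base) (Φ : Set 𝔥.root) (α : 𝔥.root) : ℤ :=
  if α ∈ posRoots b then (if α ∈ Φ then 1 else 0) else (if negRoot α ∈ Φ then -2 else -1)

theorem shi_of_mem {b : (rootSystem 𝔥).Base} {Φ : Set 𝔥.root} {α : 𝔥.root} (hα : α ∈ posRoots b)
    (h : α ∈ Φ) : shi b Φ α = 1 := by simp [shi, hα, h]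

theorem shi_of_notMem {b : (rootSystem 𝔥).Base} {Φ : Set 𝔥.root} {α : 𝔥.root}
    (hα : α ∈ posRoots b) (h : α ∉ Φ) : shi b Φ α = 0 := by simp [shi, hα, h]

theorem shi_negRoot (b : (rootSystem 𝔥).Base) (Φ : Set 𝔥.root) (α : 𝔥.root) :
    shi b Φ (negRoot α) = -1 - shi b Φ α := by
  have hN := negRoot_mem_posRoots_iff b α
  by_cases h1 : α ∈ posRoots b
  · have h2 : negRoot α ∉ posRoots b := fun h => hN.1 h h1
    by_cases h3 : α ∈ Φ <;> simp [shi, negRoot_negRoot, h1, h2, h3]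
  · have h2 := hN.2 h1
    by_cases h3 : negRoot α ∈ Φ <;> simp [shi, h1, h2, h3]

/-- For positive roots with γ = α + β, the bound k_α + k_β ≤ k_γ expresses both hypotheses on Φ:
being an ideal if one summand lies in Φ, being abelian if both would. The bound k_γ ≤ k_α + k_β + 1
is automatic, since the values are 0 and 1. The other sign patterns are rearranged into a sum of
positive roots. -/
theorem isShi_shi {b : (rootSystem 𝔥).Base} {Φ : Set 𝔥.root} (h : IsAbelianRootIdeal b Φ) :
    (rootSystem 𝔥).IsShi (shi b Φ) := by
  have hneg := shi_negRoot b Φ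
  refine ⟨hneg, ?_⟩
  have hN := negRoot_mem_posRoots_iff b
  have h01 : ∀ α ∈ posRoots b, 0 ≤ shi b Φ α ∧ shi b Φ α ≤ 1 := fun α hα => by
    by_cases h' : α ∈ Φ
    · rw [shi_of_mem hα h']; omega
    · rw [shi_of_notMem hα h']; omega
  have key : ∀ α β γ : 𝔥.root, α ∈ posRoots b → β ∈ posRoots b →
      (rootSystem 𝔥).root γ = (rootSystem 𝔥).root α + (rootSystem 𝔥).root β →
      shi b Φ α + shi b Φ β ≤ shi b Φ γ ∧ shi b Φ γ ≤ 1 := by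
    intro α β γ hα hβ hγ
    have hγp := add_mem_posRoots b hα hβ hγ
    refine ⟨?_, (h01 γ hγp).2⟩
    by_cases h1 : α ∈ Φ
    · have h2 : β ∉ Φ := fun h2 => h.abelian α h1 β h2 γ hγ
      rw [shi_of_mem hα h1, shi_of_notMem hβ h2, shi_of_mem hγp (h.add_mem α h1 β hβ γ hγ)]
      omega
    · by_cases h2 : β ∈ Φ
      · rw [shi_of_notMem hα h1, shi_of_mem hβ h2,
          shi_of_mem hγp (h.add_mem β h2 α hα γ (by rw [hγ, add_comm]))]
        omega
      · rw [shi_of_notMem hα h1, shi_of_notMem hβ h2]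
        linarith [(h01 γ hγp).1]
  have hneg' : ∀ α, shi b Φ (negRoot α) = -1 - shi b Φ α := hneg
  intro i j m hm
  by_cases hi : i ∈ posRoots b <;> by_cases hj : j ∈ posRoots b
  · have h1 := key i j m hi hj hm
    have h2 := h01 i hi
    have h3 := h01 j hj
    omega
  · have h3 := h01 i hi
    have hj' := (hN j).2 hj
    by_cases hmp : m ∈ posRoots b
    · have h1 := key m (negRoot j) i hmp hj' (by rw [root_negRoot, hm]; abel)
      rw [hneg'] at h1
      omega
    · have h1 := key i (negRoot m) (negRoot j) hi ((hN m).2 hmp)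
        (by rw [root_negRoot, root_negRoot, hm]; abel)
      have h4 := h01 _ ((hN m).2 hmp)
      rw [hneg', hneg'] at h1
      rw [hneg'] at h4
      omega
  · have h3 := h01 j hj
    have hi' := (hN i).2 hi
    by_cases hmp : m ∈ posRoots b
    · have h1 := key m (negRoot i) j hmp hi' (by rw [root_negRoot, hm]; abel)
      rw [hneg'] at h1
      omega
    · have h1 := key j (negRoot m) (negRoot i) hj ((hN m).2 hmp)
        (by rw [root_negRoot, root_negRoot, hm]; abel)
      have h4 := h01 _ ((hN m).2 hmp)
      rw [hneg', hneg'] at h1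
      rw [hneg'] at h4
      omega
  · have h1 := key (negRoot i) (negRoot j) (negRoot m) ((hN i).2 hi) ((hN j).2 hj)
      (by rw [root_negRoot, root_negRoot, root_negRoot, hm]; abel)
    rw [hneg', hneg', hneg'] at h1
    omega

/-- The alcove inequalities at positive roots, unfolded: τ lies in X and Δ_τ² ⊆ Φ ⊆ Δ_τ¹ ∪ Δ_τ². -/
theorem mem_alcoveVertices_iff {b : (rootSystem 𝔥).Base} {Φ : Set 𝔥.root}
    (h : IsAbelianRootIdeal b Φ) {τ : 𝔥} : τ ∈ alcoveVertices b (shi b Φ) ↔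
      τ ∈ coweightLattice b ∧ ∀ α ∈ posRoots b, 0 ≤ lev τ α ∧ lev τ α ≤ 2 ∧
        (lev τ α = 2 → α ∈ Φ) ∧ (α ∈ Φ → 1 ≤ lev τ α) := by
  refine and_congr_right fun hτ => ⟨fun hk α hα => ?_, fun hk => ?_⟩
  · have := hk α
    by_cases hΦ : α ∈ Φ
    · rw [shi_of_mem hα hΦ] at this
      exact ⟨by omega, by omega, fun _ => hΦ, fun _ => this.1⟩
    · rw [shi_of_notMem hα hΦ] at this
      exact ⟨by omega, by omega, fun h' => by omega, fun h' => absurd h' hΦ⟩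
  · have hpos : ∀ α ∈ posRoots b, shi b Φ α ≤ lev τ α ∧ lev τ α ≤ shi b Φ α + 1 := by
      intro α hα
      obtain ⟨h1, h2, h3, h4⟩ := hk α hα
      by_cases hΦ : α ∈ Φ
      · rw [shi_of_mem hα hΦ]
        exact ⟨h4 hΦ, by omega⟩
      · rw [shi_of_notMem hα hΦ]
        refine ⟨h1, ?_⟩
        by_contra hcon
        exact hΦ (h3 (by omega))
    intro α
    by_cases hα : α ∈ posRoots b
    · exact hpos α hα
    · have h1 := hpos _ ((negRoot_mem_posRoots_iff b α).2 hα)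
      rw [negRoot, (isShi_shi h).neg, (isLevel_lev hτ).neg] at h1
      omega

/-- When no positive root has level 2, the alcove condition reduces to levels 0 and 1, with level 1
on Φ. -/
theorem C_eq {b : (rootSystem 𝔥).Base} {θ : 𝔥.root} (hθ : IsHighestRoot b θ)
    {𝔦 : Submodule ℂ 𝔤} (h : IsAbelianRootIdeal b (rootsOf b 𝔦)) :
    C b 𝔦 = {τ | τ ∈ alcoveVertices b (shi b (rootsOf b 𝔦)) ∧ ¬ (levelRoots b τ 2).Nonempty} := by
  ext τ
  change τ ∈ minusculeCoweights b ∧ rootsOf b 𝔦 ⊆ V b τ ↔ _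
  rw [mem_minusculeCoweights_iff hθ, Set.mem_ofPred_eq, mem_alcoveVertices_iff h,
    Set.not_nonempty_iff_eq_empty]
  constructor
  · rintro ⟨⟨hτ, h1⟩, h2⟩
    refine ⟨⟨hτ, fun α hα => ⟨(h1 α hα).1, by have := h1 α hα; omega,
      fun h' => by have := h1 α hα; omega, fun hΦ => ((mem_V_iff hτ).1 (h2 hΦ)).2⟩⟩, ?_⟩
    ext α
    simp only [mem_levelRoots_iff hτ, Set.mem_empty_iff_false, iff_false, not_and]
    intro hα
    have := h1 α hα
    push_cast
    omega
  · rintro ⟨⟨hτ, h1⟩, h2⟩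
    refine ⟨⟨hτ, fun α hα => ⟨(h1 α hα).1, ?_⟩⟩, fun α hα =>
      (mem_V_iff hτ).2 ⟨h.pos hα, (h1 α (h.pos hα)).2.2.2 hα⟩⟩
    have h3 : α ∉ levelRoots b τ 2 := by rw [h2]; simp
    rw [mem_levelRoots_iff hτ] at h3
    have := (h1 α hα).2.1
    push_cast at h3
    by_contra hcon
    exact h3 ⟨hα, by omega⟩

theorem levelRoots_two_isAbelianRootIdeal {b : (rootSystem 𝔥).Base} {θ : 𝔥.root}
    (hθ : IsHighestRoot b θ) {τ : 𝔥} (hτ : τ ∈ X b) :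
    IsAbelianRootIdeal b (levelRoots b τ 2) := by
  obtain ⟨hτP, hτ2⟩ := (mem_X_iff hθ).1 hτ
  refine ⟨fun α hα => hα.1, fun α hα β hβ γ hγ => ?_, fun α hα β hβ γ hγ => ?_⟩
  · have hγpos := add_mem_posRoots b hα.1 hβ hγ
    have h1 := ((mem_levelRoots_iff hτP).1 hα).2
    have h2 := lev_eq_add hτP hγ
    have h3 := hτ2 γ hγpos
    have h4 := hτ2 β hβ
    refine (mem_levelRoots_iff hτP).2 ⟨hγpos, ?_⟩
    push_cast at h1 ⊢
    omega
  · have hγpos := add_mem_posRoots b hα.1 hβ.1 hγ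
    have h1 := ((mem_levelRoots_iff hτP).1 hα).2
    have h2 := ((mem_levelRoots_iff hτP).1 hβ).2
    have h3 := lev_eq_add hτP hγ
    have h4 := hτ2 γ hγpos
    push_cast at h1 h2
    omega

/-- The inclusions 𝔦(Δ_τ²) ⊆ 𝔦 ⊆ 𝔦(Δ_τ²) + 𝔦(Δ_τ¹) are the alcove conditions on τ. The complement 𝔰
is forced: by the modular law it is the intersection of 𝔦 with 𝔦(Δ_τ¹). -/
theorem decompositions_eq {b : (rootSystem 𝔥).Base} {θ : 𝔥.root} (hθ : IsHighestRoot b θ)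
    {𝔦 : Submodule ℂ 𝔤} (h : IsAbelianIdeal b 𝔦) :
    decompositions b 𝔦 =
      (fun τ => (rootSum (levelRoots b τ 2), rootSum (rootsOf b 𝔦 ∩ levelRoots b τ 1))) ''
        {τ | τ ∈ alcoveVertices b (shi b (rootsOf b 𝔦)) ∧ (levelRoots b τ 2).Nonempty} := by
  have hΦ := h.isAbelianRootIdeal
  ext ⟨p, q⟩
  constructor
  · rintro ⟨τ, hτ, hp, hp0, hsp, hq, hi⟩
    change p = _ at hp
    change p ≠ ⊥ at hp0
    change q ≤ _ at hq
    change 𝔦 = p ⊔ q at hi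
    obtain ⟨hτP, hτ2⟩ := (mem_X_iff hθ).1 hτ
    have hne : (levelRoots b τ 2).Nonempty := by
      by_contra hcon
      rw [Set.not_nonempty_iff_eq_empty] at hcon
      exact hp0 (by rw [hp, hcon, rootSum_empty])
    have h21 : Disjoint (levelRoots b τ 2) (levelRoots b τ 1) := by
      refine Set.disjoint_left.2 fun α h2 h1 => ?_
      have h2' := ((mem_levelRoots_iff hτP).1 h2).2
      have h1' := ((mem_levelRoots_iff hτP).1 h1).2
      push_cast at h1' h2'
      omega
    have hle2 : levelRoots b τ 2 ⊆ rootsOf b 𝔦 := by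
      rw [← rootSum_le_iff, ← h.eq_rootSum, ← hp, hi]
      exact le_sup_left
    have hle12 : rootsOf b 𝔦 ⊆ levelRoots b τ 2 ∪ levelRoots b τ 1 := by
      rw [← rootSum_le_iff, ← h.eq_rootSum, rootSum_union, hi, hp]
      exact sup_le_sup_left hq _
    refine ⟨τ, ⟨(mem_alcoveVertices_iff hΦ).2 ⟨hτP, fun α hα => ⟨(hτ2 α hα).1, (hτ2 α hα).2,
      fun h' => hle2 ((mem_levelRoots_iff hτP).2 ⟨hα, h'⟩), fun h' => ?_⟩⟩, hne⟩, ?_⟩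
    · rcases hle12 h' with h' | h'
      · have := ((mem_levelRoots_iff hτP).1 h').2
        push_cast at this
        omega
      · have := ((mem_levelRoots_iff hτP).1 h').2
        push_cast at this
        omega
    · have hmod : ∀ s ≤ rootSum (levelRoots b τ 1),
          (rootSum (levelRoots b τ 2) ⊔ s) ⊓ rootSum (levelRoots b τ 1) = s := by
        intro s hs
        rw [sup_comm, sup_inf_assoc_of_le _ hs, (disjoint_rootSum h21).eq_bot, sup_bot_eq]
      have hΦeq : rootsOf b 𝔦 = levelRoots b τ 2 ∪ (rootsOf b 𝔦 ∩ levelRoots b τ 1) := by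
        ext α
        constructor
        · intro hα
          rcases hle12 hα with h' | h'
          · exact Or.inl h'
          · exact Or.inr ⟨hα, h'⟩
        · rintro (h' | h')
          · exact hle2 h'
          · exact h'.1
      refine Prod.ext hp.symm ?_
      have h1 := hmod q hq
      have h2 := hmod (rootSum (rootsOf b 𝔦 ∩ levelRoots b τ 1)) (rootSum_mono Set.inter_subset_right)
      rw [← rootSum_union, ← hΦeq, ← h.eq_rootSum] at h2
      rw [← hp, ← hi] at h1
      exact h2.symm.trans h1
  · rintro ⟨τ, ⟨hτ, hne⟩, hpq⟩
    obtain ⟨rfl, rfl⟩ := Prod.mk.inj hpq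
    obtain ⟨hτP, hτ2⟩ := (mem_alcoveVertices_iff hΦ).1 hτ
    have hτX : τ ∈ X b := (mem_X_iff hθ).2 ⟨hτP, fun α hα => ⟨(hτ2 α hα).1, (hτ2 α hα).2.1⟩⟩
    refine ⟨τ, hτX, rfl, ?_, ⟨rootSum_isAbelianIdeal (levelRoots_two_isAbelianRootIdeal hθ hτX),
      τ, hτX, rootsOf_rootSum b fun α hα => hα.1⟩, rootSum_mono Set.inter_subset_right, ?_⟩
    · intro h0
      rw [← rootSum_empty (𝔥 := 𝔥)] at h0
      exact hne.ne_empty (rootSum_injective h0)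
    · conv_lhs => rw [h.eq_rootSum]
      change _ = rootSum _ ⊔ rootSum _
      rw [← rootSum_union]
      congr 1
      ext α
      constructor
      · intro hα
        obtain ⟨h1, h2, h3, h4⟩ := hτ2 α (hΦ.pos hα)
        have := h4 hα
        by_cases h5 : lev τ α = 2
        · exact Or.inl ((mem_levelRoots_iff hτP).2 ⟨hΦ.pos hα, h5⟩)
        · exact Or.inr ⟨hα, (mem_levelRoots_iff hτP).2 ⟨hΦ.pos hα, by push_cast; omega⟩⟩
      · rintro (h' | h')
        · have := (mem_levelRoots_iff hτP).1 h'
          exact (hτ2 α this.1).2.2.1 this.2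
        · exact h'.1

theorem decompositions_finite_and_ncard {b : (rootSystem 𝔥).Base} {θ : 𝔥.root}
    (hθ : IsHighestRoot b θ) {𝔦 : Submodule ℂ 𝔤} (h : IsAbelianIdeal b 𝔦) :
    (decompositions b 𝔦).Finite ∧ (decompositions b 𝔦).ncard + (C b 𝔦).ncard =
      (corootLattice 𝔥).relIndex (coweightLattice b) := by
  have hΦ := h.isAbelianRootIdeal
  set T := alcoveVertices b (shi b (rootsOf b 𝔦)) with hT
  have hfin : T.Finite := alcoveVertices_finite b _
  have hsub : {τ | τ ∈ T ∧ (levelRoots b τ 2).Nonempty} ⊆ T := fun τ hτ => hτ.1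
  rw [decompositions_eq hθ h, C_eq hθ hΦ]
  refine ⟨(hfin.subset hsub).image _, ?_⟩
  rw [Set.InjOn.ncard_image, ← ncard_alcoveVertices b (isShi_shi hΦ), ← hT,
    ← Set.ncard_union_eq ?_ (hfin.subset hsub) (hfin.subset fun τ hτ => hτ.1)]
  · congr 1
    ext τ
    constructor
    · rintro (h' | h') <;> exact h'.1
    · intro h'
      by_cases h2 : (levelRoots b τ 2).Nonempty
      · exact Or.inl ⟨h', h2⟩
      · exact Or.inr ⟨h', h2⟩
  · exact Set.disjoint_left.2 fun τ h1 h2 => h2.2 h1.2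
  · rintro τ ⟨hτ, hτne⟩ σ ⟨hσ, hσne⟩ heq
    have hX : ∀ τ ∈ T, τ ∈ X b := fun τ hτ => by
      obtain ⟨hτP, hτ2⟩ := (mem_alcoveVertices_iff hΦ).1 hτ
      exact (mem_X_iff hθ).2 ⟨hτP, fun α hα => ⟨(hτ2 α hα).1, (hτ2 α hα).2.1⟩⟩
    exact eq_of_levelRoots_two_eq hθ (hX τ hτ) (hX σ hσ) hτne (rootSum_injective (Prod.mk.inj heq).1)

/-- Apply the bijection to Φ = ∅, the fundamental alcove, which contains finitely many coweights. -/
theorem relIndex_ne_zero (b : (rootSystem 𝔥).Base) :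
    (corootLattice 𝔥).relIndex (coweightLattice b) ≠ 0 := by
  have hempty : IsAbelianRootIdeal b (∅ : Set 𝔥.root) := ⟨by simp, by simp, by simp⟩
  have hbij := alcoveVertices_bijective b (isShi_shi hempty)
  have hfin := (alcoveVertices_finite b (shi b (∅ : Set 𝔥.root))).to_subtype
  have hq := Finite.of_surjective _ hbij.surjective
  exact (Nat.card_pos (α := coweightLattice b ⧸
    (corootLattice 𝔥).addSubgroupOf (coweightLattice b))).ne'

end LieDecomp

/-! ### Triangular decomposition -/

namespace LieDecomp

variable {𝔤 : Type*} [LieRing 𝔤] [LieAlgebra ℂ 𝔤] [FiniteDimensional ℂ 𝔤] [LieAlgebra.IsSimple ℂ 𝔤]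
  {𝔥 : LieSubalgebra ℂ 𝔤} [𝔥.IsCartanSubalgebra]

theorem mem_rootSpace_negRoot {α : 𝔥.root} {x : 𝔤} :
    x ∈ rootSpace 𝔥 (negRoot α).1 ↔ x ∈ rootSpace 𝔥 (-α.1 : 𝔥 → ℂ) := by
  have : ((negRoot α).1 : 𝔥 → ℂ) = -α.1 := by
    ext t
    exact LinearMap.congr_fun (root_negRoot α) t
  rw [this]

theorem exists_isSl2Triple (α : 𝔥.root) :
    ∃ e ∈ rootSpace 𝔥 α.1, ∃ f ∈ rootSpace 𝔥 (negRoot α).1,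
      IsSl2Triple ((rootSystem 𝔥).coroot α : 𝔤) e f := by
  obtain ⟨h, e, f, ht, he, hf⟩ := exists_isSl2Triple_of_weight_isNonZero (𝔥.isNonZero_coe_root α)
  have := ht.h_eq_coroot (𝔥.isNonZero_coe_root α) he hf
  exact ⟨e, he, f, mem_rootSpace_negRoot.2 hf, this ▸ ht⟩

theorem lie_cartan_rootSpace {α : 𝔥.root} {x : 𝔤} (hx : x ∈ rootSpace 𝔥 α.1) (h : 𝔥) :
    ⁅(h : 𝔤), x⁆ = (rootSystem 𝔥).root α h • x := lie_eq_smul_of_mem_rootSpace hx h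

theorem lie_cartan_cartan (h h' : 𝔥) : ⁅(h : 𝔤), (h' : 𝔤)⁆ = 0 := by
  have := congrArg Subtype.val (trivial_lie_zero 𝔥 𝔥 h h')
  exact this

theorem exists_eq_smul_of_mem_rootSpace {α : 𝔥.root} {x y : 𝔤} (hx : x ∈ rootSpace 𝔥 α.1)
    (hx0 : x ≠ 0) (hy : y ∈ rootSpace 𝔥 α.1) : ∃ c : ℂ, y = c • x := by
  obtain ⟨c, hc⟩ := (finrank_eq_one_iff_of_nonzero' (⟨x, hx⟩ : rootSpace 𝔥 α.1)
    (by simpa [Subtype.ext_iff] using hx0)).1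
    (finrank_rootSpace_eq_one α.1 (𝔥.isNonZero_coe_root α)) ⟨y, hy⟩
  exact ⟨c, (congrArg Subtype.val hc).symm⟩

theorem exists_lie_eq_smul_coroot {α : 𝔥.root} {x y : 𝔤} (hx : x ∈ rootSpace 𝔥 α.1)
    (hy : y ∈ rootSpace 𝔥 (negRoot α).1) : ∃ c : ℂ, ⁅x, y⁆ = c • ((rootSystem 𝔥).coroot α : 𝔤) := by
  obtain ⟨e, he, f, hf, ht⟩ := exists_isSl2Triple α
  obtain ⟨c, rfl⟩ := exists_eq_smul_of_mem_rootSpace he ht.e_ne_zero hx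
  obtain ⟨d, rfl⟩ := exists_eq_smul_of_mem_rootSpace hf ht.f_ne_zero hy
  exact ⟨c * d, by rw [smul_lie, lie_smul, ht.lie_e_f, smul_smul]⟩

theorem posRoots_sub_simple (b : (rootSystem 𝔥).Base) {α i γ : 𝔥.root} (hα : α ∈ posRoots b)
    (hi : i ∈ b.support)
    (h : (rootSystem 𝔥).root γ = (rootSystem 𝔥).root α + (rootSystem 𝔥).root (negRoot i)) :
    γ ∈ posRoots b :=
  RootPairing.Base.IsPos.sub hα hi (by rw [h, root_negRoot, sub_eq_add_neg])

/-- The subspace `𝔫` spanned by the positive root spaces. -/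
noncomputable abbrev npos (b : (rootSystem 𝔥).Base) : Submodule ℂ 𝔤 := rootSum (posRoots b)

/-- The subspace `𝔫⁻` spanned by the negative root spaces. -/
noncomputable abbrev nneg (b : (rootSystem 𝔥).Base) : Submodule ℂ 𝔤 := rootSum (posRoots b)ᶜ

theorem npos_induction {b : (rootSystem 𝔥).Base} {p : 𝔤 → Prop}
    (h : ∀ α ∈ posRoots b, ∀ x ∈ rootSpace 𝔥 α.1, p x) (h0 : p 0)
    (hadd : ∀ x y, p x → p y → p (x + y)) {x : 𝔤} (hx : x ∈ npos b) : p x := by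
  refine Submodule.iSup_induction _ (motive := p) hx (fun α y hy => ?_) h0 hadd
  by_cases hα : α ∈ posRoots b
  · exact h α hα y (by simpa [hα] using hy)
  · have : y = 0 := by simpa [hα] using hy
    rwa [this]

theorem nneg_induction {b : (rootSystem 𝔥).Base} {p : 𝔤 → Prop}
    (h : ∀ α ∈ posRoots b, ∀ x ∈ rootSpace 𝔥 (negRoot α).1, p x) (h0 : p 0)
    (hadd : ∀ x y, p x → p y → p (x + y)) {x : 𝔤} (hx : x ∈ nneg b) : p x := by
  refine Submodule.iSup_induction _ (motive := p) hx (fun α y hy => ?_) h0 hadd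
  by_cases hα : α ∈ (posRoots b)ᶜ
  · refine h (negRoot α) ((negRoot_mem_posRoots_iff b α).2 hα) y ?_
    rw [negRoot_negRoot]
    simpa [hα] using hy
  · have : y = 0 := by
      rw [Set.notMem_compl_iff] at hα
      simpa [hα] using hy
    rwa [this]

theorem mem_npos {b : (rootSystem 𝔥).Base} {α : 𝔥.root} (hα : α ∈ posRoots b) {x : 𝔤}
    (hx : x ∈ rootSpace 𝔥 α.1) : x ∈ npos b := rootSpace_le_rootSum_iff.2 hα hx

theorem mem_nneg {b : (rootSystem 𝔥).Base} {α : 𝔥.root} (hα : α ∈ posRoots b) {x : 𝔤}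
    (hx : x ∈ rootSpace 𝔥 (negRoot α).1) : x ∈ nneg b :=
  rootSpace_le_rootSum_iff.2 (Set.mem_compl fun h => (negRoot_mem_posRoots_iff b α).1 h hα) hx

/-- For a simple root α_i and a positive α ≠ α_i, the difference α - α_i is a positive root or not a
root; for α = α_i the bracket is a multiple of the coroot. -/
theorem exists_lie_sub_mem_npos {b : (rootSystem 𝔥).Base} {i : 𝔥.root} (hi : i ∈ b.support)
    {x y : 𝔤} (hx : x ∈ npos b) (hy : y ∈ rootSpace 𝔥 (negRoot i).1) :
    ∃ c : ℂ, ⁅x, y⁆ - c • ((rootSystem 𝔥).coroot i : 𝔤) ∈ npos b := by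
  refine npos_induction (p := fun x => ∃ c : ℂ, ⁅x, y⁆ - c • ((rootSystem 𝔥).coroot i : 𝔤) ∈ npos b)
    (fun α hα x hx => ?_) ⟨0, by simp⟩ ?_ hx
  · by_cases h : i = α
    · subst h
      obtain ⟨c, hc⟩ := exists_lie_eq_smul_coroot hx hy
      exact ⟨c, by rw [hc, sub_self]; exact zero_mem _⟩
    · refine ⟨0, ?_⟩
      rw [zero_smul, sub_zero]
      by_cases h0 : ⁅x, y⁆ = 0
      · rw [h0]; exact zero_mem _
      · obtain ⟨γ, hγ, hxy⟩ := exists_root_eq_add hx hy h0 fun h' => h (by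
          rw [← negRoot_negRoot i, h', negRoot_negRoot])
        exact mem_npos (posRoots_sub_simple b hα hi hγ) hxy
  · rintro x z ⟨c, hc⟩ ⟨d, hd⟩
    refine ⟨c + d, ?_⟩
    have : ⁅x + z, y⁆ - (c + d) • ((rootSystem 𝔥).coroot i : 𝔤) =
      (⁅x, y⁆ - c • ((rootSystem 𝔥).coroot i : 𝔤)) +
        (⁅z, y⁆ - d • ((rootSystem 𝔥).coroot i : 𝔤)) := by
      rw [add_lie, add_smul]; abel
    rw [this]
    exact add_mem hc hd

theorem exists_lie_sub_mem_nneg {b : (rootSystem 𝔥).Base} {i : 𝔥.root} (hi : i ∈ b.support)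
    {x y : 𝔤} (hx : x ∈ rootSpace 𝔥 i.1) (hy : y ∈ nneg b) :
    ∃ c : ℂ, ⁅x, y⁆ - c • ((rootSystem 𝔥).coroot i : 𝔤) ∈ nneg b := by
  refine nneg_induction (p := fun y => ∃ c : ℂ, ⁅x, y⁆ - c • ((rootSystem 𝔥).coroot i : 𝔤) ∈ nneg b)
    (fun α hα y hy => ?_) ⟨0, by simp⟩ ?_ hy
  · by_cases h : i = α
    · subst h
      obtain ⟨c, hc⟩ := exists_lie_eq_smul_coroot hx hy
      exact ⟨c, by rw [hc, sub_self]; exact zero_mem _⟩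
    · refine ⟨0, ?_⟩
      rw [zero_smul, sub_zero]
      by_cases h0 : ⁅x, y⁆ = 0
      · rw [h0]; exact zero_mem _
      · obtain ⟨γ, hγ, hxy⟩ := exists_root_eq_add hx hy h0 fun h' => h (by
          rw [← negRoot_negRoot i, ← h', negRoot_negRoot])
        refine mem_nneg (α := negRoot γ) (posRoots_sub_simple b hα hi ?_) (by rwa [negRoot_negRoot])
        rw [root_negRoot, hγ, root_negRoot, root_negRoot]
        abel
  · rintro y z ⟨c, hc⟩ ⟨d, hd⟩
    refine ⟨c + d, ?_⟩
    have : ⁅x, y + z⁆ - (c + d) • ((rootSystem 𝔥).coroot i : 𝔤) =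
      (⁅x, y⁆ - c • ((rootSystem 𝔥).coroot i : 𝔤)) +
        (⁅x, z⁆ - d • ((rootSystem 𝔥).coroot i : 𝔤)) := by
      rw [lie_add, add_smul]; abel
    rw [this]
    exact add_mem hc hd

theorem triangular (b : (rootSystem 𝔥).Base) (x : 𝔤) :
    ∃ y ∈ nneg b, ∃ h : 𝔥, ∃ z ∈ npos b, x = y + h + z := by
  have hx : x ∈ 𝔥.toSubmodule ⊔ rootSum (Set.univ : Set 𝔥.root) := by
    have h1 := cartan_sup_iSup_rootSpace_eq_top (K := ℂ) (L := 𝔤) (H := 𝔥)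
    have h2 : x ∈ (𝔥.toLieSubmodule ⊔ ⨆ α : LieModule.Weight ℂ 𝔥 𝔤, ⨆ (_ : α.IsNonZero),
      rootSpace 𝔥 α : LieSubmodule ℂ 𝔥 𝔤) := by rw [h1]; trivial
    rw [← LieSubmodule.mem_toSubmodule, LieSubmodule.sup_toSubmodule,
      LieSubmodule.iSup_toSubmodule] at h2
    have h3 : ⨆ α : LieModule.Weight ℂ 𝔥 𝔤, (⨆ (_ : α.IsNonZero), rootSpace 𝔥 α).toSubmodule ≤
        rootSum (Set.univ : Set 𝔥.root) := ?_
    · exact sup_le_sup_left h3 _ h2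
    refine iSup_le fun α => ?_
    rw [LieSubmodule.iSup_toSubmodule]
    refine iSup_le fun hα => ?_
    exact rootSpace_le_rootSum_iff (α := ⟨α, by simpa using hα⟩).2 trivial
  rw [← Set.compl_union_self (posRoots b), rootSum_union] at hx
  obtain ⟨h, hh, w, hw, rfl⟩ := Submodule.mem_sup.1 hx
  obtain ⟨y, hy, z, hz, rfl⟩ := Submodule.mem_sup.1 hw
  exact ⟨y, hy, ⟨h, hh⟩, z, hz, by simp only; abel⟩

/-- The sum of the fundamental coweights. -/
noncomputable def heightCoweight (b : (rootSystem 𝔥).Base) : 𝔥 := ∑ i, fundCoweight b i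

theorem simple_heightCoweight (b : (rootSystem 𝔥).Base) (i : b.support) :
    (rootSystem 𝔥).root i (heightCoweight b) = 1 := by
  have h : ∀ j, (rootSystem 𝔥).root (i : 𝔥.root) (fundCoweight b j) =
    Finsupp.single i (1 : ℂ) j := fun j => root_fundCoweight b j i
  rw [heightCoweight, map_sum, Finset.sum_eq_single i]
  · rw [h]; simp
  · intro j _ hj
    rw [h]; simp [hj.symm]
  · simp

theorem exists_nat_of_mem_closure {b : (rootSystem 𝔥).Base} {φ : Dual ℂ 𝔥}
    (h : φ ∈ AddSubmonoid.closure ((rootSystem 𝔥).root '' b.support)) :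
    ∃ n : ℕ, φ (heightCoweight b) = n := by
  induction h using AddSubmonoid.closure_induction with
  | mem x hx =>
    obtain ⟨i, hi, rfl⟩ := hx
    exact ⟨1, by rw [simple_heightCoweight b ⟨i, hi⟩]; simp⟩
  | zero => exact ⟨0, by simp⟩
  | add x y _ _ hx hy =>
    obtain ⟨n, hn⟩ := hx
    obtain ⟨m, hm⟩ := hy
    exact ⟨n + m, by simp [hn, hm]⟩

theorem posRoots_heightCoweight {b : (rootSystem 𝔥).Base} {α : 𝔥.root} (h : α ∈ posRoots b) :
    ∃ n : ℕ, (rootSystem 𝔥).root α (heightCoweight b) = (n + 1 : ℕ) := by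
  refine RootPairing.Base.IsPos.induction_on_add (b := b) h
    (p := fun α => ∃ n : ℕ, (rootSystem 𝔥).root α (heightCoweight b) = (n + 1 : ℕ))
    (fun i hi => ⟨0, by rw [simple_heightCoweight b ⟨i, hi⟩]; simp⟩) ?_
  rintro i j k hk ⟨n, hn⟩ hj
  refine ⟨n + 1, ?_⟩
  rw [hk, LinearMap.add_apply, hn, simple_heightCoweight b ⟨j, hj⟩]
  push_cast
  rfl

end LieDecomp

/-! ### The Harish-Chandra projection -/

namespace LieDecomp

variable {𝔤 : Type u} [LieRing 𝔤] [LieAlgebra ℂ 𝔤] [FiniteDimensional ℂ 𝔤] [LieAlgebra.IsSimple ℂ 𝔤]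
  {𝔥 : LieSubalgebra ℂ 𝔤} [𝔥.IsCartanSubalgebra]

section Enveloping

attribute [local instance 100] LieRing.ofAssociativeRing

/-- The action of the enveloping algebra on a module. -/
noncomputable def uact (M : Type*) [AddCommGroup M] [Module ℂ M] [LieRingModule 𝔤 M]
    [LieModule ℂ 𝔤 M] : UniversalEnvelopingAlgebra ℂ 𝔤 →ₐ[ℂ] Module.End ℂ M :=
  UniversalEnvelopingAlgebra.lift ℂ (LieModule.toEnd ℂ 𝔤 M)

theorem uact_ι {M : Type*} [AddCommGroup M] [Module ℂ M] [LieRingModule 𝔤 M]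
    [LieModule ℂ 𝔤 M] (x : 𝔤) (m : M) :
    uact M (UniversalEnvelopingAlgebra.ι ℂ x) m = ⁅x, m⁆ := by
  rw [uact, UniversalEnvelopingAlgebra.lift_ι_apply]
  rfl

theorem ι_mul_sub_mul_ι (x y : 𝔤) :
    UniversalEnvelopingAlgebra.ι ℂ x * UniversalEnvelopingAlgebra.ι ℂ y -
      UniversalEnvelopingAlgebra.ι ℂ y * UniversalEnvelopingAlgebra.ι ℂ x =
      UniversalEnvelopingAlgebra.ι ℂ ⁅x, y⁆ := by
  rw [LieHom.map_lie, LieRing.of_associative_ring_bracket]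

variable (𝔤) in
/-- The image of `𝔤` in its enveloping algebra. -/
noncomputable def ιRange : Submodule ℂ (UniversalEnvelopingAlgebra ℂ 𝔤) :=
  LinearMap.range (UniversalEnvelopingAlgebra.ι ℂ (L := 𝔤) : 𝔤 →ₗ[ℂ] UniversalEnvelopingAlgebra ℂ 𝔤)

theorem ι_mem_ιRange (x : 𝔤) : UniversalEnvelopingAlgebra.ι ℂ x ∈ ιRange 𝔤 := ⟨x, rfl⟩

theorem exists_ι_of_mem_ιRange {u : UniversalEnvelopingAlgebra ℂ 𝔤} (h : u ∈ ιRange 𝔤) :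
    ∃ x, u = UniversalEnvelopingAlgebra.ι ℂ x := by
  obtain ⟨x, rfl⟩ := h
  exact ⟨x, rfl⟩

theorem adjoin_range_ι : Algebra.adjoin ℂ
    (Set.range (UniversalEnvelopingAlgebra.ι ℂ (L := 𝔤))) = ⊤ := by
  have h1 : Function.Surjective (UniversalEnvelopingAlgebra.mkAlgHom ℂ 𝔤) :=
    RingCon.mk'_surjective (UniversalEnvelopingAlgebra.ringCon ℂ 𝔤)
  have h2 := (AlgHom.range_eq_top _).2 h1
  rw [← Algebra.map_top, ← TensorAlgebra.adjoin_range_ι, AlgHom.map_adjoin, ← Set.range_comp] at h2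
  exact h2

/-- Induction on the length of products of elements of 𝔤, phrased with the powers of the image of 𝔤
so that commutators, which do not increase length, can be used. -/
theorem enveloping_induction {Q : Submodule ℂ (UniversalEnvelopingAlgebra ℂ 𝔤)}
    (h : ∀ k, ιRange 𝔤 ^ k ≤ Q) (u : UniversalEnvelopingAlgebra ℂ 𝔤) : u ∈ Q := by
  have hu : u ∈ Subalgebra.toSubmodule (Algebra.adjoin ℂ
    (Set.range (UniversalEnvelopingAlgebra.ι ℂ (L := 𝔤)))) := by rw [adjoin_range_ι]; trivial
  rw [Algebra.adjoin_eq_span] at hu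
  refine Submodule.span_le.2 ?_ hu
  intro w hw
  suffices hk : ∃ k, w ∈ ιRange 𝔤 ^ k by
    obtain ⟨k, hk⟩ := hk
    exact h k hk
  induction hw using Submonoid.closure_induction with
  | mem x hx =>
    obtain ⟨x, rfl⟩ := hx
    exact ⟨1, by rw [pow_one]; exact ι_mem_ιRange x⟩
  | one => exact ⟨0, by rw [pow_zero]; exact Submodule.one_le.1 le_rfl⟩
  | mul x y _ _ hx hy =>
    obtain ⟨k, hk⟩ := hx
    obtain ⟨l, hl⟩ := hy
    exact ⟨k + l, by rw [pow_add]; exact Submodule.mul_mem_mul hk hl⟩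

theorem commutator_mem_pow (x : 𝔤) (k : ℕ) {u : UniversalEnvelopingAlgebra ℂ 𝔤}
    (hu : u ∈ ιRange 𝔤 ^ k) :
    UniversalEnvelopingAlgebra.ι ℂ x * u - u * UniversalEnvelopingAlgebra.ι ℂ x ∈ ιRange 𝔤 ^ k := by
  induction k generalizing u with
  | zero =>
    rw [pow_zero] at hu
    obtain ⟨c, rfl⟩ := Submodule.mem_one.1 hu
    rw [Algebra.commutes, sub_self]
    exact zero_mem _
  | succ k ih =>
    rw [pow_succ'] at hu ⊢
    refine Submodule.mul_induction_on hu (fun a ha w hw => ?_) fun a c ha hc => ?_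
    · obtain ⟨y, rfl⟩ := exists_ι_of_mem_ιRange ha
      have : UniversalEnvelopingAlgebra.ι ℂ x * (UniversalEnvelopingAlgebra.ι ℂ y * w) -
          UniversalEnvelopingAlgebra.ι ℂ y * w * UniversalEnvelopingAlgebra.ι ℂ x =
          (UniversalEnvelopingAlgebra.ι ℂ x * UniversalEnvelopingAlgebra.ι ℂ y -
            UniversalEnvelopingAlgebra.ι ℂ y * UniversalEnvelopingAlgebra.ι ℂ x) * w +
          UniversalEnvelopingAlgebra.ι ℂ y * (UniversalEnvelopingAlgebra.ι ℂ x * w -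
            w * UniversalEnvelopingAlgebra.ι ℂ x) := by noncomm_ring
      rw [this, ι_mul_sub_mul_ι]
      exact add_mem (Submodule.mul_mem_mul (ι_mem_ιRange _) hw)
        (Submodule.mul_mem_mul (ι_mem_ιRange _) (ih hw))
    · have : UniversalEnvelopingAlgebra.ι ℂ x * (a + c) - (a + c) * UniversalEnvelopingAlgebra.ι ℂ x =
        (UniversalEnvelopingAlgebra.ι ℂ x * a - a * UniversalEnvelopingAlgebra.ι ℂ x) +
        (UniversalEnvelopingAlgebra.ι ℂ x * c - c * UniversalEnvelopingAlgebra.ι ℂ x) := by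
        noncomm_ring
      rw [this]
      exact add_mem ha hc

end Enveloping

section Modules

variable {M : Type*} [AddCommGroup M] [Module ℂ M] [LieRingModule 𝔤 M] [LieModule ℂ 𝔤 M]

/-- `v` is annihilated by the positive root spaces and has weight `φ`. -/
structure IsHighest (b : (rootSystem 𝔥).Base) (φ : Dual ℂ 𝔥) (v : M) : Prop where
  lie_pos : ∀ x ∈ npos b, ⁅x, v⁆ = 0
  lie_cartan : ∀ h : 𝔥, ⁅(h : 𝔤), v⁆ = φ h • v

/-- The form `ξ` vanishes on `𝔫⁻ M` and has weight `φ`. -/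
structure IsLowest (b : (rootSystem 𝔥).Base) (φ : Dual ℂ 𝔥) (ξ : Dual ℂ M) : Prop where
  lie_neg : ∀ x ∈ nneg b, ∀ m, ξ ⁅x, m⁆ = 0
  lie_cartan : ∀ (h : 𝔥) (m : M), ξ ⁅(h : 𝔤), m⁆ = φ h * ξ m

end Modules

/-- The weights `φ` for which some module has a highest weight vector of weight `φ` paired
nontrivially with a form of weight `φ` vanishing on `𝔫⁻ M`. -/
def pairedWeights (b : (rootSystem 𝔥).Base) : Set (Dual ℂ 𝔥) :=
  {φ | ∃ (M : Type u) (_ : AddCommGroup M) (_ : Module ℂ M) (_ : LieRingModule 𝔤 M)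
    (_ : LieModule ℂ 𝔤 M) (v : M) (ξ : Dual ℂ M), IsHighest b φ v ∧ IsLowest b φ ξ ∧ ξ v = 1}

theorem apply_eq_sum_repr {κ : Type*} [Fintype κ] (μ : Basis κ ℂ (Dual ℂ 𝔥)) (φ : Dual ℂ 𝔥) (h : 𝔥) :
    φ h = ∑ i, μ i h * μ.repr φ i := by
  have := LinearMap.congr_fun (μ.sum_repr φ).symm h
  rw [this, LinearMap.sum_apply]
  exact Finset.sum_congr rfl fun i _ => by rw [LinearMap.smul_apply, smul_eq_mul, mul_comm]

/-- The Harish-Chandra projection. The polynomial depends on u alone, and w need not be a weight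
vector; this is later used for singular vectors. -/
theorem exists_polynomial (b : (rootSystem 𝔥).Base) {κ : Type*} [Fintype κ]
    (μ : Basis κ ℂ (Dual ℂ 𝔥)) (u : UniversalEnvelopingAlgebra ℂ 𝔤) :
    ∃ P : MvPolynomial κ ℂ, ∀ (M : Type u) [AddCommGroup M] [Module ℂ M] [LieRingModule 𝔤 M]
      [LieModule ℂ 𝔤 M] (φ : Dual ℂ 𝔥) (ξ : Dual ℂ M), IsLowest b φ ξ →
      ∀ w : M, (∀ x ∈ npos b, ⁅x, w⁆ = 0) →
        ξ (uact M u w) = MvPolynomial.eval (fun i => μ.repr φ i) P * ξ w := by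
  let Q : Submodule ℂ (UniversalEnvelopingAlgebra ℂ 𝔤) :=
    { carrier := {u | ∃ P : MvPolynomial κ ℂ, ∀ (M : Type u) [AddCommGroup M] [Module ℂ M]
        [LieRingModule 𝔤 M] [LieModule ℂ 𝔤 M] (φ : Dual ℂ 𝔥) (ξ : Dual ℂ M), IsLowest b φ ξ →
        ∀ w : M, (∀ x ∈ npos b, ⁅x, w⁆ = 0) →
          ξ (uact M u w) = MvPolynomial.eval (fun i => μ.repr φ i) P * ξ w}
      add_mem' := by
        rintro u u' ⟨P, hP⟩ ⟨P', hP'⟩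
        refine ⟨P + P', ?_⟩
        intro M _ _ _ _ φ ξ hξ w hw
        rw [map_add, LinearMap.add_apply, map_add, hP M φ ξ hξ w hw, hP' M φ ξ hξ w hw, map_add]
        ring
      zero_mem' := ⟨0, by intros; simp⟩
      smul_mem' := by
        rintro c u ⟨P, hP⟩
        refine ⟨MvPolynomial.C c * P, ?_⟩
        intro M _ _ _ _ φ ξ hξ w hw
        rw [map_smul, LinearMap.smul_apply, map_smul, hP M φ ξ hξ w hw, map_mul,
          MvPolynomial.eval_C, smul_eq_mul]
        ring }
  refine enveloping_induction (Q := Q) (fun k => ?_) u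
  induction k with
  | zero =>
    rw [pow_zero, Submodule.one_le]
    refine ⟨1, ?_⟩
    intro M _ _ _ _ φ ξ hξ w hw
    simp
  | succ k ih =>
    rw [pow_succ', Submodule.mul_le]
    intro a ha w hw
    obtain ⟨x, rfl⟩ := exists_ι_of_mem_ιRange ha
    obtain ⟨y, hy, h, z, hz, rfl⟩ := triangular b x
    rw [map_add, map_add, add_mul, add_mul]
    refine add_mem (add_mem ?_ ?_) ?_
    -- A leading factor from 𝔫⁻ is killed by ξ.
    · refine ⟨0, ?_⟩
      intro M _ _ _ _ φ ξ hξ m hm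
      rw [map_mul, Module.End.mul_apply, uact_ι, hξ.lie_neg y hy]
      simp
    -- A leading factor h ∈ 𝔥 multiplies the polynomial by the linear function φ ↦ φ(h).
    · obtain ⟨P, hP⟩ := ih hw
      refine ⟨(∑ i, MvPolynomial.C (μ i h) * MvPolynomial.X i) * P, ?_⟩
      intro M _ _ _ _ φ ξ hξ m hm
      have hφ := apply_eq_sum_repr μ φ h
      rw [map_mul, Module.End.mul_apply, uact_ι, hξ.lie_cartan, hP M φ ξ hξ m hm, hφ]
      simp [mul_assoc]
    -- A leading factor z ∈ 𝔫 kills the vector once moved to the right, so only the commutator,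
    -- still of length k, contributes.
    · obtain ⟨P, hP⟩ := ih (commutator_mem_pow z k hw)
      refine ⟨P, ?_⟩
      intro M _ _ _ _ φ ξ hξ m hm
      rw [← hP M φ ξ hξ m hm, map_sub, map_mul, map_mul, LinearMap.sub_apply, Module.End.mul_apply,
        Module.End.mul_apply, uact_ι z m, hm z hz, map_zero, sub_zero]

/-- A linear form on the enveloping algebra describing a universal highest weight module. -/
structure IsUniversalForm (b : (rootSystem 𝔥).Base) (φ : Dual ℂ 𝔥)
    (F : Dual ℂ (UniversalEnvelopingAlgebra ℂ 𝔤)) : Prop where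
  one : F 1 = 1
  neg_mul : ∀ x ∈ nneg b, ∀ u, F (UniversalEnvelopingAlgebra.ι ℂ x * u) = 0
  mul_pos : ∀ x ∈ npos b, ∀ u, F (u * UniversalEnvelopingAlgebra.ι ℂ x) = 0
  cartan_mul : ∀ (h : 𝔥) u, F (UniversalEnvelopingAlgebra.ι ℂ (h : 𝔤) * u) = φ h * F u
  mul_cartan : ∀ (h : 𝔥) u, F (u * UniversalEnvelopingAlgebra.ι ℂ (h : 𝔤)) = φ h * F u

/-- The natural combinations of the basis `μ` are Zariski dense, so the polynomial attached to u is
unique, hence linear in u and compatible with multiplication by 𝔫⁻, 𝔥 and 𝔫. Evaluating it at an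
arbitrary φ gives the form. -/
theorem exists_isUniversalForm (b : (rootSystem 𝔥).Base) {κ : Type*} [Fintype κ]
    (μ : Basis κ ℂ (Dual ℂ 𝔥)) (hμ : ∀ n : κ → ℕ, ∑ i, n i • μ i ∈ pairedWeights b)
    (φ : Dual ℂ 𝔥) : ∃ F : Dual ℂ (UniversalEnvelopingAlgebra ℂ 𝔤), IsUniversalForm b φ F := by
  let R : UniversalEnvelopingAlgebra ℂ 𝔤 → MvPolynomial κ ℂ → Prop := fun u P =>
    ∀ (M : Type u) [AddCommGroup M] [Module ℂ M] [LieRingModule 𝔤 M]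
      [LieModule ℂ 𝔤 M] (ψ : Dual ℂ 𝔥) (v : M) (ξ : Dual ℂ M), IsHighest b ψ v → IsLowest b ψ ξ →
      ξ v = 1 → ξ (uact M u v) = MvPolynomial.eval (fun i => μ.repr ψ i) P
  have hex : ∀ u, ∃ P, R u P := fun u => by
    obtain ⟨P, hP⟩ := exists_polynomial b μ u
    refine ⟨P, ?_⟩
    intro M _ _ _ _ ψ v ξ hv hξ h1
    rw [hP M ψ ξ hξ v hv.lie_pos, h1, mul_one]
  have huniq : ∀ {u P P'}, R u P → R u P' → P = P' := by
    intro u P P' h h'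
    refine MvPolynomial.funext_set (fun _ => Set.range (Nat.cast : ℕ → ℂ))
      (fun _ => Set.infinite_range_of_injective Nat.cast_injective) ?_
    intro x hx
    choose n hn using fun i => hx i trivial
    obtain ⟨M, _, _, _, _, v, ξ, hv, hξ, h1⟩ := hμ n
    have hrepr : (fun i => μ.repr (∑ i, n i • μ i) i) = x := by
      ext i
      have : ∑ i, n i • μ i = ∑ i, (n i : ℂ) • μ i :=
        Finset.sum_congr rfl fun i _ => (Nat.cast_smul_eq_nsmul ℂ (n i) (μ i)).symm
      rw [← hn i, this, Basis.repr_sum_self]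
    rw [← hrepr, ← h M _ v ξ hv hξ h1, ← h' M _ v ξ hv hξ h1]
  choose H hH using hex
  refine ⟨{ toFun := fun u => MvPolynomial.eval (fun i => μ.repr φ i) (H u)
            map_add' := ?_
            map_smul' := ?_ }, ?_, ?_, ?_, ?_, ?_⟩
  · intro u u'
    rw [← map_add]
    congr 1
    refine huniq (hH _) ?_
    intro M _ _ _ _ ψ v ξ hv hξ h1
    rw [map_add, LinearMap.add_apply, map_add, hH u M ψ v ξ hv hξ h1, hH u' M ψ v ξ hv hξ h1,
      map_add]
  · intro c u
    have : H (c • u) = MvPolynomial.C c * H u := by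
      refine huniq (hH _) ?_
      intro M _ _ _ _ ψ v ξ hv hξ h1
      rw [map_smul, LinearMap.smul_apply, map_smul, hH u M ψ v ξ hv hξ h1, map_mul,
        MvPolynomial.eval_C, smul_eq_mul]
    simp only [this]
    simp
  · have : H 1 = 1 := by
      refine huniq (hH _) ?_
      intro M _ _ _ _ ψ v ξ hv hξ h1
      simp [h1]
    simp only [LinearMap.coe_mk, AddHom.coe_mk, this]
    simp
  · intro x hx u
    have : H (UniversalEnvelopingAlgebra.ι ℂ x * u) = 0 := by
      refine huniq (hH _) ?_
      intro M _ _ _ _ ψ v ξ hv hξ h1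
      rw [map_mul, Module.End.mul_apply, uact_ι, hξ.lie_neg x hx, map_zero]
    simp only [LinearMap.coe_mk, AddHom.coe_mk, this]
    simp
  · intro x hx u
    have : H (u * UniversalEnvelopingAlgebra.ι ℂ x) = 0 := by
      refine huniq (hH _) ?_
      intro M _ _ _ _ ψ v ξ hv hξ h1
      rw [map_mul, Module.End.mul_apply, uact_ι, hv.lie_pos x hx, map_zero, map_zero, map_zero]
    simp only [LinearMap.coe_mk, AddHom.coe_mk, this]
    simp
  · intro h u
    have : H (UniversalEnvelopingAlgebra.ι ℂ (h : 𝔤) * u) =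
        (∑ i, MvPolynomial.C (μ i h) * MvPolynomial.X i) * H u := by
      refine huniq (hH _) ?_
      intro M _ _ _ _ ψ v ξ hv hξ h1
      have hψ := apply_eq_sum_repr μ ψ h
      rw [map_mul, Module.End.mul_apply, uact_ι, hξ.lie_cartan, hH u M ψ v ξ hv hξ h1, hψ]
      simp
    have hφ := apply_eq_sum_repr μ φ h
    simp only [LinearMap.coe_mk, AddHom.coe_mk, this, hφ]; simp
  · intro h u
    have : H (u * UniversalEnvelopingAlgebra.ι ℂ (h : 𝔤)) =
        (∑ i, MvPolynomial.C (μ i h) * MvPolynomial.X i) * H u := by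
      refine huniq (hH _) ?_
      intro M _ _ _ _ ψ v ξ hv hξ h1
      have hψ := apply_eq_sum_repr μ ψ h
      rw [map_mul, Module.End.mul_apply, uact_ι, hv.lie_cartan, map_smul, map_smul,
        hH u M ψ v ξ hv hξ h1, hψ]
      simp
    have hφ := apply_eq_sum_repr μ φ h
    simp only [LinearMap.coe_mk, AddHom.coe_mk, this, hφ]; simp

end LieDecomp

/-! ### Existence of modules with a prescribed highest weight -/

namespace LieDecomp

variable {𝔤 : Type u} [LieRing 𝔤] [LieAlgebra ℂ 𝔤] [FiniteDimensional ℂ 𝔤] [LieAlgebra.IsSimple ℂ 𝔤]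
  {𝔥 : LieSubalgebra ℂ 𝔤} [𝔥.IsCartanSubalgebra]

open scoped TensorProduct

section Tensor

variable {M N : Type*} [AddCommGroup M] [Module ℂ M] [LieRingModule 𝔤 M] [LieModule ℂ 𝔤 M]
  [AddCommGroup N] [Module ℂ N] [LieRingModule 𝔤 N] [LieModule ℂ 𝔤 N]
  {b : (rootSystem 𝔥).Base} {φ ψ : Dual ℂ 𝔥}

theorem IsHighest.tmul {v : M} {w : N} (hv : IsHighest b φ v) (hw : IsHighest b ψ w) :
    IsHighest b (φ + ψ) (v ⊗ₜ[ℂ] w) where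
  lie_pos x hx := by
    rw [TensorProduct.LieModule.lie_tmul_right, hv.lie_pos x hx, hw.lie_pos x hx]
    simp
  lie_cartan h := by
    rw [TensorProduct.LieModule.lie_tmul_right, hv.lie_cartan, hw.lie_cartan,
      TensorProduct.tmul_smul, ← TensorProduct.smul_tmul', LinearMap.add_apply, add_smul]

theorem IsLowest.tmul {ξ : Dual ℂ M} {ζ : Dual ℂ N} (hξ : IsLowest b φ ξ) (hζ : IsLowest b ψ ζ) :
    IsLowest b (φ + ψ) (TensorProduct.dualDistrib ℂ M N (ξ ⊗ₜ[ℂ] ζ)) where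
  lie_neg x hx t := by
    induction t with
    | zero => simp
    | tmul m n =>
      rw [TensorProduct.LieModule.lie_tmul_right, map_add, TensorProduct.dualDistrib_apply,
        TensorProduct.dualDistrib_apply, hξ.lie_neg x hx, hζ.lie_neg x hx]
      simp
    | add s t hs ht => rw [lie_add, map_add, hs, ht, add_zero]
  lie_cartan h t := by
    induction t with
    | zero => simp
    | tmul m n =>
      rw [TensorProduct.LieModule.lie_tmul_right, map_add, TensorProduct.dualDistrib_apply,
        TensorProduct.dualDistrib_apply, TensorProduct.dualDistrib_apply, hξ.lie_cartan,
        hζ.lie_cartan, LinearMap.add_apply]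
      ring
    | add s t hs ht => rw [lie_add, map_add, hs, ht, map_add, mul_add]

/-- The highest weight vector `v ⊗ y v - y v ⊗ v` in the tensor square. -/
theorem IsHighest.tmul_sub_tmul {i : 𝔥.root} (hi : i ∈ b.support) {v : M} (hv : IsHighest b φ v)
    {y : 𝔤} (hy : y ∈ rootSpace 𝔥 (negRoot i).1) :
    IsHighest b (φ + φ - (rootSystem 𝔥).root i) (v ⊗ₜ[ℂ] ⁅y, v⁆ - ⁅y, v⁆ ⊗ₜ[ℂ] v) where
  lie_pos x hx := by
    obtain ⟨c, hc⟩ := exists_lie_sub_mem_npos hi hx hy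
    have h1 : ⁅x, ⁅y, v⁆⁆ = (c * φ ((rootSystem 𝔥).coroot i)) • v := by
      have := hv.lie_pos _ hc
      rw [sub_lie, smul_lie, hv.lie_cartan, sub_eq_zero, lie_lie, hv.lie_pos x hx, lie_zero,
        sub_zero, smul_smul] at this
      exact this
    rw [lie_sub, TensorProduct.LieModule.lie_tmul_right, TensorProduct.LieModule.lie_tmul_right,
      hv.lie_pos x hx, h1, TensorProduct.zero_tmul, TensorProduct.tmul_zero,
      TensorProduct.tmul_smul, TensorProduct.smul_tmul']
    simp
  lie_cartan h := by
    have h1 : ⁅(h : 𝔤), ⁅y, v⁆⁆ = (φ - (rootSystem 𝔥).root i) h • ⁅y, v⁆ := by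
      rw [leibniz_lie, lie_cartan_rootSpace hy, hv.lie_cartan, smul_lie, lie_smul, root_negRoot,
        ← add_smul]
      congr 1
      rw [LinearMap.neg_apply, LinearMap.sub_apply]
      ring
    rw [lie_sub, TensorProduct.LieModule.lie_tmul_right, TensorProduct.LieModule.lie_tmul_right,
      hv.lie_cartan, h1]
    simp only [TensorProduct.tmul_smul, ← TensorProduct.smul_tmul', LinearMap.add_apply,
      LinearMap.sub_apply]
    module

theorem IsLowest.tmul_sub_tmul {i : 𝔥.root} (hi : i ∈ b.support) {ξ : Dual ℂ M}
    (hξ : IsLowest b φ ξ) {x : 𝔤} (hx : x ∈ rootSpace 𝔥 i.1) :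
    IsLowest b (φ + φ - (rootSystem 𝔥).root i) (TensorProduct.dualDistrib ℂ M M
      (ξ ⊗ₜ[ℂ] (ξ ∘ₗ LieModule.toEnd ℂ 𝔤 M x) - (ξ ∘ₗ LieModule.toEnd ℂ 𝔤 M x) ⊗ₜ[ℂ] ξ)) where
  lie_neg y hy t := by
    obtain ⟨c, hc⟩ := exists_lie_sub_mem_nneg hi hx hy
    have h1 : ∀ m, ξ ⁅x, ⁅y, m⁆⁆ = c * φ ((rootSystem 𝔥).coroot i) * ξ m := by
      intro m
      have := hξ.lie_neg _ hc m
      rw [sub_lie, smul_lie, map_sub, map_smul, hξ.lie_cartan, sub_eq_zero, lie_lie, map_sub,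
        hξ.lie_neg y hy, sub_zero, smul_eq_mul, ← mul_assoc] at this
      exact this
    induction t with
    | zero => simp
    | tmul m n =>
      rw [TensorProduct.LieModule.lie_tmul_right]
      simp only [map_sub, map_add, LinearMap.sub_apply, TensorProduct.dualDistrib_apply,
        LinearMap.comp_apply, LieModule.toEnd_apply_apply, hξ.lie_neg y hy, h1]
      ring
    | add s t hs ht => rw [lie_add, map_add, hs, ht, add_zero]
  lie_cartan h t := by
    have h1 : ∀ m, ξ ⁅x, ⁅(h : 𝔤), m⁆⁆ = (φ - (rootSystem 𝔥).root i) h * ξ ⁅x, m⁆ := by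
      intro m
      have h2 : ⁅x, ⁅(h : 𝔤), m⁆⁆ = ⁅(h : 𝔤), ⁅x, m⁆⁆ - ⁅⁅(h : 𝔤), x⁆, m⁆ := by
        rw [lie_lie]; abel
      rw [h2, map_sub, hξ.lie_cartan, lie_cartan_rootSpace hx, smul_lie, map_smul, smul_eq_mul,
        LinearMap.sub_apply]
      ring
    induction t with
    | zero => simp
    | tmul m n =>
      rw [TensorProduct.LieModule.lie_tmul_right]
      simp only [map_sub, map_add, LinearMap.sub_apply, TensorProduct.dualDistrib_apply,
        LinearMap.comp_apply, LieModule.toEnd_apply_apply, hξ.lie_cartan, h1, LinearMap.add_apply]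
      ring
    | add s t hs ht => rw [lie_add, map_add, hs, ht, map_add, mul_add]

end Tensor

theorem add_mem_pairedWeights {b : (rootSystem 𝔥).Base} {φ ψ : Dual ℂ 𝔥}
    (hφ : φ ∈ pairedWeights b) (hψ : ψ ∈ pairedWeights b) : φ + ψ ∈ pairedWeights b := by
  obtain ⟨M, _, _, _, _, v, ξ, hv, hξ, h1⟩ := hφ
  obtain ⟨N, _, _, _, _, w, ζ, hw, hζ, h2⟩ := hψ
  exact ⟨M ⊗[ℂ] N, _, _, _, inferInstance, _, _, hv.tmul hw, hξ.tmul hζ, by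
    rw [TensorProduct.dualDistrib_apply, h1, h2, one_mul]⟩

theorem zero_mem_pairedWeights (b : (rootSystem 𝔥).Base) : (0 : Dual ℂ 𝔥) ∈ pairedWeights b := by
  let _ : LieRingModule 𝔤 (ULift.{u} ℂ) :=
    { bracket := fun _ _ => 0
      add_lie := by intros; simp
      lie_add := by intros; simp
      leibniz_lie := by intros; simp }
  have h0 : ∀ (x : 𝔤) (m : ULift.{u} ℂ), ⁅x, m⁆ = 0 := fun _ _ => rfl
  let _ : LieModule ℂ 𝔤 (ULift.{u} ℂ) :=
    { smul_lie := by intros; simp [h0]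
      lie_smul := by intros; simp [h0] }
  exact ⟨ULift.{u} ℂ, _, _, _, inferInstance, ⟨1⟩,
    (ULift.moduleEquiv : ULift.{u} ℂ ≃ₗ[ℂ] ℂ).toLinearMap, ⟨by simp [h0], by simp [h0]⟩,
    ⟨by simp [h0], by simp [h0]⟩, rfl⟩

/-- In the tensor square the vector v ⊗ fv - fv ⊗ v pairs with the corresponding antisymmetric form
to 2φ(α_i^∨), up to which it is normalised. -/
theorem add_sub_mem_pairedWeights {b : (rootSystem 𝔥).Base} {φ : Dual ℂ 𝔥}
    (hφ : φ ∈ pairedWeights b) {i : 𝔥.root} (hi : i ∈ b.support)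
    (h : φ ((rootSystem 𝔥).coroot i) ≠ 0) : φ + φ - (rootSystem 𝔥).root i ∈ pairedWeights b := by
  obtain ⟨M, _, _, _, _, v, ξ, hv, hξ, h1⟩ := hφ
  obtain ⟨e, he, f, hf, ht⟩ := exists_isSl2Triple i
  have hv' := hv.tmul_sub_tmul hi hf
  have hξ' := hξ.tmul_sub_tmul hi he
  have hev : ⁅e, v⁆ = 0 := hv.lie_pos e (mem_npos (simple_mem_posRoots b hi) he)
  have hefv : ξ ⁅e, ⁅f, v⁆⁆ = φ ((rootSystem 𝔥).coroot i) := by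
    rw [leibniz_lie, ht.lie_e_f, hev, lie_zero, add_zero, hv.lie_cartan, map_smul, h1, smul_eq_mul,
      mul_one]
  have hfv : ξ ⁅f, v⁆ = 0 := hξ.lie_neg f (mem_nneg (simple_mem_posRoots b hi) hf) v
  have hne : (2 * φ ((rootSystem 𝔥).coroot i)) ≠ 0 := mul_ne_zero two_ne_zero h
  refine ⟨M ⊗[ℂ] M, _, _, _, inferInstance,
    (2 * φ ((rootSystem 𝔥).coroot i))⁻¹ • (v ⊗ₜ[ℂ] ⁅f, v⁆ - ⁅f, v⁆ ⊗ₜ[ℂ] v), _,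
    ⟨fun x hx => ?_, fun h => ?_⟩, hξ', ?_⟩
  · rw [lie_smul, hv'.lie_pos x hx, smul_zero]
  · rw [lie_smul, hv'.lie_cartan, smul_comm]
  · rw [map_smul, smul_eq_mul, inv_mul_eq_one₀ hne]
    simp only [map_sub, LinearMap.sub_apply, TensorProduct.dualDistrib_apply,
        LinearMap.comp_apply, LieModule.toEnd_apply_apply, h1, hev, hfv, hefv, map_zero]
    ring

/-- In the adjoint module, a root vector e of maximal height is killed by 𝔫. The Killing form
against a vector of the opposite root space supplies the form. -/
theorem exists_root_mem_pairedWeights (b : (rootSystem 𝔥).Base) :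
    ∃ θ : 𝔥.root, (rootSystem 𝔥).root θ ∈ pairedWeights b := by
  obtain ⟨i⟩ := base_support_nonempty b
  have : Nonempty 𝔥.root := ⟨i⟩
  obtain ⟨θ, hθ⟩ := Finite.exists_max (fun α : 𝔥.root => b.height α)
  have hθpos : 0 < b.height θ := lt_of_lt_of_le (simple_mem_posRoots b i.2) (hθ i)
  have key : ∀ {e}, e ∈ rootSpace 𝔥 θ.1 → ∀ x ∈ npos b, ⁅x, e⁆ = 0 := by
    intro e he x hx
    refine npos_induction (p := fun x => ⁅x, e⁆ = 0) (fun α hα x hx => ?_) (by simp)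
      (fun x y hx hy => by rw [add_lie, hx, hy, add_zero]) hx
    by_contra h0
    have hα' : 0 < b.height α := hα
    obtain ⟨γ, hγ, -⟩ := exists_root_eq_add hx he h0 fun h =>
      (negRoot_mem_posRoots_iff b α).1 (h ▸ hθpos) hα
    have := hθ γ
    rw [b.height_add hγ] at this
    omega
  have key' : ∀ {f}, f ∈ rootSpace 𝔥 (negRoot θ).1 → ∀ x ∈ nneg b, ⁅x, f⁆ = 0 := by
    intro f hf x hx
    refine nneg_induction (p := fun x => ⁅x, f⁆ = 0) (fun α hα x hx => ?_) (by simp)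
      (fun x y hx hy => by rw [add_lie, hx, hy, add_zero]) hx
    by_contra h0
    have hα' : 0 < b.height α := hα
    obtain ⟨γ, hγ, -⟩ := exists_root_eq_add hx hf h0 fun h =>
      (negRoot_mem_posRoots_iff b θ).1 (by rw [h, negRoot_negRoot]; exact hα) hθpos
    have h1 := hθ (negRoot γ)
    rw [b.height_add (i := α) (j := θ) (k := negRoot γ)
      (by rw [root_negRoot, hγ, root_negRoot, root_negRoot]; abel)] at h1
    omega
  obtain ⟨e, he, he0⟩ := θ.1.exists_ne_zero
  obtain ⟨f, hf, hef⟩ : ∃ f ∈ rootSpace 𝔥 (negRoot θ).1, killingForm ℂ 𝔤 f e ≠ 0 := by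
    by_contra! hcon
    apply he0
    have := mem_ker_killingForm_of_mem_rootSpace_of_forall_rootSpace_neg ℂ 𝔤 𝔥 he fun y hy => by
      rw [LieModule.traceForm_comm]
      exact hcon y (mem_rootSpace_negRoot.2 hy)
    rwa [LieAlgebra.IsKilling.ker_killingForm_eq_bot, Submodule.mem_bot] at this
  have hinv : ∀ x m, killingForm ℂ 𝔤 f ⁅x, m⁆ = - killingForm ℂ 𝔤 ⁅x, f⁆ m := fun x m => by
    rw [LieModule.traceForm_apply_lie_apply', neg_neg]
  refine ⟨θ, 𝔤, _, _, _, inferInstance, e, (killingForm ℂ 𝔤 f e)⁻¹ • killingForm ℂ 𝔤 f,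
    ⟨key he, lie_cartan_rootSpace he⟩, ⟨fun x hx m => ?_, fun h m => ?_⟩, ?_⟩
  · rw [LinearMap.smul_apply, hinv, key' hf x hx]
    simp
  · rw [LinearMap.smul_apply, LinearMap.smul_apply, hinv, lie_cartan_rootSpace hf, root_negRoot,
      map_smul]
    simp only [LinearMap.smul_apply, LinearMap.neg_apply, smul_eq_mul]
    ring
  · rw [LinearMap.smul_apply, smul_eq_mul, inv_mul_cancel₀ hef]

/-- If φ is paired and φ(α_i^∨) ≠ 0, then 2φ and 2φ - α_i lie in the span, hence so does α_i. The
span is therefore stable under simple reflections, and it is nonzero, so irreducibility makes it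
everything. -/
theorem span_pairedWeights (b : (rootSystem 𝔥).Base) :
    Submodule.span ℂ (pairedWeights b) = ⊤ := by
  refine RootPairing.IsIrreducible.eq_top_of_invtSubmodule_reflection (P := rootSystem 𝔥) _
    ((b.forall_mem_support_invtSubmodule_iff _).1 fun i hi => ?_) ?_
  · rw [Module.End.mem_invtSubmodule, Submodule.span_le]
    intro φ hφ
    change (rootSystem 𝔥).reflection i φ ∈ Submodule.span ℂ (pairedWeights b)
    have hφ' := Submodule.subset_span (R := ℂ) hφ
    rw [RootPairing.reflection_apply]
    by_cases h : (rootSystem 𝔥).toLinearMap φ ((rootSystem 𝔥).coroot i) = 0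
    · have h0 : (rootSystem 𝔥).coroot' i φ = 0 := h
      rw [h0, zero_smul, sub_zero]
      exact hφ'
    · have h1 := Submodule.subset_span (R := ℂ) (add_sub_mem_pairedWeights hφ hi h)
      have h2 : (rootSystem 𝔥).root i ∈ Submodule.span ℂ (pairedWeights b) := by
        have := sub_mem (add_mem hφ' hφ') h1
        rwa [sub_sub_cancel] at this
      exact sub_mem hφ' (Submodule.smul_mem _ _ h2)
  · intro h
    obtain ⟨θ, hθ⟩ := exists_root_mem_pairedWeights b
    have := Submodule.subset_span (R := ℂ) hθ
    rw [h] at this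
    exact (rootSystem 𝔥).ne_zero θ this

theorem exists_universalForm (b : (rootSystem 𝔥).Base) (φ : Dual ℂ 𝔥) :
    ∃ F : Dual ℂ (UniversalEnvelopingAlgebra ℂ 𝔤), IsUniversalForm b φ F := by
  let μ := Basis.ofSpan (span_pairedWeights b).ge
  have hμ : ∀ i, μ i ∈ pairedWeights b := fun i =>
    Basis.ofSpan_subset (span_pairedWeights b).ge (Set.mem_range_self i)
  have : Fintype ((linearIndepOn_empty ℂ id).extend (Set.empty_subset (pairedWeights b))) :=
    FiniteDimensional.fintypeBasisIndex μ
  let S : AddSubmonoid (Dual ℂ 𝔥) :=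
    { carrier := pairedWeights b
      add_mem' := add_mem_pairedWeights
      zero_mem' := zero_mem_pairedWeights b }
  exact exists_isUniversalForm b μ
    (fun n => sum_mem (S := S) fun i _ => nsmul_mem (S := S) (hμ i) (n i)) φ

section Irreducible

attribute [local instance 100] LieRing.ofAssociativeRing

/-- The irreducible highest weight module of highest weight `φ`. -/
theorem exists_irreducible (b : (rootSystem 𝔥).Base) (φ : Dual ℂ 𝔥) :
    ∃ (M : Type u) (_ : AddCommGroup M) (_ : Module ℂ M) (_ : LieRingModule 𝔤 M)
      (_ : LieModule ℂ 𝔤 M) (v : M) (ξ : Dual ℂ M), IsHighest b φ v ∧ IsLowest b φ ξ ∧ ξ v = 1 ∧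
      (∀ m, ∃ u, uact (𝔤 := 𝔤) M u v = m) ∧
      ∀ m, (∀ u : UniversalEnvelopingAlgebra ℂ 𝔤, ξ (uact M u m) = 0) → m = 0 := by
  obtain ⟨F, hF⟩ := exists_universalForm b φ
  set U := UniversalEnvelopingAlgebra ℂ 𝔤
  -- The largest left ideal contained in the kernel of `F`; dividing by it is what makes the induced
  -- form detect every nonzero vector.
  let K : Submodule U U :=
    { carrier := {u | ∀ x, F (x * u) = 0}
      add_mem' := fun {u w} hu hw x => by rw [mul_add, map_add, hu x, hw x, add_zero]
      zero_mem' := fun x => by rw [mul_zero, map_zero]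
      smul_mem' := fun c u hu x => by rw [smul_eq_mul, ← mul_assoc]; exact hu _ }
  have hK : ∀ u, u ∈ K ↔ ∀ x, F (x * u) = 0 := fun _ => Iff.rfl
  let _ : LieRingModule 𝔤 (U ⧸ K) :=
    { bracket := fun x m => UniversalEnvelopingAlgebra.ι ℂ x • m
      add_lie := fun x y m => by
        rw [map_add, add_smul]
      lie_add := fun x m n => smul_add _ _ _
      leibniz_lie := fun x y m => by
        change UniversalEnvelopingAlgebra.ι ℂ x • UniversalEnvelopingAlgebra.ι ℂ y • m =
          UniversalEnvelopingAlgebra.ι ℂ ⁅x, y⁆ • m +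
            UniversalEnvelopingAlgebra.ι ℂ y • UniversalEnvelopingAlgebra.ι ℂ x • m
        rw [← ι_mul_sub_mul_ι, sub_smul, mul_smul, mul_smul, sub_add_cancel] }
  have hlie : ∀ (x : 𝔤) (m : U ⧸ K), ⁅x, m⁆ = UniversalEnvelopingAlgebra.ι ℂ x • m := fun _ _ => rfl
  let _ : LieModule ℂ 𝔤 (U ⧸ K) :=
    { smul_lie := fun c x m => by rw [hlie, hlie, map_smul, smul_assoc]
      lie_smul := fun c x m => by rw [hlie, hlie, smul_comm] }
  have hact : ∀ (u : U) (m : U ⧸ K), uact (𝔤 := 𝔤) (U ⧸ K) u m = u • m := by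
    have : uact (𝔤 := 𝔤) (U ⧸ K) = Algebra.lsmul ℂ ℂ (U ⧸ K) := by
      apply UniversalEnvelopingAlgebra.hom_ext
      refine LieHom.ext fun x => LinearMap.ext fun m => ?_
      change uact (U ⧸ K) (UniversalEnvelopingAlgebra.ι ℂ x) _ = _
      rw [uact_ι]
      rfl
    intro u m
    rw [this]
    rfl
  let ξ : Dual ℂ (U ⧸ K) := (K.restrictScalars ℂ).liftQ F fun u hu => by
    have := hu 1
    rwa [one_mul] at this
  have hξ : ∀ u : U, ξ (Submodule.Quotient.mk u) = F u := fun _ => rfl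
  refine ⟨U ⧸ K, _, _, _, inferInstance, Submodule.Quotient.mk 1, ξ, ⟨fun x hx => ?_, fun h => ?_⟩,
    ⟨fun x hx m => ?_, fun h m => ?_⟩, ?_, fun m => ?_, fun m hm => ?_⟩
  · rw [hlie, ← Submodule.Quotient.mk_smul, Submodule.Quotient.mk_eq_zero, hK]
    intro u
    rw [smul_eq_mul, mul_one, hF.mul_pos x hx]
  · rw [hlie, ← Submodule.Quotient.mk_smul, ← Submodule.Quotient.mk_smul, Submodule.Quotient.eq, hK]
    intro u
    rw [smul_eq_mul, mul_one, mul_sub, map_sub, hF.mul_cartan, mul_smul_comm, mul_one, map_smul,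
      smul_eq_mul, sub_self]
  · obtain ⟨u, rfl⟩ := Submodule.Quotient.mk_surjective _ m
    rw [hlie, ← Submodule.Quotient.mk_smul, hξ, smul_eq_mul, hF.neg_mul x hx]
  · obtain ⟨u, rfl⟩ := Submodule.Quotient.mk_surjective _ m
    rw [hlie, ← Submodule.Quotient.mk_smul, hξ, hξ, smul_eq_mul, hF.cartan_mul]
  · rw [hξ, hF.one]
  · obtain ⟨u, rfl⟩ := Submodule.Quotient.mk_surjective _ m
    exact ⟨u, by rw [hact, ← Submodule.Quotient.mk_smul, smul_eq_mul, mul_one]⟩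
  · obtain ⟨u, rfl⟩ := Submodule.Quotient.mk_surjective _ m
    rw [Submodule.Quotient.mk_eq_zero, hK]
    intro x
    have := hm x
    rwa [hact, ← Submodule.Quotient.mk_smul, hξ, smul_eq_mul] at this

end Irreducible

end LieDecomp

/-! ### Highest weight modules -/

namespace LieDecomp

variable {𝔤 : Type u} [LieRing 𝔤] [LieAlgebra ℂ 𝔤] [FiniteDimensional ℂ 𝔤] [LieAlgebra.IsSimple ℂ 𝔤]
  {𝔥 : LieSubalgebra ℂ 𝔤} [𝔥.IsCartanSubalgebra]

section HighestWeight

variable {M : Type*} [AddCommGroup M] [Module ℂ M] [LieRingModule 𝔤 M] [LieModule ℂ 𝔤 M]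

/-- The action as a bilinear map. -/
noncomputable def actBilin (𝔤 M : Type*) [LieRing 𝔤] [LieAlgebra ℂ 𝔤] [AddCommGroup M] [Module ℂ M]
    [LieRingModule 𝔤 M] [LieModule ℂ 𝔤 M] : 𝔤 →ₗ[ℂ] M →ₗ[ℂ] M :=
  LinearMap.mk₂ ℂ (fun x m => ⁅x, m⁆) add_lie smul_lie lie_add (fun c x m => lie_smul c x m)

theorem actBilin_apply (x : 𝔤) (m : M) : actBilin 𝔤 M x m = ⁅x, m⁆ := rfl

/-- The span of the vectors `y₁ ⋯ yₖ v`, `yᵢ ∈ 𝔫⁻`. -/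
noncomputable def layer (b : (rootSystem 𝔥).Base) (v : M) : ℕ → Submodule ℂ M
  | 0 => Submodule.span ℂ {v}
  | k + 1 => Submodule.map₂ (actBilin 𝔤 M) (nneg b) (layer b v k)

variable {b : (rootSystem 𝔥).Base} {φ : Dual ℂ 𝔥} {v : M}

theorem lie_mem_layer_succ {k : ℕ} {y : 𝔤} (hy : y ∈ nneg b) {m : M} (hm : m ∈ layer b v k) :
    ⁅y, m⁆ ∈ layer b v (k + 1) :=
  Submodule.apply_mem_map₂ (actBilin 𝔤 M) hy hm

theorem layer_le_iSup (k : ℕ) : layer b v k ≤ ⨆ k, layer b v k := le_iSup (layer b v) k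

theorem nneg_lie_mem_iSup_layer {y : 𝔤} (hy : y ∈ nneg b) {m : M} (hm : m ∈ ⨆ k, layer b v k) :
    ⁅y, m⁆ ∈ ⨆ k, layer b v k := by
  refine Submodule.iSup_induction _ (motive := fun m => ⁅y, m⁆ ∈ ⨆ k, layer b v k) hm
    (fun k m hm => layer_le_iSup (k + 1) (lie_mem_layer_succ hy hm)) (by simp) fun m n hm hn => ?_
  rw [lie_add]
  exact add_mem hm hn

/-- Only 𝔫⁻ is needed to generate: on v itself the triangular decomposition applies, and then x(ym)
= [x, y]m + y(xm) carries out the induction. -/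
theorem IsHighest.lie_layer (hv : IsHighest b φ v) (k : ℕ) :
    ∀ m ∈ layer b v k, ∀ x : 𝔤, ⁅x, m⁆ ∈ ⨆ k, layer b v k := by
  induction k with
  | zero =>
    intro m hm x
    obtain ⟨c, rfl⟩ := Submodule.mem_span_singleton.1 hm
    have h0 : v ∈ layer b v 0 := Submodule.mem_span_singleton_self v
    obtain ⟨y, hy, h, z, hz, rfl⟩ := triangular b x
    rw [lie_smul, add_lie, add_lie, hv.lie_pos z hz, hv.lie_cartan, add_zero]
    exact Submodule.smul_mem _ _ (add_mem (layer_le_iSup 1 (lie_mem_layer_succ hy h0))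
      (Submodule.smul_mem _ _ (layer_le_iSup 0 h0)))
  | succ k ih =>
    suffices h : layer b v (k + 1) ≤
        ⨅ x : 𝔤, (⨆ k, layer b v k).comap (LieModule.toEnd ℂ 𝔤 M x) by
      intro m hm x
      exact (Submodule.mem_iInf _).1 (h hm) x
    refine Submodule.map₂_le.2 fun y hy m hm => (Submodule.mem_iInf _).2 fun x => ?_
    change ⁅x, ⁅y, m⁆⁆ ∈ (⨆ k, layer b v k : Submodule ℂ M)
    rw [leibniz_lie]
    exact add_mem (ih m hm _) (nneg_lie_mem_iSup_layer hy (ih m hm x))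

/-- The submodule generated by a highest weight vector. -/
noncomputable def IsHighest.submodule (hv : IsHighest b φ v) : LieSubmodule ℂ 𝔤 M where
  toSubmodule := ⨆ k, layer b v k
  lie_mem := by
    intro x m hm
    refine Submodule.iSup_induction _ (motive := fun m => ⁅x, m⁆ ∈ ⨆ k, layer b v k) hm
      (fun k m hm => hv.lie_layer k m hm x) (by simp) fun m n hm hn => ?_
    rw [lie_add]
    exact add_mem hm hn

theorem IsHighest.mem_submodule (hv : IsHighest b φ v) : v ∈ hv.submodule :=
  layer_le_iSup 0 (Submodule.mem_span_singleton_self v)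

variable (M) in
/-- The weight space of weight `φ`. -/
def wtSpace (φ : Dual ℂ 𝔥) : Submodule ℂ M where
  carrier := {m | ∀ h : 𝔥, ⁅(h : 𝔤), m⁆ = φ h • m}
  add_mem' {m n} hm hn h := by rw [lie_add, hm h, hn h, smul_add]
  zero_mem' h := by simp
  smul_mem' c m hm h := by rw [lie_smul, hm h, smul_comm]

theorem lie_mem_wtSpace {α : 𝔥.root} {x : 𝔤} (hx : x ∈ rootSpace 𝔥 α.1) {m : M}
    (hm : m ∈ wtSpace M φ) : ⁅x, m⁆ ∈ wtSpace M (φ + (rootSystem 𝔥).root α) := by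
  intro h
  rw [leibniz_lie, hm h, lie_cartan_rootSpace hx, smul_lie, lie_smul, ← add_smul,
    LinearMap.add_apply, add_comm]

theorem pow_toEnd_mem_wtSpace {α : 𝔥.root} {x : 𝔤} (hx : x ∈ rootSpace 𝔥 α.1) {m : M}
    (hm : m ∈ wtSpace M φ) (k : ℕ) :
    (LieModule.toEnd ℂ 𝔤 M x ^ k) m ∈ wtSpace M (φ + k • (rootSystem 𝔥).root α) := by
  induction k with
  | zero => simpa using hm
  | succ k ih =>
    rw [pow_succ', Module.End.mul_apply, succ_nsmul, ← add_assoc]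
    exact lie_mem_wtSpace hx ih

/-- The vectors of a weight `φ - δ`, with `δ` a sum of simple roots of height at least `k`. -/
def lowerVectors (b : (rootSystem 𝔥).Base) (φ : Dual ℂ 𝔥) (M : Type*) [AddCommGroup M] [Module ℂ M]
    [LieRingModule 𝔤 M] [LieModule ℂ 𝔤 M] (k : ℕ) : Set M :=
  {m | ∃ δ ∈ AddSubmonoid.closure ((rootSystem 𝔥).root '' b.support),
    (∃ n : ℕ, k ≤ n ∧ δ (heightCoweight b) = n) ∧ m ∈ wtSpace M (φ - δ)}

theorem IsHighest.layer_le_span (hv : IsHighest b φ v) (k : ℕ) :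
    layer b v k ≤ Submodule.span ℂ (lowerVectors b φ M k) := by
  induction k with
  | zero =>
    refine Submodule.span_mono ?_
    rw [Set.singleton_subset_iff]
    exact ⟨0, zero_mem _, ⟨0, le_rfl, by simp⟩, by rw [sub_zero]; exact hv.lie_cartan⟩
  | succ k ih =>
    refine Submodule.map₂_le.2 fun y hy m hm => ?_
    rw [actBilin_apply]
    refine nneg_induction (p := fun y => ⁅y, m⁆ ∈ Submodule.span ℂ (lowerVectors b φ M (k + 1)))
      (fun α hα y hy => ?_) (by simp) (fun x y hx hy => by rw [add_lie]; exact add_mem hx hy) hy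
    refine Submodule.span_induction (p := fun m _ =>
      ⁅y, m⁆ ∈ Submodule.span ℂ (lowerVectors b φ M (k + 1))) ?_ (by simp)
      (fun m n _ _ hm hn => by rw [lie_add]; exact add_mem hm hn)
      (fun c m _ hm => by rw [lie_smul]; exact Submodule.smul_mem _ _ hm) (ih hm)
    rintro m ⟨δ, hδ, ⟨n, hn, hδn⟩, hm⟩
    obtain ⟨l, hl⟩ := posRoots_heightCoweight hα
    refine Submodule.subset_span ⟨δ + (rootSystem 𝔥).root α,
      add_mem hδ (root_mem_closure_of_mem_posRoots b hα), ⟨n + (l + 1), by omega, ?_⟩, ?_⟩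
    · rw [LinearMap.add_apply, hδn, hl]
      push_cast
      rfl
    · have := lie_mem_wtSpace hy hm
      rw [root_negRoot] at this
      convert this using 2
      abel

theorem lowerVectors_anti {k l : ℕ} (h : k ≤ l) : lowerVectors b φ M l ⊆ lowerVectors b φ M k := by
  rintro m ⟨δ, hδ, ⟨n, hn, hδn⟩, hm⟩
  exact ⟨δ, hδ, ⟨n, h.trans hn, hδn⟩, hm⟩

theorem wtSpace_le_genWeightSpace (φ : Dual ℂ 𝔥) :
    wtSpace M φ ≤ (LieModule.genWeightSpace M (φ : 𝔥 → ℂ)).toSubmodule := by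
  intro m hm
  refine LieModule.weightSpace_le_genWeightSpace M (φ : 𝔥 → ℂ) ?_
  rw [LieModule.mem_weightSpace]
  exact hm

/-- Generalised weight spaces are independent even in infinite dimension, so a nonzero weight vector
in a span of weight vectors has the weight of one of them. -/
theorem exists_mem_closure_of_mem_wtSpace {μ : Dual ℂ 𝔥} {m : M} (hm : m ∈ wtSpace M μ) (hm0 : m ≠ 0)
    {k : ℕ} (h : m ∈ Submodule.span ℂ (lowerVectors b φ M k)) :
    ∃ δ ∈ AddSubmonoid.closure ((rootSystem 𝔥).root '' b.support),
      (∃ n : ℕ, k ≤ n ∧ δ (heightCoweight b) = n) ∧ μ = φ - δ := by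
  by_contra! hcon
  have hind := LieSubmodule.iSupIndep_toSubmodule.2 (LieModule.iSupIndep_genWeightSpace ℂ 𝔥 M)
  have hdisj := hind (μ : 𝔥 → ℂ)
  apply hm0
  refine Submodule.disjoint_def.1 hdisj m (wtSpace_le_genWeightSpace μ hm) ?_
  refine Submodule.span_le.2 ?_ h
  rintro w ⟨δ, hδ, hn, hw⟩
  have hne : ((φ - δ : Dual ℂ 𝔥) : 𝔥 → ℂ) ≠ μ := fun h =>
    hcon δ hδ hn (DFunLike.coe_injective h).symm
  exact le_iSup₂_of_le (f := fun (χ : 𝔥 → ℂ) (_ : χ ≠ μ) =>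
    (LieModule.genWeightSpace M χ).toSubmodule) _ hne le_rfl (wtSpace_le_genWeightSpace _ hw)

theorem IsHighest.exists_of_mem_wtSpace (hv : IsHighest b φ v) {μ : Dual ℂ 𝔥} {m : M}
    (hm : m ∈ wtSpace M μ) (hm0 : m ≠ 0) (h : m ∈ hv.submodule) :
    ∃ δ ∈ AddSubmonoid.closure ((rootSystem 𝔥).root '' b.support), μ = φ - δ := by
  obtain ⟨δ, hδ, -, h'⟩ := exists_mem_closure_of_mem_wtSpace (b := b) (φ := φ) (k := 0) hm hm0
    (iSup_le (fun k => (hv.layer_le_span k).trans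
      (Submodule.span_mono (lowerVectors_anti (Nat.zero_le k)))) h)
  exact ⟨δ, hδ, h'⟩

/-- Since ad x is nilpotent, all of 𝔤 lies in its generalised 0-eigenspace, and generalised
eigenvalues add under the action. -/
theorem lie_mem_maxGenEigenspace_of_mem_rootSpace {α : 𝔥.root} {x : 𝔤} (hx : x ∈ rootSpace 𝔥 α.1)
    (y : 𝔤) {m : M} (hm : m ∈ (LieModule.toEnd ℂ 𝔤 M x).maxGenEigenspace 0) :
    ⁅y, m⁆ ∈ (LieModule.toEnd ℂ 𝔤 M x).maxGenEigenspace 0 := by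
  have hnil : IsNilpotent (LieModule.toEnd ℂ 𝔤 𝔤 x) :=
    LieAlgebra.isNilpotent_ad_of_mem_rootSpace 𝔥 (𝔥.isNonZero_coe_root α) hx
  have hy : y ∈ (LieModule.toEnd ℂ 𝔤 𝔤 x).maxGenEigenspace 0 := by
    obtain ⟨k, hk⟩ := hnil
    rw [Module.End.mem_maxGenEigenspace]
    exact ⟨k, by rw [zero_smul, sub_zero, hk]; rfl⟩
  have := LieModule.lie_mem_maxGenEigenspace_toEnd hy hm
  rwa [add_zero] at this

/-- Root vectors act locally nilpotently as soon as they act nilpotently on a generator. -/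
theorem locally_nilpotent {α : 𝔥.root} {x : 𝔤} (hx : x ∈ rootSpace 𝔥 α.1)
    (hgen : ∀ N : LieSubmodule ℂ 𝔤 M, v ∈ N → N = ⊤) {k : ℕ}
    (hk : (LieModule.toEnd ℂ 𝔤 M x ^ k) v = 0) (m : M) :
    ∃ k : ℕ, (LieModule.toEnd ℂ 𝔤 M x ^ k) m = 0 := by
  let N : LieSubmodule ℂ 𝔤 M :=
    { (LieModule.toEnd ℂ 𝔤 M x).maxGenEigenspace 0 with
      lie_mem := fun {y m} hm => lie_mem_maxGenEigenspace_of_mem_rootSpace hx y hm }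
  have hN : N = ⊤ := hgen N ((Module.End.mem_maxGenEigenspace _ _ _).2
    ⟨k, by rw [zero_smul, sub_zero, hk]⟩)
  have hm : m ∈ N := by rw [hN]; trivial
  obtain ⟨k, hk⟩ := (Module.End.mem_maxGenEigenspace _ _ _).1 hm
  rw [zero_smul, sub_zero] at hk
  exact ⟨k, hk⟩

end HighestWeight

/-! ### Weights of locally nilpotent modules over sl₂ -/

section Sl2

variable {L M : Type*} [LieRing L] [LieAlgebra ℂ L] [AddCommGroup M] [Module ℂ M]
  [LieRingModule L M] [LieModule ℂ L M] {h e f : L}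

theorem exists_pow_ne_zero_of_locally_nilpotent {T : Module.End ℂ M} (hT : ∀ m, ∃ k : ℕ, (T ^ k) m = 0)
    {m : M} (hm : m ≠ 0) : ∃ p : ℕ, (T ^ p) m ≠ 0 ∧ (T ^ (p + 1)) m = 0 :=
  Nat.exists_not_and_succ_of_not_zero_of_exists (p := fun k => (T ^ k) m = 0) (by simpa using hm)
    (hT m)

theorem primitive_eigenvalue (t : IsSl2Triple h e f) {m : M} {μ : ℂ}
    (P : t.HasPrimitiveVectorWith m μ)
    (hf : ∀ m : M, ∃ k : ℕ, (LieModule.toEnd ℂ L M f ^ k) m = 0) : ∃ n : ℕ, μ = n := by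
  obtain ⟨n, hn₁, hn₂⟩ := exists_pow_ne_zero_of_locally_nilpotent hf P.ne_zero
  refine ⟨n, ?_⟩
  have := P.lie_e_pow_succ_toEnd_f n
  rw [hn₂, lie_zero, eq_comm, smul_eq_zero_iff_left hn₁, mul_eq_zero, sub_eq_zero] at this
  exact this.resolve_left (Nat.cast_add_one_ne_zero n)

theorem exists_primitive (t : IsSl2Triple h e f) {m : M} (hm : m ≠ 0) {μ : ℂ}
    (hμ : ⁅h, m⁆ = μ • m)
    (he : ∀ m : M, ∃ k : ℕ, (LieModule.toEnd ℂ L M e ^ k) m = 0)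
    (hf : ∀ m : M, ∃ k : ℕ, (LieModule.toEnd ℂ L M f ^ k) m = 0) :
    ∃ p n : ℕ, t.HasPrimitiveVectorWith ((LieModule.toEnd ℂ L M e ^ p) m) (n : ℂ) ∧
      μ + 2 * p = n := by
  obtain ⟨p, hp₁, hp₂⟩ := exists_pow_ne_zero_of_locally_nilpotent he hm
  have P : t.HasPrimitiveVectorWith ((LieModule.toEnd ℂ L M e ^ p) m) (μ + 2 * p) :=
    { ne_zero := hp₁
      lie_h := t.lie_h_pow_toEnd_e hμ p
      lie_e := by rw [IsSl2Triple.lie_e_pow_toEnd_e, hp₂] }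
  obtain ⟨n, hn⟩ := primitive_eigenvalue t P hf
  exact ⟨p, n, hn ▸ P, hn⟩

/-- Produces a nonzero vector of the opposite weight. For z ≥ 0, raise m to a primitive vector of
weight n = z + 2p and lower it n - p ≤ n times; for z < 0, exchange the roles of e and f. -/
theorem exists_int_and_ne_zero (t : IsSl2Triple h e f) {m : M} (hm : m ≠ 0) {μ : ℂ}
    (hμ : ⁅h, m⁆ = μ • m)
    (he : ∀ m : M, ∃ k : ℕ, (LieModule.toEnd ℂ L M e ^ k) m = 0)
    (hf : ∀ m : M, ∃ k : ℕ, (LieModule.toEnd ℂ L M f ^ k) m = 0) :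
    ∃ z : ℤ, μ = z ∧ ((∃ p q : ℕ, (q : ℤ) - p = z ∧
        (LieModule.toEnd ℂ L M f ^ q) ((LieModule.toEnd ℂ L M e ^ p) m) ≠ 0) ∨
      (∃ p q : ℕ, (p : ℤ) - q = z ∧
        (LieModule.toEnd ℂ L M e ^ q) ((LieModule.toEnd ℂ L M f ^ p) m) ≠ 0)) := by
  obtain ⟨p, n, P, hpn⟩ := exists_primitive t hm hμ he hf
  have hz : μ = ((n - 2 * p : ℤ) : ℂ) := by
    push_cast
    rw [← hpn]
    ring
  refine ⟨n - 2 * p, hz, ?_⟩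
  by_cases hpos : (p : ℤ) ≤ n - p
  · refine Or.inl ⟨p, n - p, by omega, ?_⟩
    exact P.pow_toEnd_f_ne_zero_of_eq_nat rfl (by omega)
  · right
    have hμ' : ⁅-h, m⁆ = (-μ) • m := by rw [neg_lie, hμ, neg_smul]
    obtain ⟨p', n', P', hpn'⟩ := exists_primitive t.symm hm hμ' hf he
    have h1 : (-(n - 2 * p : ℤ) + 2 * p' : ℤ) = n' := by
      rw [hz] at hpn'
      exact_mod_cast hpn'
    refine ⟨p', n' - p', by omega, ?_⟩
    exact P'.pow_toEnd_f_ne_zero_of_eq_nat rfl (by omega)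

end Sl2

end LieDecomp

/-! ### Finite-dimensionality of irreducible modules with dominant integral highest weight -/

namespace LieDecomp

variable {𝔤 : Type u} [LieRing 𝔤] [LieAlgebra ℂ 𝔤] [FiniteDimensional ℂ 𝔤] [LieAlgebra.IsSimple ℂ 𝔤]
  {𝔥 : LieSubalgebra ℂ 𝔤} [𝔥.IsCartanSubalgebra]

theorem finite_closure_reflection : Finite
    (Subgroup.closure (Set.range (rootSystem 𝔥).reflection)) := by
  have hmap : ∀ g ∈ Subgroup.closure (Set.range (rootSystem 𝔥).reflection), ∀ α : 𝔥.root,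
      g ((rootSystem 𝔥).root α) ∈ Set.range (rootSystem 𝔥).root := by
    intro g hg
    induction hg using Subgroup.closure_induction'' with
    | one => exact fun α => ⟨α, rfl⟩
    | mem g hg =>
      obtain ⟨i, rfl⟩ := hg
      exact fun α => ⟨_, RootPairing.root_reflectionPerm _ i α⟩
    | inv_mem g hg =>
      obtain ⟨i, rfl⟩ := hg
      intro α
      rw [RootPairing.reflection_inv]
      exact ⟨_, RootPairing.root_reflectionPerm _ i α⟩
    | mul g g' _ _ hg hg' =>
      intro α
      obtain ⟨β, hβ⟩ := hg' α
      rw [LinearEquiv.mul_apply, ← hβ]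
      exact hg β
  refine Finite.of_injective (β := 𝔥.root → 𝔥.root) (fun g α => (hmap g.1 g.2 α).choose) ?_
  intro g g' h
  have h' : ∀ α, g.1 ((rootSystem 𝔥).root α) = g'.1 ((rootSystem 𝔥).root α) := fun α => by
    rw [← (hmap g.1 g.2 α).choose_spec, ← (hmap g'.1 g'.2 α).choose_spec]
    exact congrArg _ (congrFun h α)
  apply Subtype.ext
  apply LinearEquiv.toLinearMap_injective
  refine LinearMap.ext_on (RootPairing.IsRootSystem.span_root_eq_top (P := rootSystem 𝔥)) ?_
  rintro _ ⟨α, rfl⟩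
  exact h' α

/-- The orbit sum is fixed by every reflection, hence annihilated by every coroot. -/
theorem sum_closure_reflection [Fintype (Subgroup.closure (Set.range (rootSystem 𝔥).reflection))]
    (μ : Dual ℂ 𝔥) :
    ∑ g : Subgroup.closure (Set.range (rootSystem 𝔥).reflection), g.1 μ = 0 := by
  rw [RootPairing.eq_zero_iff_forall_coroot'_eq_zero (P := rootSystem 𝔥)]
  intro i
  set σ := ∑ g : Subgroup.closure (Set.range (rootSystem 𝔥).reflection), g.1 μ with hσ
  have h1 : (rootSystem 𝔥).reflection i σ = σ := by
    let s : Subgroup.closure (Set.range (rootSystem 𝔥).reflection) :=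
      ⟨(rootSystem 𝔥).reflection i, Subgroup.subset_closure ⟨i, rfl⟩⟩
    have h2 := Equiv.sum_comp (Equiv.mulLeft s)
      fun g : Subgroup.closure (Set.range (rootSystem 𝔥).reflection) => g.1 μ
    rw [hσ, map_sum, ← h2]
    rfl
  rw [RootPairing.reflection_apply, sub_eq_self] at h1
  exact (smul_eq_zero.1 h1).resolve_right ((rootSystem 𝔥).ne_zero i)

/-- For a weight φ - δ in `W`, sum φ - g(φ - δ) over the Weyl group: the orbit sum vanishes and
|Weyl group| · φ remains. Each summand has natural height and the one at g = 1 is δ, so the height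
of δ is bounded independently of δ. -/
theorem height_bound {b : (rootSystem 𝔥).Base} {φ : Dual ℂ 𝔥} {W : Set (Dual ℂ 𝔥)}
    (hW : ∀ i ∈ b.support, ∀ μ ∈ W, (rootSystem 𝔥).reflection i μ ∈ W)
    (hle : ∀ μ ∈ W, ∃ δ ∈ AddSubmonoid.closure ((rootSystem 𝔥).root '' b.support), μ = φ - δ) :
    ∃ K : ℕ, ∀ δ : Dual ℂ 𝔥, φ - δ ∈ W → ∀ n : ℕ, δ (heightCoweight b) = n → n ≤ K := by
  classical
  have hW' : ∀ i, ∀ μ ∈ W, (rootSystem 𝔥).reflection i μ ∈ W := by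
    intro i
    refine b.induction_reflect i
      (p := fun i => ∀ μ ∈ W, (rootSystem 𝔥).reflection i μ ∈ W) ?_ hW ?_
    · intro i hi μ hμ
      rw [RootPairing.reflection_reflectionPerm]
      exact hi _ (hi _ (hi _ hμ))
    · intro i j hi hj μ hμ
      rw [RootPairing.reflection_reflectionPerm]
      exact hW j hj _ (hi _ (hW j hj _ hμ))
  have hG : ∀ g ∈ Subgroup.closure (Set.range (rootSystem 𝔥).reflection), ∀ μ ∈ W, g μ ∈ W := by
    intro g hg
    induction hg using Subgroup.closure_induction'' with
    | one => exact fun μ hμ => hμ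
    | mem g hg =>
      obtain ⟨i, rfl⟩ := hg
      exact hW' i
    | inv_mem g hg =>
      obtain ⟨i, rfl⟩ := hg
      rw [RootPairing.reflection_inv]
      exact hW' i
    | mul g g' _ _ hg hg' => exact fun μ hμ => hg _ (hg' μ hμ)
  have := finite_closure_reflection (𝔥 := 𝔥)
  have := Fintype.ofFinite (Subgroup.closure (Set.range (rootSystem 𝔥).reflection))
  have key : ∀ δ : Dual ℂ 𝔥, φ - δ ∈ W → ∀ n : ℕ, δ (heightCoweight b) = n →
      ∃ K : ℕ, n ≤ K ∧ (K : ℂ) =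
        Fintype.card (Subgroup.closure (Set.range (rootSystem 𝔥).reflection)) *
          φ (heightCoweight b) := by
    intro δ hδ n hn
    have h1 : ∀ g : Subgroup.closure (Set.range (rootSystem 𝔥).reflection), ∃ k : ℕ,
        (φ - g.1 (φ - δ)) (heightCoweight b) = k := by
      intro g
      obtain ⟨ε, hε, h⟩ := hle _ (hG g.1 g.2 _ hδ)
      rw [h, sub_sub_cancel]
      exact exists_nat_of_mem_closure hε
    choose k hk using h1
    refine ⟨∑ g, k g, ?_, ?_⟩
    · have h2 : k 1 = n := by
        have := hk 1
        rw [← Nat.cast_inj (R := ℂ), ← this, ← hn]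
        congr 1
        exact sub_sub_cancel φ δ
      rw [← h2]
      exact Finset.single_le_sum (fun _ _ => Nat.zero_le _) (Finset.mem_univ _)
    · push_cast
      simp_rw [← hk]
      rw [← LinearMap.sum_apply, Finset.sum_sub_distrib, sum_closure_reflection, sub_zero,
        Finset.sum_const, Finset.card_univ, LinearMap.smul_apply, nsmul_eq_mul]
  by_cases hne : ∃ δ : Dual ℂ 𝔥, φ - δ ∈ W ∧ ∃ n : ℕ, δ (heightCoweight b) = n
  · obtain ⟨δ, hδ, n, hn⟩ := hne
    obtain ⟨K, -, hK⟩ := key δ hδ n hn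
    refine ⟨K, fun δ' hδ' n' hn' => ?_⟩
    obtain ⟨K', hK', hK''⟩ := key δ' hδ' n' hn'
    have : K' = K := by
      rw [← Nat.cast_inj (R := ℂ), hK'', hK]
    omega
  · exact ⟨0, fun δ hδ n hn => absurd ⟨δ, hδ, n, hn⟩ hne⟩

section

variable {M : Type u} [AddCommGroup M] [Module ℂ M] [LieRingModule 𝔤 M] [LieModule ℂ 𝔤 M]
  {b : (rootSystem 𝔥).Base} {φ : Dual ℂ 𝔥} {v : M}

theorem uact_mem (N : LieSubmodule ℂ 𝔤 M) (u : UniversalEnvelopingAlgebra ℂ 𝔤) {m : M}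
    (hm : m ∈ N) : uact M u m ∈ N := by
  let Q : Submodule ℂ (UniversalEnvelopingAlgebra ℂ 𝔤) :=
    { carrier := {u | ∀ m ∈ N, uact M u m ∈ N}
      add_mem' := fun {u u'} hu hu' m hm => by
        rw [map_add, LinearMap.add_apply]; exact add_mem (hu m hm) (hu' m hm)
      zero_mem' := fun m _ => by rw [map_zero, LinearMap.zero_apply]; exact zero_mem _
      smul_mem' := fun c u hu m hm => by
        rw [map_smul, LinearMap.smul_apply]; exact N.smul_mem _ (hu m hm) }
  refine enveloping_induction (Q := Q) (fun k => ?_) u m hm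
  induction k with
  | zero =>
    rw [pow_zero, Submodule.one_le]
    intro m hm
    rwa [map_one]
  | succ k ih =>
    rw [pow_succ', Submodule.mul_le]
    intro a ha w hw m hm
    obtain ⟨x, rfl⟩ := exists_ι_of_mem_ιRange ha
    rw [map_mul, Module.End.mul_apply, uact_ι]
    exact N.lie_mem (ih hw m hm)

/-- On a vector killed by 𝔫 the value ξ(uw) is a multiple of ξ(w), so ξ vanishes on everything that
w generates. -/
theorem eq_zero_of_singular {ξ : Dual ℂ M} (hξ : IsLowest b φ ξ)
    (hnd : ∀ m, (∀ u : UniversalEnvelopingAlgebra ℂ 𝔤, ξ (uact M u m) = 0) → m = 0) {w : M}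
    (hw : ∀ x ∈ npos b, ⁅x, w⁆ = 0) (h : ξ w = 0) : w = 0 := by
  refine hnd w fun u => ?_
  obtain ⟨P, hP⟩ := exists_polynomial b (Module.finBasis ℂ (Dual ℂ 𝔥)) u
  rw [hP M φ ξ hξ w hw, h, mul_zero]

/-- Commuting x past f leads to α - α_i, which if a root is again positive, and differs from α_i
because 2α_i is not a root. -/
theorem IsHighest.lie_pow_eq_zero (hv : IsHighest b φ v) {i : 𝔥.root} (hi : i ∈ b.support) {f : 𝔤}
    (hf : f ∈ rootSpace 𝔥 (negRoot i).1) (k : ℕ) : ∀ α ∈ posRoots b, α ≠ i →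
    ∀ x ∈ rootSpace 𝔥 α.1, ⁅x, (LieModule.toEnd ℂ 𝔤 M f ^ k) v⁆ = 0 := by
  induction k with
  | zero => exact fun α hα _ x hx => hv.lie_pos x (mem_npos hα hx)
  | succ k ih =>
    intro α hα hαi x hx
    rw [pow_succ', Module.End.mul_apply, LieModule.toEnd_apply_apply, leibniz_lie, ih α hα hαi x hx,
      lie_zero, add_zero]
    by_cases h0 : ⁅x, f⁆ = 0
    · rw [h0, zero_lie]
    · obtain ⟨γ, hγ, hxf⟩ := exists_root_eq_add hx hf h0 fun h' => hαi (by
        rw [← negRoot_negRoot i, h', negRoot_negRoot])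
      refine ih γ (posRoots_sub_simple b hα hi hγ) ?_ _ hxf
      rintro rfl
      have : IsAddTorsionFree (Dual ℂ 𝔥) := .of_isTorsionFree ℂ _
      refine (rootSystem 𝔥).nsmul_notMem_range_root (n := 2) (i := γ) ⟨α, ?_⟩
      rw [two_nsmul]
      nth_rewrite 1 [hγ]
      rw [root_negRoot]
      abel

/-- The vector fⁿ⁺¹v is singular: for α_i by the sl₂ formula, whose factor n - φ(α_i^∨) vanishes,
and for the other positive roots by the preceding lemma. The form ξ kills it since it lies in 𝔫⁻M.
-/
theorem IsHighest.pow_eq_zero (hv : IsHighest b φ v) {ξ : Dual ℂ M} (hξ : IsLowest b φ ξ)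
    (h1 : ξ v = 1)
    (hnd : ∀ m, (∀ u : UniversalEnvelopingAlgebra ℂ 𝔤, ξ (uact M u m) = 0) → m = 0)
    {i : 𝔥.root} (hi : i ∈ b.support) {e f : 𝔤} (he : e ∈ rootSpace 𝔥 i.1)
    (hf : f ∈ rootSpace 𝔥 (negRoot i).1) (t : IsSl2Triple ((rootSystem 𝔥).coroot i : 𝔤) e f)
    {n : ℕ} (hn : φ ((rootSystem 𝔥).coroot i) = n) :
    (LieModule.toEnd ℂ 𝔤 M f ^ (n + 1)) v = 0 := by
  have hipos := simple_mem_posRoots b hi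
  have P : t.HasPrimitiveVectorWith v (n : ℂ) :=
    { ne_zero := by rintro rfl; simp at h1
      lie_h := by rw [hv.lie_cartan, hn]
      lie_e := hv.lie_pos e (mem_npos hipos he) }
  refine eq_zero_of_singular hξ hnd (fun x hx => ?_) ?_
  · refine npos_induction (p := fun x => ⁅x, (LieModule.toEnd ℂ 𝔤 M f ^ (n + 1)) v⁆ = 0)
      (fun α hα x hx => ?_) (by simp) (fun x y hx hy => by rw [add_lie, hx, hy, add_zero]) hx
    by_cases h : α = i
    · subst h
      obtain ⟨c, rfl⟩ := exists_eq_smul_of_mem_rootSpace he t.e_ne_zero hx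
      rw [smul_lie, P.lie_e_pow_succ_toEnd_f]
      simp
    · exact hv.lie_pow_eq_zero hi hf _ α hα h x hx
  · rw [pow_succ', Module.End.mul_apply, LieModule.toEnd_apply_apply]
    exact hξ.lie_neg f (mem_nneg hipos hf) _

theorem reflection_weight (hgen : ∀ N : LieSubmodule ℂ 𝔤 M, v ∈ N → N = ⊤)
    {i : 𝔥.root} {e f : 𝔤} (he : e ∈ rootSpace 𝔥 i.1)
    (hf : f ∈ rootSpace 𝔥 (negRoot i).1) (t : IsSl2Triple ((rootSystem 𝔥).coroot i : 𝔤) e f)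
    {k l : ℕ} (hek : (LieModule.toEnd ℂ 𝔤 M e ^ k) v = 0)
    (hfl : (LieModule.toEnd ℂ 𝔤 M f ^ l) v = 0) {μ : Dual ℂ 𝔥} {m : M} (hm : m ∈ wtSpace M μ)
    (hm0 : m ≠ 0) : ∃ m' ∈ wtSpace M ((rootSystem 𝔥).reflection i μ), m' ≠ 0 := by
  have href : ∀ z : ℤ, μ ((rootSystem 𝔥).coroot i) = z →
      (rootSystem 𝔥).reflection i μ = μ - z • (rootSystem 𝔥).root i := by
    intro z hz
    rw [RootPairing.reflection_apply]
    congr 1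
    have : (rootSystem 𝔥).coroot' i μ = z := hz
    rw [this, Int.cast_smul_eq_zsmul]
  obtain ⟨z, hz, ⟨p, q, hpq, h⟩ | ⟨p, q, hpq, h⟩⟩ := exists_int_and_ne_zero t hm0 (hm _)
    (locally_nilpotent he hgen hek) (locally_nilpotent hf hgen hfl)
  · refine ⟨_, ?_, h⟩
    have := pow_toEnd_mem_wtSpace hf (pow_toEnd_mem_wtSpace he hm p) q
    rw [href z hz, ← hpq]
    convert this using 2
    rw [root_negRoot]
    module
  · refine ⟨_, ?_, h⟩
    have := pow_toEnd_mem_wtSpace he (pow_toEnd_mem_wtSpace hf hm p) q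
    rw [href z hz, ← hpq]
    convert this using 2
    rw [root_negRoot]
    module

theorem layer_finiteDimensional (b : (rootSystem 𝔥).Base) (v : M) (k : ℕ) :
    FiniteDimensional ℂ (layer b v k) := by
  rw [FiniteDimensional, Module.Finite.iff_fg]
  induction k with
  | zero => exact Submodule.fg_span_singleton v
  | succ k ih => exact Submodule.FG.map₂ _ (IsNoetherian.noetherian _) ih

/-- Simple root vectors act locally nilpotently, so the weights are stable under simple reflections
and their depth below φ is bounded. Layers beyond the bound vanish, and each layer has finite
dimension. -/
theorem IsHighest.finiteDimensional (hv : IsHighest b φ v) {ξ : Dual ℂ M} (hξ : IsLowest b φ ξ)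
    (h1 : ξ v = 1) (hgen : ∀ N : LieSubmodule ℂ 𝔤 M, v ∈ N → N = ⊤)
    (hnd : ∀ m, (∀ u : UniversalEnvelopingAlgebra ℂ 𝔤, ξ (uact M u m) = 0) → m = 0)
    (hφ : ∀ i ∈ b.support, ∃ n : ℕ, φ ((rootSystem 𝔥).coroot i) = n) : FiniteDimensional ℂ M := by
  have htop : hv.submodule = ⊤ := hgen _ hv.mem_submodule
  have hW : ∀ i ∈ b.support, ∀ μ ∈ {μ : Dual ℂ 𝔥 | ∃ m ∈ wtSpace M μ, m ≠ 0},
      (rootSystem 𝔥).reflection i μ ∈ {μ : Dual ℂ 𝔥 | ∃ m ∈ wtSpace M μ, m ≠ 0} := by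
    rintro i hi μ ⟨m, hm, hm0⟩
    obtain ⟨e, he, f, hf, t⟩ := exists_isSl2Triple i
    obtain ⟨n, hn⟩ := hφ i hi
    refine reflection_weight hgen he hf t (k := 1) ?_ (hv.pow_eq_zero hξ h1 hnd hi he hf t hn) hm hm0
    rw [pow_one]
    exact hv.lie_pos e (mem_npos (simple_mem_posRoots b hi) he)
  have hle : ∀ μ ∈ {μ : Dual ℂ 𝔥 | ∃ m ∈ wtSpace M μ, m ≠ 0},
      ∃ δ ∈ AddSubmonoid.closure ((rootSystem 𝔥).root '' b.support), μ = φ - δ := by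
    rintro μ ⟨m, hm, hm0⟩
    exact hv.exists_of_mem_wtSpace hm hm0 (by rw [htop]; trivial)
  obtain ⟨K, hK⟩ := height_bound hW hle
  have hbot : ∀ k, K < k → layer b v k = ⊥ := by
    intro k hk
    rw [eq_bot_iff]
    refine (hv.layer_le_span k).trans (Submodule.span_le.2 ?_)
    rintro m ⟨δ, -, ⟨n, hn, hδn⟩, hm⟩
    by_contra hm0
    have := hK δ ⟨m, hm, hm0⟩ n hδn
    omega
  have h2 : (⊤ : Submodule ℂ M) ≤ ⨆ k : Fin (K + 1), layer b v k := by
    have h3 : (⊤ : Submodule ℂ M) = ⨆ k, layer b v k := (congrArg (·.toSubmodule) htop).symm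
    rw [h3]
    refine iSup_le fun k => ?_
    by_cases hk : K < k
    · rw [hbot k hk]
      exact bot_le
    · exact le_iSup (fun k : Fin (K + 1) => layer b v k) ⟨k, by omega⟩
  have := layer_finiteDimensional b v
  have h3 : FiniteDimensional ℂ (⨆ k : Fin (K + 1), layer b v k : Submodule ℂ M) := inferInstance
  rw [top_le_iff.1 h2] at h3
  exact ⟨Module.Finite.iff_fg.1 h3⟩

end

theorem exists_finiteDimensional (b : (rootSystem 𝔥).Base) (φ : Dual ℂ 𝔥)
    (hφ : ∀ i ∈ b.support, ∃ n : ℕ, φ ((rootSystem 𝔥).coroot i) = n) :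
    ∃ (M : Type u) (_ : AddCommGroup M) (_ : Module ℂ M) (_ : LieRingModule 𝔤 M)
      (_ : LieModule ℂ 𝔤 M) (_ : FiniteDimensional ℂ M) (v : M), v ≠ 0 ∧ IsHighest b φ v := by
  obtain ⟨M, _, _, _, _, v, ξ, hv, hξ, h1, hgen, hnd⟩ := exists_irreducible b φ
  have hfin := hv.finiteDimensional hξ h1 (fun N hN => ?_) hnd hφ
  · exact ⟨M, _, _, _, inferInstance, hfin, v, by rintro rfl; simp at h1, hv⟩
  · rw [eq_top_iff]
    rintro m -
    obtain ⟨u, rfl⟩ := hgen m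
    exact uact_mem N u hN

end LieDecomp

/-! ### Every finite-dimensional module is spanned by its invariants and its coinvariant kernel -/

namespace LieDecomp

section

variable {𝔤 : Type u} [LieRing 𝔤] [LieAlgebra ℂ 𝔤] [FiniteDimensional ℂ 𝔤] [LieAlgebra.IsSimple ℂ 𝔤]

theorem top_lie_top : ⁅(⊤ : LieIdeal ℂ 𝔤), (⊤ : LieIdeal ℂ 𝔤)⁆ = ⊤ := by
  refine (LieAlgebra.IsSimple.eq_bot_or_eq_top (R := ℂ) _).resolve_left fun h => ?_
  refine LieAlgebra.IsSimple.non_abelian ℂ (L := 𝔤) ⟨fun x y => ?_⟩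
  have := LieSubmodule.lie_mem_lie (LieSubmodule.mem_top (R := ℂ) (L := 𝔤) x)
    (LieSubmodule.mem_top (R := ℂ) (L := 𝔤) y)
  rw [h] at this
  simpa using this

variable {E : Type v} [AddCommGroup E] [Module ℂ E] [LieRingModule 𝔤 E] [LieModule ℂ 𝔤 E]

/-- As 𝔤 is perfect, [y, z]m = y(zm) - z(ym) pushes 𝔤E into every term of the lower central series.
-/
theorem lie_eq_zero_of_isNilpotent [LieModule.IsNilpotent 𝔤 E] (x : 𝔤) (m : E) :
    ⁅x, m⁆ = 0 := by
  obtain ⟨k, hk⟩ := LieModule.IsNilpotent.nilpotent ℂ 𝔤 E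
  have key : ∀ k, LieModule.lowerCentralSeries ℂ 𝔤 E 1 ≤
      LieModule.lowerCentralSeries ℂ 𝔤 E k := by
    intro k
    induction k with
    | zero => simp
    | succ k ih =>
      rw [LieModule.lowerCentralSeries_succ ℂ 𝔤 E 0, LieSubmodule.lie_le_iff]
      rintro x - m -
      have hx : x ∈ ⁅(⊤ : LieIdeal ℂ 𝔤), (⊤ : LieIdeal ℂ 𝔤)⁆ := by rw [top_lie_top]; trivial
      rw [← LieSubmodule.mem_toSubmodule, LieSubmodule.lieIdeal_oper_eq_linear_span'] at hx
      have h1 : ∀ (z : 𝔤) (m : E), ⁅z, m⁆ ∈ LieModule.lowerCentralSeries ℂ 𝔤 E k := fun z m =>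
        ih (by
          rw [LieModule.lowerCentralSeries_succ]
          exact LieSubmodule.lie_mem_lie trivial (by simp))
      rw [LieModule.lowerCentralSeries_succ]
      induction hx using Submodule.span_induction with
      | mem x hx =>
        obtain ⟨y, -, z, -, rfl⟩ := hx
        rw [lie_lie]
        exact sub_mem (LieSubmodule.lie_mem_lie trivial (h1 _ _))
          (LieSubmodule.lie_mem_lie trivial (h1 _ _))
      | zero => simp
      | add x y _ _ hx hy => rw [add_lie]; exact add_mem hx hy
      | smul c x _ hx => rw [smul_lie]; exact Submodule.smul_mem _ c hx
  have h := key k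
  rw [hk, LieModule.lowerCentralSeries_succ] at h
  simpa using h (LieSubmodule.lie_mem_lie (LieSubmodule.mem_top (R := ℂ) x)
    (by simp : m ∈ LieModule.lowerCentralSeries ℂ 𝔤 E 0))

/-- Vanishing of the trace form makes E nilpotent over the derived algebra, which is all of 𝔤. -/
theorem lie_eq_zero_of_traceForm_eq_zero [FiniteDimensional ℂ E]
    (h : LieModule.traceForm ℂ 𝔤 E = 0) (x : 𝔤) (m : E) : ⁅x, m⁆ = 0 := by
  have h1 := LieModule.isNilpotent_derivedSeries_of_traceForm_eq_zero h
  have h2 : LieModule.IsNilpotent 𝔤 E := by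
    rw [LieModule.isNilpotent_iff_forall' (R := ℂ)] at h1 ⊢
    intro x
    refine h1 ⟨x, ?_⟩
    change x ∈ ⁅(⊤ : LieIdeal ℂ 𝔤), (⊤ : LieIdeal ℂ 𝔤)⁆
    rw [top_lie_top]
    trivial
  exact lie_eq_zero_of_isNilpotent x m

theorem traceForm_nondegenerate (h : LieModule.traceForm ℂ 𝔤 E ≠ 0) :
    (LieModule.traceForm ℂ 𝔤 E).Nondegenerate := by
  let I : LieIdeal ℂ 𝔤 :=
    { LinearMap.ker (LieModule.traceForm ℂ 𝔤 E) with
      lie_mem := by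
        intro x y hy
        change LieModule.traceForm ℂ 𝔤 E ⁅x, y⁆ = 0
        ext z
        rw [LieModule.traceForm_apply_lie_apply', show LieModule.traceForm ℂ 𝔤 E y = 0 from hy]
        simp }
  have hI : I = ⊥ := (LieAlgebra.IsSimple.eq_bot_or_eq_top I).resolve_right fun hI => h <| by
    ext x y
    have : x ∈ I := by rw [hI]; trivial
    rw [show LieModule.traceForm ℂ 𝔤 E x = 0 from this]
    rfl
  have hk : ∀ x, (∀ y, LieModule.traceForm ℂ 𝔤 E x y = 0) → x = 0 := by
    intro x hx
    have : x ∈ I := LinearMap.ext hx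
    rw [hI] at this
    simpa using this
  exact ⟨hk, fun x hx => hk x fun y => by rw [LieModule.traceForm_comm]; exact hx y⟩

variable (𝔤 E) in
/-- The Casimir operator of a module with nonzero trace form commutes with the action, has values in
`𝔤 E`, and is not nilpotent. -/
theorem exists_casimir [FiniteDimensional ℂ E] (h : LieModule.traceForm ℂ 𝔤 E ≠ 0) :
    ∃ Q : E →ₗ[ℂ] E, (∀ (x : 𝔤) m, Q ⁅x, m⁆ = ⁅x, Q m⁆) ∧
      (∀ m, Q m ∈ Submodule.span ℂ {e : E | ∃ (x : 𝔤) (m : E), ⁅x, m⁆ = e}) ∧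
      ¬ IsNilpotent Q := by
  have hnd := traceForm_nondegenerate h
  set B := LieModule.traceForm ℂ 𝔤 E with hB
  let e := finBasis ℂ 𝔤
  let e' := LinearMap.BilinForm.dualBasis B hnd e
  let Q : E →ₗ[ℂ] E := ∑ i, LieModule.toEnd ℂ 𝔤 E (e i) ∘ₗ LieModule.toEnd ℂ 𝔤 E (e' i)
  have hQ : ∀ m, Q m = ∑ i, ⁅e i, ⁅e' i, m⁆⁆ := fun m => by simp [Q]
  have hsymm : B.IsSymm := ⟨fun x y => LieModule.traceForm_comm ℂ 𝔤 E x y⟩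
  have he' : ∀ x : 𝔤, x = ∑ i, B x (e i) • e' i := fun x => by
    conv_lhs => rw [← e'.sum_repr x]
    exact Finset.sum_congr rfl fun i _ => by
      rw [LinearMap.BilinForm.dualBasis_repr_apply]
  have he : ∀ x : 𝔤, x = ∑ i, B x (e' i) • e i := fun x => by
    conv_lhs => rw [← e.sum_repr x]
    refine Finset.sum_congr rfl fun i _ => ?_
    congr 1
    conv_rhs => rw [← e.sum_repr x]
    simp only [map_sum, map_smul, LinearMap.sum_apply, LinearMap.smul_apply, e',
      LinearMap.BilinForm.apply_dualBasis_right hnd hsymm]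
    simp
  refine ⟨Q, fun x m => ?_, fun m => ?_, fun hn => ?_⟩
  · rw [hQ, hQ, lie_sum, ← sub_eq_zero, ← Finset.sum_sub_distrib]
    have h1 : ∀ i, ⁅e i, ⁅e' i, ⁅x, m⁆⁆⁆ - ⁅x, ⁅e i, ⁅e' i, m⁆⁆⁆ =
        -(⁅⁅x, e i⁆, ⁅e' i, m⁆⁆ + ⁅e i, ⁅⁅x, e' i⁆, m⁆⁆) := by
      intro i
      rw [leibniz_lie x (e i), leibniz_lie x (e' i) m, lie_add]
      abel
    have h2 : ∀ i, ⁅⁅x, e i⁆, ⁅e' i, m⁆⁆ = ∑ j, B ⁅x, e i⁆ (e' j) • ⁅e j, ⁅e' i, m⁆⁆ := by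
      intro i
      conv_lhs => rw [he ⁅x, e i⁆]
      simp [sum_lie]
    have h3 : ∀ i, ⁅e i, ⁅⁅x, e' i⁆, m⁆⁆ = ∑ j, B ⁅x, e' i⁆ (e j) • ⁅e i, ⁅e' j, m⁆⁆ := by
      intro i
      conv_lhs => rw [he' ⁅x, e' i⁆]
      simp [sum_lie, lie_sum]
    simp_rw [h1, h2, h3]
    rw [Finset.sum_neg_distrib, Finset.sum_add_distrib, neg_eq_zero,
      Finset.sum_comm, ← Finset.sum_add_distrib]
    refine Finset.sum_eq_zero fun j _ => ?_
    rw [← Finset.sum_add_distrib]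
    refine Finset.sum_eq_zero fun i _ => ?_
    -- Invariance of the trace form makes the coefficients of ad x in the basis and in the dual
    -- basis negative transposes, so the terms cancel in pairs.
    rw [← add_smul, hB, LieModule.traceForm_apply_lie_apply', LieModule.traceForm_comm,
      neg_add_cancel, zero_smul]
  · rw [hQ]
    exact sum_mem fun i _ => Submodule.subset_span ⟨_, _, rfl⟩
  -- Each dual pair contributes trace 1, so the trace is dim 𝔤, which is nonzero.
  · have h1 : LinearMap.trace ℂ E Q = finrank ℂ 𝔤 := by
      simp only [Q, map_sum]
      rw [Finset.sum_congr rfl (g := fun _ => (1 : ℂ)) fun i _ => by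
        rw [← LieModule.traceForm_apply_apply]
        exact (LinearMap.BilinForm.apply_dualBasis_right hnd hsymm e i i).trans (if_pos rfl)]
      simp
    have h2 := (LinearMap.isNilpotent_trace_of_isNilpotent hn).eq_zero
    rw [h1, Nat.cast_eq_zero, Module.finrank_zero_iff] at h2
    exact h (by ext x; rw [Subsingleton.elim x 0]; simp)

variable (𝔤 E) in
-- Fitting decomposition for the Casimir operator: the range of a power lies in 𝔤E, and the kernel
-- is a proper submodule handled by induction. If the trace form vanishes, everything is invariant.
theorem invariants_sup_span_lie_eq_top [FiniteDimensional ℂ E] :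
    (LieModule.maxTrivSubmodule ℂ 𝔤 E).toSubmodule ⊔
      Submodule.span ℂ {e : E | ∃ (x : 𝔤) (m : E), ⁅x, m⁆ = e} = ⊤ := by
  induction hn : finrank ℂ E using Nat.strong_induction_on generalizing E with
  | h n ih =>
  subst hn
  by_cases h : LieModule.traceForm ℂ 𝔤 E = 0
  · rw [eq_top_iff]
    intro m _
    exact Submodule.mem_sup_left fun x => lie_eq_zero_of_traceForm_eq_zero h x m
  obtain ⟨Q, hQ, hQs, hQn⟩ := exists_casimir 𝔤 E h
  -- The power used is k + 1, so that at least one factor `Q` is present to put the range inside the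
  -- span of brackets.
  obtain ⟨k, hk0, hk⟩ := (Filter.eventually_atTop.1 Q.eventually_isCompl_ker_pow_range_pow).imp
    fun k hk => And.intro (hk k le_rfl) (hk (k + 1) k.le_succ)
  have hpow : ∀ (k : ℕ) (x : 𝔤) m, (Q ^ k) ⁅x, m⁆ = ⁅x, (Q ^ k) m⁆ := by
    intro k x
    induction k with
    | zero => simp
    | succ k ihk => intro m; rw [pow_succ', Module.End.mul_apply, ihk, hQ, Module.End.mul_apply]
  let N : LieSubmodule ℂ 𝔤 E :=
    { LinearMap.ker (Q ^ (k + 1)) with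
      lie_mem := fun {x m} hm => by
        change (Q ^ (k + 1)) ⁅x, m⁆ = 0
        rw [hpow, show (Q ^ (k + 1)) m = 0 from hm, lie_zero] }
  have hN : finrank ℂ N < finrank ℂ E := by
    refine Submodule.finrank_lt (s := N.toSubmodule) fun hN => hQn ⟨k + 1, ?_⟩
    exact LinearMap.ker_eq_top.1 hN
  rw [eq_top_iff, ← hk.sup_eq_top]
  refine sup_le (fun m hm => ?_) ?_
  · have h1 : (⟨m, hm⟩ : N) ∈ (⊤ : Submodule ℂ N) := trivial
    rw [← ih _ hN N rfl] at h1
    obtain ⟨y, hy, z, hz, hyz⟩ := Submodule.mem_sup.1 h1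
    have h2 : m = (y : E) + z := (congrArg Subtype.val hyz).symm
    rw [h2]
    refine Submodule.add_mem_sup (fun x => ?_) ?_
    · exact congrArg Subtype.val (hy x)
    · have h3 := Submodule.mem_map_of_mem (f := N.toSubmodule.subtype) hz
      rw [Submodule.map_span] at h3
      refine Submodule.span_mono ?_ h3
      rintro _ ⟨_, ⟨x, w, rfl⟩, rfl⟩
      exact ⟨x, w, rfl⟩
  · rintro _ ⟨m, rfl⟩
    rw [pow_succ', Module.End.mul_apply]
    exact Submodule.mem_sup_right (hQs _)

end

end LieDecomp

/-! ### Highest weight vectors of finite-dimensional modules and the highest root -/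

namespace LieDecomp

variable {𝔤 : Type u} [LieRing 𝔤] [LieAlgebra ℂ 𝔤] [FiniteDimensional ℂ 𝔤] [LieAlgebra.IsSimple ℂ 𝔤]
  {𝔥 : LieSubalgebra ℂ 𝔤} [𝔥.IsCartanSubalgebra]

section

variable {M : Type*} [AddCommGroup M] [Module ℂ M] [LieRingModule 𝔤 M] [LieModule ℂ 𝔤 M]

variable (M) in
-- Choose a weight whose value at the sum of the fundamental coweights has maximal real part;
-- positive root vectors raise that value by a positive integer.
theorem exists_isHighest [FiniteDimensional ℂ M] [Nontrivial M] (b : (rootSystem 𝔥).Base) :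
    ∃ (φ : Dual ℂ 𝔥) (v : M), v ≠ 0 ∧ IsHighest b φ v := by
  have : Nonempty (LieModule.Weight ℂ 𝔥 M) := by
    by_contra hne
    have h := LieModule.iSup_genWeightSpace_eq_top' ℂ 𝔥 M
    rw [not_nonempty_iff] at hne
    rw [iSup_of_empty] at h
    exact bot_ne_top h
  obtain ⟨χ, hχ⟩ := Finite.exists_max
    fun χ : LieModule.Weight ℂ 𝔥 M => (χ (heightCoweight b)).re
  obtain ⟨v, hv0, hv⟩ := LieModule.exists_forall_lie_eq_smul ℂ 𝔥 M χ
  have hv' : v ∈ wtSpace M (LieModule.Weight.toLinear ℂ 𝔥 M χ) := hv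
  refine ⟨_, v, hv0, fun x hx => ?_, hv'⟩
  refine npos_induction (p := fun x => ⁅x, v⁆ = 0) (fun α hα x hx => ?_) (by simp)
    (fun x y hx hy => by rw [add_lie, hx, hy, add_zero]) hx
  by_contra hne
  have hmem := lie_mem_wtSpace hx hv'
  let ψ : LieModule.Weight ℂ 𝔥 M := ⟨_, fun h => hne <| by
    have := wtSpace_le_genWeightSpace _ hmem
    rw [h] at this
    simpa using this⟩
  obtain ⟨n, hn⟩ := posRoots_heightCoweight hα
  have h1 : ψ (heightCoweight b) = χ (heightCoweight b) + ((n + 1 : ℕ) : ℂ) := by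
    rw [← hn]
    rfl
  have h2 := hχ ψ
  rw [h1, Complex.add_re, Complex.natCast_re] at h2
  push_cast at h2
  linarith [n.cast_nonneg (α := ℝ)]

variable {b : (rootSystem 𝔥).Base} {φ : Dual ℂ 𝔥} {v : M}

theorem IsHighest.exists_nat [FiniteDimensional ℂ M] (hv : IsHighest b φ v) (hv0 : v ≠ 0)
    {α : 𝔥.root} (hα : α ∈ posRoots b) : ∃ n : ℕ, φ ((rootSystem 𝔥).coroot α) = n := by
  obtain ⟨e, he, f, -, t⟩ := exists_isSl2Triple α
  have P : t.HasPrimitiveVectorWith v (φ ((rootSystem 𝔥).coroot α)) :=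
    { ne_zero := hv0
      lie_h := hv.lie_cartan _
      lie_e := hv.lie_pos e (mem_npos hα he) }
  exact P.exists_nat

end

/-- The highest weight of the adjoint module, which is generated by its highest weight vector by
simplicity. It is nonzero, since otherwise a simple root would have height at most 0. -/
theorem exists_isHighestRoot (b : (rootSystem 𝔥).Base) : ∃ θ : 𝔥.root, IsHighestRoot b θ := by
  have : Nontrivial 𝔤 := by
    obtain ⟨i, -⟩ := base_support_nonempty b
    obtain ⟨e, -, f, -, t⟩ := exists_isSl2Triple (i : 𝔥.root)
    exact ⟨e, 0, t.e_ne_zero⟩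
  obtain ⟨φ, v, hv0, hv⟩ := exists_isHighest 𝔤 b
  have htop : hv.submodule = ⊤ := by
    refine (LieAlgebra.IsSimple.eq_bot_or_eq_top (R := ℂ) (L := 𝔤) hv.submodule).resolve_left
      fun h => hv0 ?_
    have := hv.mem_submodule
    rw [h] at this
    simpa using this
  have key : ∀ α : 𝔥.root, φ - (rootSystem 𝔥).root α ∈
      AddSubmonoid.closure ((rootSystem 𝔥).root '' b.support) := by
    intro α
    obtain ⟨e, he, f, -, t⟩ := exists_isSl2Triple α
    obtain ⟨δ, hδ, h⟩ := hv.exists_of_mem_wtSpace (M := 𝔤) (μ := (rootSystem 𝔥).root α) (m := e)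
      (fun h => lie_cartan_rootSpace he h) t.e_ne_zero (by rw [htop]; trivial)
    rw [h, sub_sub_cancel]
    exact hδ
  have hv' : v ∈ rootSpace 𝔥 (φ : 𝔥 → ℂ) :=
    wtSpace_le_genWeightSpace (M := 𝔤) φ hv.lie_cartan
  let θ : LieModule.Weight ℂ 𝔥 𝔤 := ⟨φ, fun h => hv0 <| by
    have h2 : v ∈ (⊥ : LieSubmodule ℂ 𝔥 𝔤) := h ▸ hv'
    simpa using h2⟩
  have hθ : θ ∈ 𝔥.root := by
    rw [LieSubalgebra.root, Finset.mem_filter]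
    refine ⟨Finset.mem_univ _, fun h0 => ?_⟩
    have hφ : φ = 0 := DFunLike.coe_injective h0
    obtain ⟨i, hi⟩ := base_support_nonempty b
    have := key i
    obtain ⟨n, hn⟩ := exists_nat_of_mem_closure this
    rw [hφ, LinearMap.sub_apply, simple_heightCoweight b ⟨i, hi⟩, LinearMap.zero_apply] at hn
    have h1 : ((n + 1 : ℕ) : ℂ) = 0 := by
      push_cast
      rw [← hn]
      ring
    exact absurd h1 (Nat.cast_ne_zero.2 n.succ_ne_zero)
  exact ⟨⟨θ, hθ⟩, key⟩

end LieDecomp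

/-! ### Exponentials of endomorphisms of finite-dimensional spaces -/

namespace LieDecomp

section Exp

variable {M N P : Type*} [AddCommGroup M] [Module ℂ M] [FiniteDimensional ℂ M]
  [AddCommGroup N] [Module ℂ N] [FiniteDimensional ℂ N]

open scoped Nat TensorProduct

/-- `U` is the exponential of `T`. -/
def IsExp (T U : M →ₗ[ℂ] M) : Prop :=
  ∀ (ψ : Dual ℂ M) (m : M), HasSum (fun k : ℕ => (k ! : ℂ)⁻¹ * ψ ((T ^ k) m)) (ψ (U m))

theorem IsExp.comm {T U : M →ₗ[ℂ] M} {S V : N →ₗ[ℂ] N} (h : IsExp T U) (h' : IsExp S V)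
    {f : M →ₗ[ℂ] N} (hf : ∀ m, f (T m) = S (f m)) (m : M) : f (U m) = V (f m) := by
  have hpow : ∀ (k : ℕ) m, f ((T ^ k) m) = (S ^ k) (f m) := by
    intro k
    induction k with
    | zero => simp
    | succ k ih => intro m; rw [pow_succ, Module.End.mul_apply, ih, hf, pow_succ,
        Module.End.mul_apply]
  rw [← sub_eq_zero, ← Module.forall_dual_apply_eq_zero_iff ℂ]
  intro ψ
  have h1 := h (ψ ∘ₗ f) m
  simp only [LinearMap.comp_apply, hpow] at h1
  rw [map_sub, sub_eq_zero]
  exact h1.unique (h' ψ (f m))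

theorem IsExp.apply_of_eigenvector {T U : M →ₗ[ℂ] M} (h : IsExp T U) {c : ℂ} {m : M}
    (hm : T m = c • m) : U m = Complex.exp c • m := by
  have hpow : ∀ k : ℕ, (T ^ k) m = c ^ k • m := by
    intro k
    induction k with
    | zero => simp
    | succ k ih => rw [pow_succ', Module.End.mul_apply, ih, map_smul, hm, smul_smul, pow_succ]
  rw [← sub_eq_zero, ← Module.forall_dual_apply_eq_zero_iff ℂ]
  intro ψ
  have h1 := h ψ m
  have h2 := (NormedSpace.expSeries_div_hasSum_exp c).mul_right (ψ m)
  rw [map_sub, sub_eq_zero, map_smul, smul_eq_mul, Complex.exp_eq_exp_ℂ]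
  refine h1.unique (h2.congr_fun ?_)
  intro k
  rw [hpow, map_smul, smul_eq_mul]
  ring

section

attribute [local instance] Matrix.linftyOpNormedRing Matrix.linftyOpNormedAlgebra

theorem isExp_toLin {n : ℕ} (e : Basis (Fin n) ℂ M) (A : Matrix (Fin n) (Fin n) ℂ) :
    IsExp (Matrix.toLinAlgEquiv e A) (Matrix.toLinAlgEquiv e (NormedSpace.exp A)) := by
  intro ψ m
  let F : Matrix (Fin n) (Fin n) ℂ →ₗ[ℂ] ℂ :=
    ψ ∘ₗ LinearMap.applyₗ m ∘ₗ (Matrix.toLinAlgEquiv e).toLinearMap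
  have hF : Continuous F := F.continuous_of_finiteDimensional
  have h1 := (NormedSpace.exp_series_hasSum_exp' (𝕂 := ℂ) A).map F hF
  refine h1.congr_fun ?_
  intro k
  change _ = F _
  rw [map_smul, smul_eq_mul]
  congr 1
  simp [F]

/-- Differentiate at t = 0. -/
theorem commute_of_forall_commute_exp {n : ℕ} {A Z : Matrix (Fin n) (Fin n) ℂ}
    (h : ∀ t : ℂ, Commute Z (NormedSpace.exp (t • A))) : Commute Z A := by
  have h1 := hasDerivAt_exp_smul_const (𝕂 := ℂ) A 0
  rw [zero_smul, NormedSpace.exp_zero, one_mul] at h1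
  have h2 := h1.const_mul Z
  have h3 := h1.mul_const Z
  exact (h2.congr_of_eventuallyEq (.of_forall fun t => (h t).symm)).unique h3

end

/-- The exponential of an endomorphism. -/
noncomputable def endExp (T : M →ₗ[ℂ] M) : M →ₗ[ℂ] M :=
  Matrix.toLinAlgEquiv (finBasis ℂ M)
    (NormedSpace.exp (LinearMap.toMatrixAlgEquiv (finBasis ℂ M) T))

theorem isExp_endExp (T : M →ₗ[ℂ] M) : IsExp T (endExp T) := by
  have := isExp_toLin (finBasis ℂ M) (LinearMap.toMatrixAlgEquiv (finBasis ℂ M) T)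
  rwa [Matrix.toLinAlgEquiv_toMatrixAlgEquiv] at this

theorem endExp_add_of_commute {S T : M →ₗ[ℂ] M} (h : Commute S T) :
    endExp (S + T) = endExp S ∘ₗ endExp T := by
  rw [endExp, map_add, Matrix.exp_add_of_commute, map_mul]
  · rfl
  · exact h.map (LinearMap.toMatrixAlgEquiv (finBasis ℂ M))

theorem endExp_tmul (S : M →ₗ[ℂ] M) (T : N →ₗ[ℂ] N) (m : M) (n : N) :
    endExp (TensorProduct.map S LinearMap.id + TensorProduct.map LinearMap.id T) (m ⊗ₜ n) =
      endExp S m ⊗ₜ[ℂ] endExp T n := by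
  rw [endExp_add_of_commute, LinearMap.comp_apply]
  · have h1 := (isExp_endExp T).comm (isExp_endExp
      (TensorProduct.map (LinearMap.id : M →ₗ[ℂ] M) T)) (f := TensorProduct.mk ℂ M N m)
      (fun _ => by simp) n
    have h2 := (isExp_endExp S).comm (isExp_endExp
      (TensorProduct.map S (LinearMap.id : N →ₗ[ℂ] N)))
      (f := (TensorProduct.mk ℂ M N).flip (endExp T n)) (fun _ => by simp) m
    simp only [LinearMap.flip_apply, TensorProduct.mk_apply] at h1 h2
    rw [← h1, ← h2]
  · rw [Commute, SemiconjBy, Module.End.mul_eq_comp, Module.End.mul_eq_comp,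
      ← TensorProduct.map_comp, ← TensorProduct.map_comp]
    rfl

end Exp

end LieDecomp

/-! ### The action of the simply connected group on finite-dimensional modules -/

namespace LieDecomp

section Action

attribute [local instance] LieRing.ofAssociativeRing

open scoped TensorProduct

variable {𝔤 : Type*} [LieRing 𝔤] [LieAlgebra ℂ 𝔤]

/-- The exponential map of the simply connected group. -/
noncomputable def groupExp (x : 𝔤) : simplyConnectedGroup 𝔤 :=
  ⟨expFamily x, Subgroup.subset_closure ⟨x, rfl⟩⟩

theorem group_induction {p : simplyConnectedGroup 𝔤 → Prop} (hexp : ∀ x, p (groupExp x))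
    (hmul : ∀ g h, p g → p h → p (g * h)) (hinv : ∀ g, p g → p g⁻¹) (g : simplyConnectedGroup 𝔤) :
    p g := by
  obtain ⟨g, hg⟩ := g
  induction hg using Subgroup.closure_induction with
  | mem x hx =>
    obtain ⟨x, rfl⟩ := hx
    exact hexp x
  | one =>
    have := hmul _ _ (hexp 0) (hinv _ (hexp 0))
    rwa [mul_inv_cancel] at this
  | mul x y hx hy ihx ihy => exact hmul ⟨x, hx⟩ ⟨y, hy⟩ ihx ihy
  | inv x hx ihx => exact hinv ⟨x, hx⟩ ihx

theorem groupExp_add {x y : 𝔤} (h : ⁅x, y⁆ = 0) :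
    groupExp (x + y) = groupExp x * groupExp y := by
  refine Subtype.ext (funext fun ρ => Units.ext ?_)
  change NormedSpace.exp (ρ.2 (x + y)) = NormedSpace.exp (ρ.2 x) * NormedSpace.exp (ρ.2 y)
  rw [map_add, Matrix.exp_add_of_commute]
  have h1 := ρ.2.map_lie x y
  rw [h, map_zero, LieRing.of_associative_ring_bracket] at h1
  exact (sub_eq_zero.1 h1.symm)

variable (M : Type*) [AddCommGroup M] [Module ℂ M] [FiniteDimensional ℂ M] [LieRingModule 𝔤 M]
  [LieModule ℂ 𝔤 M] {N : Type*} [AddCommGroup N] [Module ℂ N] [FiniteDimensional ℂ N]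
  [LieRingModule 𝔤 N] [LieModule ℂ 𝔤 N]

variable (𝔤) in
/-- A finite-dimensional module, as a matrix representation. -/
noncomputable def matrixRep : MatrixRep 𝔤 :=
  ⟨finrank ℂ M,
    { toFun := fun x => LinearMap.toMatrixAlgEquiv (finBasis ℂ M) (LieModule.toEnd ℂ 𝔤 M x)
      map_add' := fun x y => by rw [map_add, map_add]
      map_smul' := fun c x => by rw [map_smul, map_smul]; rfl
      map_lie' := fun {x y} => by
        rw [LieRing.of_associative_ring_bracket, LieHom.map_lie,
          LieRing.of_associative_ring_bracket, map_sub, map_mul, map_mul] }⟩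

/-- The action of the simply connected group on a finite-dimensional module. -/
noncomputable def groupAction : simplyConnectedGroup 𝔤 →* Module.End ℂ M :=
  (((Matrix.toLinAlgEquiv (finBasis ℂ M)).toAlgHom.toRingHom.toMonoidHom.comp
    (Units.coeHom (Matrix (Fin (finrank ℂ M)) (Fin (finrank ℂ M)) ℂ))).comp
    (Pi.evalMonoidHom (fun ρ : MatrixRep 𝔤 => GL (Fin ρ.1) ℂ) (matrixRep 𝔤 M))).comp
    (simplyConnectedGroup 𝔤).subtype

theorem groupAction_groupExp (x : 𝔤) :
    groupAction M (groupExp x) = endExp (LieModule.toEnd ℂ 𝔤 M x) := rfl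

theorem isExp_groupAction (x : 𝔤) :
    IsExp (LieModule.toEnd ℂ 𝔤 M x) (groupAction M (groupExp x)) := isExp_endExp _

variable {M}

theorem groupAction_inv_apply (g : simplyConnectedGroup 𝔤) (m : M) :
    groupAction M g⁻¹ (groupAction M g m) = m := by
  rw [← Module.End.mul_apply, ← map_mul, inv_mul_cancel, map_one, Module.End.one_apply]

theorem groupAction_apply_inv (g : simplyConnectedGroup 𝔤) (m : M) :
    groupAction M g (groupAction M g⁻¹ m) = m := by
  rw [← Module.End.mul_apply, ← map_mul, mul_inv_cancel, map_one, Module.End.one_apply]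

theorem groupAction_comm {f : M →ₗ[ℂ] N} (hf : ∀ (x : 𝔤) m, f ⁅x, m⁆ = ⁅x, f m⁆)
    (g : simplyConnectedGroup 𝔤) : ∀ m, f (groupAction M g m) = groupAction N g (f m) := by
  refine group_induction (p := fun g => ∀ m, f (groupAction M g m) = groupAction N g (f m))
    (fun x m => ?_) (fun g h hg hh m => ?_) (fun g hg m => ?_) g
  · exact (isExp_groupAction M x).comm (isExp_groupAction N x) (hf x) m
  · rw [map_mul, Module.End.mul_apply, hg, hh, map_mul, Module.End.mul_apply]
  · rw [← groupAction_inv_apply g (f (groupAction M g⁻¹ m)), ← hg, groupAction_apply_inv]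

theorem groupAction_tmul (g : simplyConnectedGroup 𝔤) : ∀ (m : M) (n : N),
    groupAction (M ⊗[ℂ] N) g (m ⊗ₜ n) = groupAction M g m ⊗ₜ groupAction N g n := by
  refine group_induction (p := fun g => ∀ (m : M) (n : N), groupAction (M ⊗[ℂ] N) g (m ⊗ₜ n) =
    groupAction M g m ⊗ₜ groupAction N g n) (fun x m n => ?_) (fun g h hg hh m n => ?_)
    (fun g hg m n => ?_) g
  · rw [groupAction_groupExp, groupAction_groupExp, groupAction_groupExp, ← endExp_tmul]
    congr 2
  · simp only [map_mul, Module.End.mul_apply, hg, hh]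
  · rw [← groupAction_inv_apply g (groupAction M g⁻¹ m ⊗ₜ[ℂ] groupAction N g⁻¹ n), hg,
      groupAction_apply_inv, groupAction_apply_inv]

theorem groupAction_matrix {ρ : MatrixRep 𝔤} {f : (Fin ρ.1 → ℂ) →ₗ[ℂ] M}
    (hf : ∀ x w, f ((ρ.2 x).mulVec w) = ⁅x, f w⁆) (g : simplyConnectedGroup 𝔤) :
    ∀ w, f ((g.1 ρ : Matrix (Fin ρ.1) (Fin ρ.1) ℂ).mulVec w) = groupAction M g (f w) := by
  refine group_induction (p := fun g => ∀ w,
    f ((g.1 ρ : Matrix (Fin ρ.1) (Fin ρ.1) ℂ).mulVec w) = groupAction M g (f w)) (fun x w => ?_) (fun g h hg hh w => ?_) (fun g hg w => ?_) g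
  · have happ : ∀ (A : Matrix (Fin ρ.1) (Fin ρ.1) ℂ) w,
        Matrix.toLinAlgEquiv (Pi.basisFun ℂ (Fin ρ.1)) A w = A.mulVec w := fun A w => by
      change Matrix.toLin (Pi.basisFun ℂ (Fin ρ.1)) (Pi.basisFun ℂ (Fin ρ.1)) A w = _
      rw [Matrix.toLin_eq_toLin', Matrix.toLin'_apply]
    have h1 := (isExp_toLin (Pi.basisFun ℂ (Fin ρ.1)) (ρ.2 x)).comm (isExp_groupAction M x)
      (f := f) (fun w => by rw [happ]; exact hf x w) w
    rwa [happ] at h1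
  · have : (((g * h).1 ρ : GL (Fin ρ.1) ℂ) : Matrix (Fin ρ.1) (Fin ρ.1) ℂ) =
      (g.1 ρ : Matrix (Fin ρ.1) (Fin ρ.1) ℂ) * (h.1 ρ : Matrix (Fin ρ.1) (Fin ρ.1) ℂ) := rfl
    rw [this, ← Matrix.mulVec_mulVec, hg, hh, map_mul, Module.End.mul_apply]
  · rw [← groupAction_inv_apply g (f _), ← hg, Matrix.mulVec_mulVec]
    have : (g.1 ρ : Matrix (Fin ρ.1) (Fin ρ.1) ℂ) *
      (((g⁻¹).1 ρ : GL (Fin ρ.1) ℂ) : Matrix (Fin ρ.1) (Fin ρ.1) ℂ) = 1 :=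
      Units.mul_inv (g.1 ρ)
    rw [this, Matrix.one_mulVec]

/-- The group acts faithfully on the product of all finite-dimensional modules. -/
theorem eq_one_of_groupAction_eq_one {g : simplyConnectedGroup 𝔤}
    (h : ∀ (M : Type) [AddCommGroup M] [Module ℂ M] [FiniteDimensional ℂ M] [LieRingModule 𝔤 M]
      [LieModule ℂ 𝔤 M], groupAction M g = 1) : g = 1 := by
  refine Subtype.ext (funext fun ρ => Units.ext ?_)
  let _ : LieRingModule 𝔤 (Fin ρ.1 → ℂ) :=
    { bracket := fun x w => (ρ.2 x).mulVec w
      add_lie := fun x y w => by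
        change (ρ.2 (x + y)).mulVec w = (ρ.2 x).mulVec w + (ρ.2 y).mulVec w
        rw [map_add, Matrix.add_mulVec]
      lie_add := fun x v w => Matrix.mulVec_add _ _ _
      leibniz_lie := fun x y w => by
        change (ρ.2 x).mulVec ((ρ.2 y).mulVec w) =
          (ρ.2 ⁅x, y⁆).mulVec w + (ρ.2 y).mulVec ((ρ.2 x).mulVec w)
        rw [LieHom.map_lie, LieRing.of_associative_ring_bracket, Matrix.sub_mulVec,
          Matrix.mulVec_mulVec, Matrix.mulVec_mulVec, sub_add_cancel] }
  let _ : LieModule ℂ 𝔤 (Fin ρ.1 → ℂ) :=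
    { smul_lie := fun c x w => by
        change (ρ.2 (c • x)).mulVec w = c • (ρ.2 x).mulVec w
        rw [map_smul, Matrix.smul_mulVec]
      lie_smul := fun c x w => Matrix.mulVec_smul _ _ _ }
  have h1 := groupAction_matrix (ρ := ρ) (f := LinearMap.id) (fun x w => rfl) g
  rw [h (Fin ρ.1 → ℂ)] at h1
  refine Matrix.ext_of_mulVec_single fun i => ?_
  exact (h1 _).trans (Matrix.one_mulVec _).symm

/-- Central elements act by intertwining operators. -/
theorem groupAction_lie_of_mem_center {z : simplyConnectedGroup 𝔤}
    (hz : z ∈ Subgroup.center (simplyConnectedGroup 𝔤)) (x : 𝔤) (m : M) :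
    groupAction M z ⁅x, m⁆ = ⁅x, groupAction M z m⁆ := by
  have h1 : Commute (LinearMap.toMatrixAlgEquiv (finBasis ℂ M) (groupAction M z))
      (LinearMap.toMatrixAlgEquiv (finBasis ℂ M) (LieModule.toEnd ℂ 𝔤 M x)) := by
    refine commute_of_forall_commute_exp fun t => ?_
    have h2 : Commute (groupAction M z) (groupAction M (groupExp (t • x))) :=
      by
      rw [Commute, SemiconjBy, ← map_mul, ← map_mul, Subgroup.mem_center_iff.1 hz]
    have h3 := h2.map (LinearMap.toMatrixAlgEquiv (finBasis ℂ M))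
    rwa [groupAction_groupExp, endExp, LinearMap.toMatrixAlgEquiv_toLinAlgEquiv, map_smul,
      map_smul] at h3
  have h2 : Commute (groupAction M z) (LieModule.toEnd ℂ 𝔤 M x) :=
    (LinearMap.toMatrixAlgEquiv (finBasis ℂ M)).injective (by rw [map_mul, map_mul]; exact h1)
  exact LinearMap.congr_fun h2 m

/-- The action of each g commutes with every intertwining operator, in particular with the action of
z, so the commutator acts trivially on all modules. -/
theorem mem_center_of_groupExp_comm {z : simplyConnectedGroup 𝔤}
    (h : ∀ (M : Type) [AddCommGroup M] [Module ℂ M] [FiniteDimensional ℂ M] [LieRingModule 𝔤 M]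
      [LieModule ℂ 𝔤 M] (x : 𝔤) (m : M), groupAction M z ⁅x, m⁆ = ⁅x, groupAction M z m⁆) :
    z ∈ Subgroup.center (simplyConnectedGroup 𝔤) := by
  rw [Subgroup.mem_center_iff]
  intro g
  rw [← mul_inv_eq_one, mul_inv_rev, ← mul_assoc]
  refine eq_one_of_groupAction_eq_one fun M _ _ _ _ _ => LinearMap.ext fun m => ?_
  have h1 := groupAction_comm (h M) g
  rw [map_mul, map_mul, map_mul, Module.End.mul_apply, Module.End.mul_apply, Module.End.mul_apply,
    ← h1, groupAction_apply_inv, groupAction_apply_inv, Module.End.one_apply]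

end Action

end LieDecomp

/-! ### Central elements acting trivially on highest weight vectors -/

namespace LieDecomp

open scoped TensorProduct

variable {𝔤 : Type*} [LieRing 𝔤] [LieAlgebra ℂ 𝔤] [FiniteDimensional ℂ 𝔤] [LieAlgebra.IsSimple ℂ 𝔤]
  {𝔥 : LieSubalgebra ℂ 𝔤} [𝔥.IsCartanSubalgebra] {b : (rootSystem 𝔥).Base}

section

variable {M : Type*} [AddCommGroup M] [Module ℂ M] [FiniteDimensional ℂ M] [LieRingModule 𝔤 M]
  [LieModule ℂ 𝔤 M]

theorem groupAction_mem (P : LieSubmodule ℂ 𝔤 M) (g : simplyConnectedGroup 𝔤) {m : M} (hm : m ∈ P) :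
    groupAction M g m ∈ P := by
  have h := groupAction_comm (f := (P.incl : P →ₗ[ℂ] M)) (fun x m => rfl) g (⟨m, hm⟩ : P)
  exact h ▸ (groupAction P g ⟨m, hm⟩).2

theorem IsHighest.coe {P : LieSubmodule ℂ 𝔤 M} {φ : Dual ℂ 𝔥} {v : P}
    (hv : IsHighest b φ v) : IsHighest b φ (v : M) where
  lie_pos x hx := congrArg Subtype.val (hv.lie_pos x hx)
  lie_cartan h := congrArg Subtype.val (hv.lie_cartan h)

/-- An endomorphism commuting with the action and killing all highest weight vectors is
nilpotent. -/
theorem isNilpotent_of_forall_isHighest (b : (rootSystem 𝔥).Base) {T : Module.End ℂ M}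
    (hT : ∀ (x : 𝔤) m, T ⁅x, m⁆ = ⁅x, T m⁆)
    (h : ∀ (φ : Dual ℂ 𝔥) (v : M), IsHighest b φ v → T v = 0) : IsNilpotent T := by
  have h1 : ∀ μ : ℂ, μ ≠ 0 → T.maxGenEigenspace μ = ⊥ := by
    intro μ hμ
    by_contra hne
    -- An eigenspace with nonzero eigenvalue is a submodule. If nonzero, it would contain a highest
    -- weight vector, which T does not kill.
    let P : LieSubmodule ℂ 𝔤 M :=
      { Module.End.eigenspace T μ with
        lie_mem := fun {x m} hm => by
          change ⁅x, m⁆ ∈ Module.End.eigenspace T μ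
          rw [Module.End.mem_eigenspace_iff, hT,
            show T m = μ • m from Module.End.mem_eigenspace_iff.1 hm, lie_smul] }
    have hP : Nontrivial P := by
      refine (Submodule.nontrivial_iff_ne_bot (p := P.toSubmodule)).2 fun h0 => hne ?_
      rw [eq_bot_iff]
      intro m hm
      obtain ⟨k, hk⟩ := (Module.End.mem_maxGenEigenspace _ _ _).1 hm
      have hinj : Function.Injective ⇑(T - μ • 1 : Module.End ℂ M) := by
        rw [← LinearMap.ker_eq_bot, ← Module.End.eigenspace_def]
        exact h0
      have : Function.Injective ⇑((T - μ • 1 : Module.End ℂ M) ^ k) := by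
        rw [Module.End.coe_pow]
        exact hinj.iterate k
      exact this (hk.trans (map_zero _).symm)
    obtain ⟨φ, v, hv0, hv⟩ := exists_isHighest P b
    have h2 := h φ v (hv.coe)
    rw [show T v = μ • (v : M) from Module.End.mem_eigenspace_iff.1 v.2] at h2
    exact (smul_ne_zero hμ (by simpa using hv0)) h2
  have h2 : T.maxGenEigenspace 0 = ⊤ := by
    rw [← Module.End.iSup_maxGenEigenspace_eq_top T]
    refine le_antisymm (le_iSup T.maxGenEigenspace 0) (iSup_le fun μ => ?_)
    by_cases hμ : μ = 0
    · rw [hμ]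
    · rw [h1 μ hμ]
      exact bot_le
  rw [Module.End.isNilpotent_iff_of_finite]
  intro m
  obtain ⟨k, hk⟩ := (Module.End.mem_maxGenEigenspace _ _ _).1 (h2 ▸ trivial : m ∈ T.maxGenEigenspace 0)
  exact ⟨k, by rwa [zero_smul, sub_zero] at hk⟩

/-- Test against rank one operators. -/
theorem eq_zero_of_forall_trace_mul_eq_zero {T : M →ₗ[ℂ] M}
    (h : ∀ S : M →ₗ[ℂ] M, LinearMap.trace ℂ M (T * S) = 0) : T = 0 := by
  ext m
  rw [LinearMap.zero_apply, ← Module.forall_dual_apply_eq_zero_iff ℂ]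
  intro ψ
  have h1 : T * LinearMap.smulRight ψ m = LinearMap.smulRight ψ (T m) := by
    ext n
    simp
  rw [← LinearMap.trace_smulRight, ← h1, h]

/-- A central element acting trivially on all highest weight vectors acts trivially. -/
theorem groupAction_eq_one_of_mem_center {z : simplyConnectedGroup 𝔤}
    (hz : z ∈ Subgroup.center (simplyConnectedGroup 𝔤))
    (h : ∀ (φ : Dual ℂ 𝔥) (v : M), IsHighest b φ v → groupAction M z v = v) :
    groupAction M z = 1 := by
  set T : M →ₗ[ℂ] M := groupAction M z - 1 with hTdef
  have hT : ∀ (x : 𝔤) m, T ⁅x, m⁆ = ⁅x, T m⁆ := fun x m => by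
    simp only [hTdef, LinearMap.sub_apply, Module.End.one_apply, lie_sub,
      groupAction_lie_of_mem_center hz]
  have hnil : IsNilpotent T := isNilpotent_of_forall_isHighest b hT fun φ v hv => by
    rw [hTdef, LinearMap.sub_apply, h φ v hv, Module.End.one_apply, sub_self]
  rw [← sub_eq_zero]
  refine eq_zero_of_forall_trace_mul_eq_zero fun S => ?_
  -- Split S into an intertwiner R and brackets. T commutes with R, because every group element
  -- does, so TR is nilpotent and has trace 0. Against [x, R] the trace vanishes by cyclicity, since
  -- T commutes with x.
  have hS : S ∈ (LieModule.maxTrivSubmodule ℂ 𝔤 (M →ₗ[ℂ] M)).toSubmodule ⊔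
      Submodule.span ℂ {e : M →ₗ[ℂ] M | ∃ (x : 𝔤) (m : M →ₗ[ℂ] M), ⁅x, m⁆ = e} := by
    rw [invariants_sup_span_lie_eq_top]
    trivial
  suffices hle : (LieModule.maxTrivSubmodule ℂ 𝔤 (M →ₗ[ℂ] M)).toSubmodule ⊔
      Submodule.span ℂ {e : M →ₗ[ℂ] M | ∃ (x : 𝔤) (m : M →ₗ[ℂ] M), ⁅x, m⁆ = e} ≤
      LinearMap.ker (LinearMap.trace ℂ M ∘ₗ LinearMap.mulLeft ℂ T) from hle hS
  refine sup_le (fun R hR => ?_) (Submodule.span_le.2 ?_)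
  · have hR' : ∀ (x : 𝔤) m, R ⁅x, m⁆ = ⁅x, R m⁆ := fun x m => by
      have h1 := LinearMap.congr_fun (hR x) m
      rw [LieHom.lie_apply, LinearMap.zero_apply, sub_eq_zero] at h1
      exact h1.symm
    have hcomm : Commute T R := LinearMap.ext fun m => by
      have := groupAction_comm hR' z m
      simp only [hTdef, Module.End.mul_apply, LinearMap.sub_apply, Module.End.one_apply, map_sub,
        this]
    exact (LinearMap.isNilpotent_trace_of_isNilpotent (hcomm.isNilpotent_mul_right hnil)).eq_zero
  · rintro _ ⟨x, R, rfl⟩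
    change LinearMap.trace ℂ M (T * ⁅x, R⁆) = 0
    have h1 : ⁅x, R⁆ = LieModule.toEnd ℂ 𝔤 M x * R - R * LieModule.toEnd ℂ 𝔤 M x := by
      ext m
      simp
    have h2 : T * LieModule.toEnd ℂ 𝔤 M x = LieModule.toEnd ℂ 𝔤 M x * T :=
      LinearMap.ext fun m => by simp [hT]
    rw [h1, mul_sub, map_sub, ← mul_assoc, ← mul_assoc, h2, mul_assoc, LinearMap.trace_mul_comm,
      sub_self]

end

theorem eq_one_of_mem_center {z : simplyConnectedGroup 𝔤}
    (hz : z ∈ Subgroup.center (simplyConnectedGroup 𝔤))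
    (h : ∀ (M : Type) [AddCommGroup M] [Module ℂ M] [FiniteDimensional ℂ M] [LieRingModule 𝔤 M]
      [LieModule ℂ 𝔤 M] (φ : Dual ℂ 𝔥) (v : M), IsHighest b φ v → groupAction M z v = v) : z = 1 :=
  eq_one_of_groupAction_eq_one fun M _ _ _ _ _ =>
    groupAction_eq_one_of_mem_center (b := b) hz (h M)

end LieDecomp

/-! ### Central characters -/

namespace LieDecomp

open scoped TensorProduct

section ProductModule

variable {𝔤 M N : Type*} [LieRing 𝔤] [LieAlgebra ℂ 𝔤] [AddCommGroup M] [Module ℂ M]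
  [LieRingModule 𝔤 M] [LieModule ℂ 𝔤 M] [AddCommGroup N] [Module ℂ N] [LieRingModule 𝔤 N]
  [LieModule ℂ 𝔤 N]

instance prodLieRingModule : LieRingModule 𝔤 (M × N) where
  bracket x m := (⁅x, m.1⁆, ⁅x, m.2⁆)
  add_lie x y m := Prod.ext (add_lie x y m.1) (add_lie x y m.2)
  lie_add x m n := Prod.ext (lie_add x m.1 n.1) (lie_add x m.2 n.2)
  leibniz_lie x y m := Prod.ext (leibniz_lie x y m.1) (leibniz_lie x y m.2)

instance prodLieModule : LieModule ℂ 𝔤 (M × N) where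
  smul_lie c x m := Prod.ext (smul_lie c x m.1) (smul_lie c x m.2)
  lie_smul c x m := Prod.ext (lie_smul c x m.1) (lie_smul c x m.2)

end ProductModule

section

variable {𝔤 : Type u} [LieRing 𝔤] [LieAlgebra ℂ 𝔤] [FiniteDimensional ℂ 𝔤] [LieAlgebra.IsSimple ℂ 𝔤]
  {𝔥 : LieSubalgebra ℂ 𝔤} [𝔥.IsCartanSubalgebra] {b : (rootSystem 𝔥).Base} {φ ψ : Dual ℂ 𝔥}

section

variable {M : Type v} [AddCommGroup M] [Module ℂ M] [LieRingModule 𝔤 M] [LieModule ℂ 𝔤 M]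
  {N : Type w} [AddCommGroup N] [Module ℂ N] [LieRingModule 𝔤 N] [LieModule ℂ 𝔤 N]

theorem IsHighest.prod {v : M} {w : N} (hv : IsHighest b φ v) (hw : IsHighest b φ w) :
    IsHighest b φ (v, w) where
  lie_pos x hx := Prod.ext (hv.lie_pos x hx) (hw.lie_pos x hx)
  lie_cartan h := Prod.ext (hv.lie_cartan h) (hw.lie_cartan h)

/-- The highest weight space of the module generated by a highest weight vector is a line. -/
theorem IsHighest.exists_eq_smul {v : M} (hv : IsHighest b φ v) {m : M} (hm : m ∈ hv.submodule)
    (hmφ : m ∈ wtSpace M φ) : ∃ c : ℂ, m = c • v := by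
  have hle : (⨆ k, layer b v k : Submodule ℂ M) ≤
      Submodule.span ℂ {v} ⊔ Submodule.span ℂ (lowerVectors b φ M 1) := by
    refine iSup_le fun k => ?_
    cases k with
    | zero => exact le_sup_left
    | succ k =>
      exact ((hv.layer_le_span (k + 1)).trans
        (Submodule.span_mono (lowerVectors_anti (Nat.le_add_left 1 k)))).trans le_sup_right
  obtain ⟨y, hy, w, hw, hyw⟩ := Submodule.mem_sup.1 (hle hm)
  obtain ⟨c, rfl⟩ := Submodule.mem_span_singleton.1 hy
  refine ⟨c, ?_⟩
  have hwφ : w ∈ wtSpace M φ := by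
    have : w = m - c • v := by rw [← hyw, add_sub_cancel_left]
    rw [this]
    exact sub_mem hmφ (Submodule.smul_mem _ c hv.lie_cartan)
  by_cases hw0 : w = 0
  · rw [← hyw, hw0, add_zero]
  obtain ⟨δ, -, ⟨n, hn, hδn⟩, hδ⟩ := exists_mem_closure_of_mem_wtSpace hwφ hw0 hw
  rw [sub_eq_self.1 hδ.symm, LinearMap.zero_apply, eq_comm, Nat.cast_eq_zero] at hδn
  omega

variable [FiniteDimensional ℂ M] [FiniteDimensional ℂ N]
  {z : simplyConnectedGroup 𝔤}

theorem IsHighest.exists_groupAction_eq_smul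
    (hz : z ∈ Subgroup.center (simplyConnectedGroup 𝔤)) {v : M} (hv : IsHighest b φ v) :
    ∃ c : ℂ, groupAction M z v = c • v :=
  hv.exists_eq_smul (groupAction_mem _ z hv.mem_submodule) fun h => by
    rw [← groupAction_lie_of_mem_center hz, hv.lie_cartan, map_smul]

/-- The vector (v, w) generates a highest weight submodule of M × N in which the weight φ occurs on
a line only, so z acts on both components by one scalar. -/
theorem IsHighest.groupAction_eq_smul_of_weight_eq
    (hz : z ∈ Subgroup.center (simplyConnectedGroup 𝔤)) {v : M} {w : N} (hv : IsHighest b φ v)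
    (hw : IsHighest b φ w) (hv0 : v ≠ 0) {c : ℂ} (hc : groupAction M z v = c • v) :
    groupAction N z w = c • w := by
  obtain ⟨d, hd⟩ := (hv.prod hw).exists_groupAction_eq_smul hz
  have h1 := groupAction_comm (f := LinearMap.fst ℂ M N) (fun (x : 𝔤) m => rfl) z (v, w)
  have h2 := groupAction_comm (f := LinearMap.snd ℂ M N) (fun (x : 𝔤) m => rfl) z (v, w)
  rw [hd, map_smul, LinearMap.fst_apply, hc] at h1
  rw [hd, map_smul, LinearMap.snd_apply] at h2
  rw [← h2, smul_left_injective ℂ hv0 h1]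

end

/-- The central element `z` acts on highest weight vectors of weight `φ` as the scalar `c`. -/
def HasCentralCharacter (b : (rootSystem 𝔥).Base) (z : simplyConnectedGroup 𝔤) (φ : Dual ℂ 𝔥)
    (c : ℂ) : Prop :=
  ∃ (M : Type u) (_ : AddCommGroup M) (_ : Module ℂ M) (_ : LieRingModule 𝔤 M)
    (_ : LieModule ℂ 𝔤 M) (_ : FiniteDimensional ℂ M) (v : M), v ≠ 0 ∧ IsHighest b φ v ∧
      groupAction M z v = c • v

variable {z : simplyConnectedGroup 𝔤} {c d : ℂ}

theorem HasCentralCharacter.groupAction_eq (h : HasCentralCharacter b z φ c)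
    (hz : z ∈ Subgroup.center (simplyConnectedGroup 𝔤)) {M : Type v} [AddCommGroup M]
    [Module ℂ M] [LieRingModule 𝔤 M] [LieModule ℂ 𝔤 M] [FiniteDimensional ℂ M] {v : M}
    (hv : IsHighest b φ v) : groupAction M z v = c • v := by
  obtain ⟨N, _, _, _, _, _, w, hw0, hw, hc⟩ := h
  exact hw.groupAction_eq_smul_of_weight_eq hz hv hw0 hc

theorem HasCentralCharacter.unique (h : HasCentralCharacter b z φ c)
    (h' : HasCentralCharacter b z φ d) (hz : z ∈ Subgroup.center (simplyConnectedGroup 𝔤)) :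
    c = d := by
  obtain ⟨M, _, _, _, _, _, v, hv0, hv, hd⟩ := h'
  exact smul_left_injective ℂ hv0 ((h.groupAction_eq hz hv).symm.trans hd)

theorem tmul_ne_zero {M N : Type*} [AddCommGroup M] [Module ℂ M] [AddCommGroup N] [Module ℂ N]
    {m : M} {n : N} (hm : m ≠ 0) (hn : n ≠ 0) : m ⊗ₜ[ℂ] n ≠ 0 := by
  intro h
  refine hm ((Module.forall_dual_apply_eq_zero_iff ℂ m).1 fun ψ => ?_)
  have h1 : TensorProduct.lid ℂ N (TensorProduct.map ψ LinearMap.id (m ⊗ₜ[ℂ] n)) = ψ m • n := by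
    simp
  rw [h, map_zero, map_zero] at h1
  exact (smul_eq_zero.1 h1.symm).resolve_right hn

theorem HasCentralCharacter.add (h : HasCentralCharacter b z φ c)
    (h' : HasCentralCharacter b z ψ d) : HasCentralCharacter b z (φ + ψ) (c * d) := by
  obtain ⟨M, _, _, _, _, _, v, hv0, hv, hc⟩ := h
  obtain ⟨N, _, _, _, _, _, w, hw0, hw, hd⟩ := h'
  refine ⟨M ⊗[ℂ] N, inferInstance, inferInstance, inferInstance, inferInstance, inferInstance,
    v ⊗ₜ w, tmul_ne_zero hv0 hw0, hv.tmul hw, ?_⟩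
  rw [groupAction_tmul, hc, hd, TensorProduct.smul_tmul_smul]

theorem exists_hasCentralCharacter (hz : z ∈ Subgroup.center (simplyConnectedGroup 𝔤))
    (hφ : ∀ i ∈ b.support, ∃ n : ℕ, φ ((rootSystem 𝔥).coroot i) = n) :
    ∃ c ≠ 0, HasCentralCharacter b z φ c := by
  obtain ⟨M, _, _, _, _, _, v, hv0, hv⟩ := exists_finiteDimensional b φ hφ
  obtain ⟨c, hc⟩ := hv.exists_groupAction_eq_smul hz
  refine ⟨c, ?_, M, _, _, _, _, inferInstance, v, hv0, hv, hc⟩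
  rintro rfl
  rw [zero_smul] at hc
  have := groupAction_inv_apply z v
  rw [hc, map_zero] at this
  exact hv0 this.symm

/-- The scalar c is nonzero and satisfies c² = c, as 0 + 0 = 0. -/
theorem hasCentralCharacter_zero (hz : z ∈ Subgroup.center (simplyConnectedGroup 𝔤)) :
    HasCentralCharacter b z 0 1 := by
  obtain ⟨c, hc0, hc⟩ := exists_hasCentralCharacter (b := b) (φ := 0) hz fun i _ => ⟨0, by simp⟩
  have h := hc.add hc
  rw [add_zero] at h
  rw [(mul_eq_left₀ hc0).1 (h.unique hc hz)] at hc
  exact hc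

theorem hasCentralCharacter_groupExp {h : 𝔥}
    (hφ : ∀ i ∈ b.support, ∃ n : ℕ, φ ((rootSystem 𝔥).coroot i) = n) :
    HasCentralCharacter b (groupExp (h : 𝔤)) φ (Complex.exp (φ h)) := by
  obtain ⟨M, _, _, _, _, _, v, hv0, hv⟩ := exists_finiteDimensional b φ hφ
  exact ⟨M, _, _, _, _, inferInstance, v, hv0, hv,
    (isExp_groupAction M (h : 𝔤)).apply_of_eigenvector (hv.lie_cartan h)⟩

end

end LieDecomp

/-! ### The centre of the simply connected group -/

namespace LieDecomp

open scoped TensorProduct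

variable {𝔤 : Type u} [LieRing 𝔤] [LieAlgebra ℂ 𝔤] [FiniteDimensional ℂ 𝔤] [LieAlgebra.IsSimple ℂ 𝔤]
  {𝔥 : LieSubalgebra ℂ 𝔤} [𝔥.IsCartanSubalgebra] {b : (rootSystem 𝔥).Base} {φ : Dual ℂ 𝔥}

/-- The fundamental weights. -/
noncomputable def fundWeight (b : (rootSystem 𝔥).Base) (i : b.support) : Dual ℂ 𝔥 :=
  b.toCoweightBasis.coord i

theorem fundWeight_coroot (i j : b.support) :
    fundWeight b i ((rootSystem 𝔥).coroot j) = Finsupp.single j (1 : ℂ) i := by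
  rw [fundWeight, Basis.coord_apply, RootPairing.Base.toCoweightBasis_repr_coroot]

theorem exists_nat_fundWeight_coroot (i : b.support) :
    ∀ j ∈ b.support, ∃ n : ℕ, fundWeight b i ((rootSystem 𝔥).coroot j) = n := by
  intro j hj
  rw [fundWeight_coroot i ⟨j, hj⟩]
  by_cases h : (⟨j, hj⟩ : b.support) = i
  · exact ⟨1, by simp [h]⟩
  · exact ⟨0, by simp [h]⟩

theorem eq_sum_fundWeight_smul_coroot (b : (rootSystem 𝔥).Base) (h : 𝔥) :
    h = ∑ i, fundWeight b i h • (rootSystem 𝔥).coroot (i : 𝔥.root) := by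
  conv_lhs => rw [← b.toCoweightBasis.sum_repr h]
  exact Finset.sum_congr rfl fun i _ => by
    rw [RootPairing.Base.toCoweightBasis_apply, fundWeight, Basis.coord_apply]

theorem mem_closure_range_fundWeight
    (hφ : ∀ i ∈ b.support, ∃ n : ℕ, φ ((rootSystem 𝔥).coroot i) = n) :
    φ ∈ AddSubmonoid.closure (Set.range (fundWeight b)) := by
  choose n hn using fun i : b.support => hφ i i.2
  have h : φ = ∑ i, n i • fundWeight b i := by
    refine b.toCoweightBasis.ext fun j => ?_
    rw [RootPairing.Base.toCoweightBasis_apply, hn, LinearMap.sum_apply,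
      Finset.sum_eq_single j]
    · rw [LinearMap.smul_apply, fundWeight_coroot]
      simp
    · intro i _ hij
      rw [LinearMap.smul_apply, fundWeight_coroot]
      simp [hij]
    · simp
  rw [h]
  exact sum_mem fun i _ => nsmul_mem (AddSubmonoid.subset_closure (Set.mem_range_self i)) _

/-- The element `exp (2πi h)` of the simply connected group. -/
noncomputable def coweightExp (h : 𝔥) : simplyConnectedGroup 𝔤 :=
  groupExp (((2 * Real.pi * Complex.I) • h : 𝔥) : 𝔤)

theorem coweightExp_add (h k : 𝔥) : coweightExp (h + k) = coweightExp h * coweightExp k := by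
  rw [coweightExp, smul_add, coweightExp, coweightExp]
  exact groupExp_add (lie_cartan_cartan _ _)

theorem groupAction_coweightExp {M : Type*} [AddCommGroup M] [Module ℂ M] [LieRingModule 𝔤 M]
    [LieModule ℂ 𝔤 M] [FiniteDimensional ℂ M] {m : M} {h : 𝔥} {c : ℂ}
    (hm : ⁅(h : 𝔤), m⁆ = c • m) :
    groupAction M (coweightExp h) m = Complex.exp (c * (2 * Real.pi * Complex.I)) • m := by
  refine (isExp_groupAction M _).apply_of_eigenvector ?_
  change ⁅(2 * Real.pi * Complex.I) • (h : 𝔤), m⁆ = _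
  rw [smul_lie, hm, smul_smul, mul_comm]

theorem groupAction_coweightExp_of_int {M : Type*} [AddCommGroup M] [Module ℂ M]
    [LieRingModule 𝔤 M] [LieModule ℂ 𝔤 M] [FiniteDimensional ℂ M] {m : M} {h : 𝔥} {n : ℤ}
    (hm : ⁅(h : 𝔤), m⁆ = (n : ℂ) • m) : groupAction M (coweightExp h) m = m := by
  rw [groupAction_coweightExp hm, Complex.exp_int_mul_two_pi_mul_I, one_smul]

theorem groupAction_coweightExp_adjoint {h : 𝔥} (hh : h ∈ coweightLattice b) (x : 𝔤) :
    groupAction 𝔤 (coweightExp h) x = x := by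
  have hroot : ∀ (α : 𝔥.root) (x : 𝔤), x ∈ rootSpace 𝔥 α.1 →
      groupAction 𝔤 (coweightExp h) x = x := by
    intro α x hx
    obtain ⟨n, hn⟩ := (mem_coweightLattice_iff b).1 hh α
    refine groupAction_coweightExp_of_int (n := n) ?_
    rw [lie_cartan_rootSpace hx, ← hn]
    rfl
  have hadd : ∀ x y, groupAction 𝔤 (coweightExp h) x = x → groupAction 𝔤 (coweightExp h) y = y →
      groupAction 𝔤 (coweightExp h) (x + y) = x + y := fun x y hx hy => by rw [map_add, hx, hy]
  obtain ⟨y, hy, k, w, hw, rfl⟩ := triangular b x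
  refine hadd _ _ (hadd _ _ ?_ ?_) ?_
  · exact nneg_induction (p := fun y => groupAction 𝔤 (coweightExp h) y = y)
      (fun α _ x hx => hroot _ x hx) (map_zero _) hadd hy
  · refine groupAction_coweightExp_of_int (n := 0) ?_
    rw [lie_cartan_cartan]
    simp
  · exact npos_induction (p := fun y => groupAction 𝔤 (coweightExp h) y = y)
      (fun α _ x hx => hroot _ x hx) (map_zero _) hadd hw

/-- The action map 𝔤 ⊗ M → M is equivariant, and exp(2πi h) acts trivially on 𝔤; hence it commutes
with 𝔤 on M. -/
theorem coweightExp_mem_center {h : 𝔥} (hh : h ∈ coweightLattice b) :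
    coweightExp h ∈ Subgroup.center (simplyConnectedGroup 𝔤) := by
  refine mem_center_of_groupExp_comm fun M _ _ _ _ _ x m => ?_
  have h1 := groupAction_comm (f := (LieModule.toModuleHom ℂ 𝔤 M : 𝔤 ⊗[ℂ] M →ₗ[ℂ] M))
    (fun x m => (LieModule.toModuleHom ℂ 𝔤 M).map_lie x m) (coweightExp h) (x ⊗ₜ m)
  rw [groupAction_tmul, groupAction_coweightExp_adjoint hh] at h1
  simpa using h1.symm

theorem hasCentralCharacter_coweightExp (h : 𝔥)
    (hφ : ∀ i ∈ b.support, ∃ n : ℕ, φ ((rootSystem 𝔥).coroot i) = n) :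
    HasCentralCharacter b (coweightExp h) φ (Complex.exp (φ h * (2 * Real.pi * Complex.I))) := by
  have := hasCentralCharacter_groupExp (h := (2 * Real.pi * Complex.I) • h) hφ
  rwa [map_smul, smul_eq_mul, mul_comm _ (φ h)] at this

theorem IsHighest.weight_mem {M : Type*} [AddCommGroup M] [Module ℂ M] [LieRingModule 𝔤 M]
    [LieModule ℂ 𝔤 M] [FiniteDimensional ℂ M] {v : M} (hv : IsHighest b φ v) (hv0 : v ≠ 0) :
    ∀ i ∈ b.support, ∃ n : ℕ, φ ((rootSystem 𝔥).coroot i) = n :=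
  fun _ hi => hv.exists_nat hv0 (simple_mem_posRoots b hi)

theorem coroot_negRoot (α : 𝔥.root) :
    (rootSystem 𝔥).coroot (negRoot α) = -(rootSystem 𝔥).coroot α := by
  rw [negRoot, RootPairing.coroot_reflectionPerm, RootPairing.coreflection_apply_self]

theorem IsHighest.exists_int {M : Type*} [AddCommGroup M] [Module ℂ M] [LieRingModule 𝔤 M]
    [LieModule ℂ 𝔤 M] [FiniteDimensional ℂ M] {v : M} (hv : IsHighest b φ v) (hv0 : v ≠ 0) {h : 𝔥}
    (hh : h ∈ corootLattice 𝔥) : ∃ n : ℤ, φ h = n := by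
  induction hh using AddSubgroup.closure_induction with
  | mem x hx =>
    obtain ⟨α, rfl⟩ := hx
    by_cases hα : α ∈ posRoots b
    · obtain ⟨n, hn⟩ := hv.exists_nat hv0 hα
      exact ⟨n, by exact_mod_cast hn⟩
    · obtain ⟨n, hn⟩ := hv.exists_nat hv0 ((negRoot_mem_posRoots_iff b α).2 hα)
      rw [coroot_negRoot, map_neg, neg_eq_iff_eq_neg] at hn
      exact ⟨-n, by rw [hn]; simp⟩
  | zero => exact ⟨0, by simp⟩
  | add x y _ _ hx hy =>
    obtain ⟨m, hm⟩ := hx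
    obtain ⟨n, hn⟩ := hy
    exact ⟨m + n, by rw [map_add, hm, hn, Int.cast_add]⟩
  | neg x _ hx =>
    obtain ⟨m, hm⟩ := hx
    exact ⟨-m, by rw [map_neg, hm, Int.cast_neg]⟩

/-- If exp(2πi h) = 1, the modules with fundamental highest weights show that the coordinates of h
in the simple coroots are integers. Conversely, highest weights of finite-dimensional modules are
integral on the coroot lattice. -/
theorem coweightExp_eq_one_iff {h : 𝔥} (hh : h ∈ coweightLattice b) :
    (coweightExp h : simplyConnectedGroup 𝔤) = 1 ↔ h ∈ corootLattice 𝔥 := by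
  have hz := coweightExp_mem_center hh
  constructor
  · intro h1
    rw [eq_sum_fundWeight_smul_coroot b h]
    refine sum_mem fun i _ => ?_
    obtain ⟨M, _, _, _, _, _, v, hv0, hv, hc⟩ :=
      hasCentralCharacter_coweightExp h (exists_nat_fundWeight_coroot i)
    rw [h1, map_one, Module.End.one_apply] at hc
    have h2 : Complex.exp (fundWeight b i h * (2 * Real.pi * Complex.I)) = 1 :=
      smul_left_injective ℂ hv0 (hc.symm.trans (one_smul ℂ v).symm)
    obtain ⟨n, hn⟩ := Complex.exp_eq_one_iff.1 h2
    rw [mul_right_cancel₀ Complex.two_pi_I_ne_zero hn, Int.cast_smul_eq_zsmul]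
    exact zsmul_mem (AddSubgroup.subset_closure (Set.mem_range_self _)) n
  · intro h1
    refine eq_one_of_mem_center (b := b) hz fun M _ _ _ _ _ φ v hv => ?_
    by_cases hv0 : v = 0
    · rw [hv0, map_zero]
    obtain ⟨n, hn⟩ := hv.exists_int hv0 h1
    exact groupAction_coweightExp_of_int (n := n) (by rw [hv.lie_cartan, hn])

theorem mem_coweightLattice_of_simple {τ : 𝔥}
    (h : ∀ i ∈ b.support, ∃ n : ℤ, (rootSystem 𝔥).root i τ = n) : τ ∈ coweightLattice b := by
  rw [eq_sum_fundCoweight b τ]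
  refine sum_mem fun i _ => ?_
  obtain ⟨n, hn⟩ := h i i.2
  rw [root_apply] at hn
  rw [hn, Int.cast_smul_eq_zsmul]
  exact AddSubgroup.zsmul_mem _ (AddSubgroup.subset_closure (Set.mem_range_self i)) n

/-- Logarithms of the scalars on the fundamental weights give the coordinates of h; multiplicativity
in φ extends the formula to all dominant integral weights. -/
theorem exists_cartan_hasCentralCharacter (b : (rootSystem 𝔥).Base) {z : simplyConnectedGroup 𝔤}
    (hz : z ∈ Subgroup.center (simplyConnectedGroup 𝔤)) :
    ∃ h : 𝔥, ∀ φ : Dual ℂ 𝔥, (∀ i ∈ b.support, ∃ n : ℕ, φ ((rootSystem 𝔥).coroot i) = n) →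
      HasCentralCharacter b z φ (Complex.exp (φ h * (2 * Real.pi * Complex.I))) := by
  choose c hc0 hc using fun i : b.support =>
    exists_hasCentralCharacter (b := b) (φ := fundWeight b i) hz (exists_nat_fundWeight_coroot i)
  let h : 𝔥 := ∑ i, ((2 * Real.pi * Complex.I)⁻¹ * Complex.log (c i)) •
    (rootSystem 𝔥).coroot (i : 𝔥.root)
  refine ⟨h, fun φ hφ => ?_⟩
  have hmem := mem_closure_range_fundWeight hφ
  clear hφ
  induction hmem using AddSubmonoid.closure_induction with
  | mem x hx =>
    obtain ⟨i, rfl⟩ := hx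
    have h1 : fundWeight b i h * (2 * Real.pi * Complex.I) = Complex.log (c i) := by
      rw [map_sum, Finset.sum_eq_single i]
      · rw [map_smul, fundWeight_coroot, Finsupp.single_eq_same, smul_eq_mul, mul_one, mul_comm,
          mul_inv_cancel_left₀ Complex.two_pi_I_ne_zero]
      · intro j _ hj
        rw [map_smul, fundWeight_coroot]
        simp [hj.symm]
      · simp
    rw [h1, Complex.exp_log (hc0 i)]
    exact hc i
  | zero =>
    rw [LinearMap.zero_apply, zero_mul, Complex.exp_zero]
    exact hasCentralCharacter_zero hz
  | add φ ψ _ _ hφ hψ =>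
    rw [LinearMap.add_apply, add_mul, Complex.exp_add]
    exact hφ.add hψ

end LieDecomp

/-! ### The order of the centre -/

namespace LieDecomp

open scoped TensorProduct

variable {𝔤 : Type u} [LieRing 𝔤] [LieAlgebra ℂ 𝔤] [FiniteDimensional ℂ 𝔤] [LieAlgebra.IsSimple ℂ 𝔤]
  {𝔥 : LieSubalgebra ℂ 𝔤} [𝔥.IsCartanSubalgebra] {b : (rootSystem 𝔥).Base} {φ : Dual ℂ 𝔥}

theorem tmul_sub_tmul_ne_zero {M : Type*} [AddCommGroup M] [Module ℂ M] [LieRingModule 𝔤 M]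
    [LieModule ℂ 𝔤 M] {x : 𝔤} {v w : M} (hv0 : v ≠ 0) (hw0 : w ≠ 0) {c d : ℂ} (hcd : c ≠ d)
    (hv : ⁅x, v⁆ = c • v) (hw : ⁅x, w⁆ = d • w) : v ⊗ₜ[ℂ] w - w ⊗ₜ[ℂ] v ≠ 0 := by
  intro h
  have h1 := congrArg (TensorProduct.map (LieModule.toEnd ℂ 𝔤 M x) LinearMap.id) h
  rw [map_sub, TensorProduct.map_tmul, TensorProduct.map_tmul, LieModule.toEnd_apply_apply,
    LieModule.toEnd_apply_apply, hv, hw, map_zero, ← TensorProduct.smul_tmul',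
    ← TensorProduct.smul_tmul', LinearMap.id_apply, LinearMap.id_apply, ← sub_eq_zero.1 h,
    ← sub_smul] at h1
  exact (smul_ne_zero (sub_ne_zero.2 hcd) (tmul_ne_zero hv0 hw0)) h1

/-- With φ the fundamental weight of i, the tensor square has a highest weight vector of weight 2φ -
α_i, and z acts on it by the square of its scalar for φ. Comparison gives exp(2πi α_i(h)) = 1, so
α_i(h) is an integer. -/
theorem exists_coweight_hasCentralCharacter (b : (rootSystem 𝔥).Base)
    {z : simplyConnectedGroup 𝔤} (hz : z ∈ Subgroup.center (simplyConnectedGroup 𝔤)) :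
    ∃ h ∈ coweightLattice b, ∀ φ : Dual ℂ 𝔥,
      (∀ i ∈ b.support, ∃ n : ℕ, φ ((rootSystem 𝔥).coroot i) = n) →
      HasCentralCharacter b z φ (Complex.exp (φ h * (2 * Real.pi * Complex.I))) := by
  obtain ⟨h, hh⟩ := exists_cartan_hasCentralCharacter b hz
  refine ⟨h, mem_coweightLattice_of_simple fun i hi => ?_, hh⟩
  obtain ⟨M, _, _, _, _, _, v, hv0, hv, hc⟩ :=
    hh (fundWeight b ⟨i, hi⟩) (exists_nat_fundWeight_coroot _)
  set φ := fundWeight b ⟨i, hi⟩ with hφ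
  obtain ⟨e, he, f, hf, t⟩ := exists_isSl2Triple i
  have hφi : φ ((rootSystem 𝔥).coroot i) = 1 := by
    rw [hφ, fundWeight_coroot ⟨i, hi⟩ ⟨i, hi⟩, Finsupp.single_eq_same]
  have hev : ⁅e, v⁆ = 0 := hv.lie_pos e (mem_npos (simple_mem_posRoots b hi) he)
  have hw0 : ⁅f, v⁆ ≠ 0 := by
    intro h0
    have h1 := lie_lie e f v
    rw [t.lie_e_f, h0, hev, lie_zero, lie_zero, sub_zero, hv.lie_cartan, hφi, one_smul] at h1
    exact hv0 h1
  have hcw : ⁅(((rootSystem 𝔥).coroot i : 𝔥) : 𝔤), ⁅f, v⁆⁆ = (-1 : ℂ) • ⁅f, v⁆ := by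
    rw [leibniz_lie, t.lie_h_f_nsmul, hv.lie_cartan, hφi, one_smul, neg_lie, nsmul_lie]
    module
  -- The two factors have eigenvalues 1 and -1 under the coroot, so they are independent.
  have hu0 : v ⊗ₜ[ℂ] ⁅f, v⁆ - ⁅f, v⁆ ⊗ₜ[ℂ] v ≠ 0 :=
    tmul_sub_tmul_ne_zero (c := 1) (d := -1) hv0 hw0 (by norm_num)
      (by rw [hv.lie_cartan, hφi]) hcw
  have hu := hv.tmul_sub_tmul hi hf
  have hzu := (hh _ (hu.weight_mem hu0)).groupAction_eq hz hu
  rw [map_sub, groupAction_tmul, groupAction_tmul, groupAction_lie_of_mem_center hz, hc, lie_smul,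
    TensorProduct.smul_tmul_smul, TensorProduct.smul_tmul_smul, ← smul_sub] at hzu
  have h2 := smul_left_injective ℂ hu0 hzu
  rw [← Complex.exp_add, LinearMap.sub_apply, LinearMap.add_apply] at h2
  have h3 : Complex.exp ((rootSystem 𝔥).root i h * (2 * Real.pi * Complex.I)) = 1 := by
    rw [show (rootSystem 𝔥).root i h * (2 * Real.pi * Complex.I) =
      (φ h * (2 * Real.pi * Complex.I) + φ h * (2 * Real.pi * Complex.I)) -
      (φ h + φ h - (rootSystem 𝔥).root i h) * (2 * Real.pi * Complex.I) by ring,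
      Complex.exp_sub, h2, div_self (Complex.exp_ne_zero _)]
  obtain ⟨n, hn⟩ := Complex.exp_eq_one_iff.1 h3
  exact ⟨n, mul_right_cancel₀ Complex.two_pi_I_ne_zero hn⟩

/-- Every central element is the exponential of a coweight. -/
theorem exists_coweightExp_eq (b : (rootSystem 𝔥).Base) {z : simplyConnectedGroup 𝔤}
    (hz : z ∈ Subgroup.center (simplyConnectedGroup 𝔤)) :
    ∃ h ∈ coweightLattice b, coweightExp h = z := by
  obtain ⟨h, hh, hc⟩ := exists_coweight_hasCentralCharacter b hz
  refine ⟨h, hh, ?_⟩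
  have hz' := coweightExp_mem_center hh
  rw [← inv_mul_eq_one]
  refine eq_one_of_mem_center (b := b) (mul_mem (inv_mem hz') hz) fun M _ _ _ _ _ φ v hv => ?_
  by_cases hv0 : v = 0
  · rw [hv0, map_zero]
  rw [map_mul, Module.End.mul_apply, (hc φ (hv.weight_mem hv0)).groupAction_eq hz hv,
    ← groupAction_coweightExp (hv.lie_cartan h), groupAction_inv_apply]

/-- The homomorphism from the coweight lattice onto the centre. -/
noncomputable def coweightExpHom (b : (rootSystem 𝔥).Base) :
    coweightLattice b →+ Additive (Cent 𝔤) where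
  toFun h := Additive.ofMul ⟨coweightExp h.1, coweightExp_mem_center h.2⟩
  map_zero' := congrArg Additive.ofMul <| Subtype.ext <|
    (coweightExp_eq_one_iff (zero_mem (coweightLattice b))).2 (zero_mem _)
  map_add' h k := congrArg Additive.ofMul <| Subtype.ext <| coweightExp_add h.1 k.1

theorem card_center (b : (rootSystem 𝔥).Base) :
    Nat.card (Cent 𝔤) = (corootLattice 𝔥).relIndex (coweightLattice b) := by
  have hker : (coweightExpHom b).ker = (corootLattice 𝔥).addSubgroupOf (coweightLattice b) := by
    ext h
    rw [AddMonoidHom.mem_ker, AddSubgroup.mem_addSubgroupOf, ← coweightExp_eq_one_iff h.2,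
      ← ofMul_one, coweightExpHom, AddMonoidHom.coe_mk, ZeroHom.coe_mk,
      Additive.ofMul.injective.eq_iff]
    exact Subtype.ext_iff
  have hrange : (coweightExpHom b).range = ⊤ := by
    rw [AddMonoidHom.range_eq_top]
    intro z
    obtain ⟨h, hh, hz⟩ := exists_coweightExp_eq b z.toMul.2
    exact ⟨⟨h, hh⟩, congrArg Additive.ofMul (Subtype.ext hz)⟩
  rw [AddSubgroup.relIndex, ← hker, AddSubgroup.index_ker, hrange, AddSubgroup.card_top]
  rfl

theorem finite_center (b : (rootSystem 𝔥).Base) : Finite (Cent 𝔤) :=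
  Nat.finite_of_card_ne_zero (by rw [card_center b]; exact relIndex_ne_zero b)

end LieDecomp

theorem corollary3p11 {𝔤 : Type*} [LieRing 𝔤] [LieAlgebra ℂ 𝔤] [FiniteDimensional ℂ 𝔤]
    [LieAlgebra.IsSimple ℂ 𝔤] (𝔥 : LieSubalgebra ℂ 𝔤) [𝔥.IsCartanSubalgebra]
    (b : (LieAlgebra.IsKilling.rootSystem 𝔥).Base) (𝔦 : Submodule ℂ 𝔤)
    (h𝔦 : LieDecomp.IsAbelianIdeal b 𝔦) :
    Finite (LieDecomp.Cent 𝔤) ∧ (LieDecomp.decompositions b 𝔦).Finite ∧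
      ((LieDecomp.decompositions b 𝔦).ncard : ℤ) =
        (Nat.card (LieDecomp.Cent 𝔤) : ℤ) - ((LieDecomp.C b 𝔦).ncard : ℤ) := by
  obtain ⟨θ, hθ⟩ := LieDecomp.exists_isHighestRoot b
  obtain ⟨hfin, hcard⟩ := LieDecomp.decompositions_finite_and_ncard hθ h𝔦
  refine ⟨LieDecomp.finite_center b, hfin, ?_⟩
  rw [LieDecomp.card_center b, ← hcard]
  push_cast
  ring
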